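/- **Setting.** Let $U\subset\mathbb R^m$ be open (a coordinate patch of the target) with smooth $\pi^{ij}=-\pi^{ji}$ and a smooth closed 3-form $H=\tfrac1{3!}H_{ijk}dx^idx^jdx^k$ such that $\tfrac12[\pi,\pi]=\pi^\sharp(H)$, i.e. $\pi^{il}\partial_l\pi^{jk}+\pi^{jl}\partial_l\pi^{ki}+\pi^{kl}\partial_l\pi^{ij}=\pi^{ai}\pi^{bj}\pi^{ck}H_{abc}$. Put $\Theta^i_{jk}=\pi^{il}H_{jkl}$ and $\Sigma=S^1\times S^1=\partial N$, $N=D\times S^1$, with coordinates $(\sigma^0,\sigma^1)$ on $\Sigma$, where $\sigma^1$ is the angle on $\partial D$. The BV fields are a smooth map $X:N\to U$ and smooth fields on $\Sigma$ with values in a finite-dimensional graded-commutative real algebra: $c_i$ (ghost number $1$), $A_i=\theta^\mu A_{\mu i}$ ($0$), $A^{+i}=\theta^\mu A^{+i}_\mu$ ($-1$), $X^+_i=\theta^1\theta^0X^+_{10\,i}$ ($-1$), $c^{+i}=\theta^1\theta^0c^{+i}_{10}$ ($-2$). They form the superfields $\boldsymbol X^i=X^i-A^{+i}+c^{+i}$,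 $\boldsymbol A_i=-c_i+A_i+X^+_i$ on $T[1]\Sigma$. Write $\boldsymbol d_\mu=\theta^\mu\partial_\mu$, $\boldsymbol\varepsilon_\mu=\theta^\mu\partial/\partial\theta^\mu$ (no sum), $\boldsymbol d=\boldsymbol d_0+\boldsymbol d_1$, $\boldsymbol\varepsilon=\boldsymbol\varepsilon_0+\boldsymbol\varepsilon_1$, $\int d^2\theta\,\theta^1\theta^0=1$, $\int=\int_{T[1]\Sigma}d^2\sigma\,d^2\theta$, $\mathrm{WZ}=\int_NX^*H$, and $\mathcal L_0=\boldsymbol A_i\boldsymbol d\boldsymbol X^i+\tfrac12\pi^{ij}(\boldsymbol X)\boldsymbol A_i\boldsymbol A_j$. For a 2-form $\omega$ on field space, $\omega(V,W)=\iota_W\iota_V\omega$ for ghost-number-zero tangent vectors. The Grigoriev–Damgaard (GD) data are $$\omega^{GD}=\int\big[\delta\boldsymbol X^i\delta\boldsymbol A_i+\tfrac12H_{ijk}(\boldsymbol X)\,\boldsymbol d_1\boldsymbol X^i\,\delta\boldsymbol X^j\delta\boldsymbol X^k\big],$$ $$S^{GD}=\int\big[\mathcal L_0+\tfrac12(\pi^{il}\pi^{jm}H_{klm})(\boldsymbol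 X)\boldsymbol A_i\boldsymbol A_j\boldsymbol\varepsilon_1\boldsymbol X^k\big]+\mathrm{WZ},$$ the covariant data are $\omega=\int\delta\boldsymbol X^i\delta\boldsymbol A_i$ and $$S^{cov}=\int\big[\mathcal L_0+\tfrac14(\pi^{il}\pi^{jm}H_{lmk})(\boldsymbol X)\boldsymbol A_i\boldsymbol A_j\boldsymbol\varepsilon\boldsymbol X^k+\tfrac12(\pi^{il}H_{jkl})(\boldsymbol X)\boldsymbol A_i(\boldsymbol d\boldsymbol X^j)\boldsymbol\varepsilon\boldsymbol X^k-\tfrac18(\pi^{im}\pi^{jn}\pi^{pq}H_{mql}H_{npk})(\boldsymbol X)\boldsymbol A_i\boldsymbol A_j(\boldsymbol\varepsilon\boldsymbol X^k)\boldsymbol\varepsilon\boldsymbol X^l\big]+\mathrm{WZ},$$ and the classical action is $S^{cl}=\int_\Sigma(A_i\wedge dX^i+\tfrac12\pi^{ij}A_i\wedge A_j)+\int_NX^*H$, $\Sigma$ carrying the boundary orientation. **Theorem.** 1. The map $T_1:(\boldsymbol X,\boldsymbol A)\mapsto(\boldsymbol X,\boldsymbol A')$, $\boldsymbol A'_i=\boldsymbol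 A_i+H_{ijk}(\boldsymbol X)(\boldsymbol\varepsilon_0\boldsymbol X^j)\boldsymbol d_1\boldsymbol X^k$, is a bijection of the space of fields. In components it changes only $X^+$, by $X^{+\prime}_{10\,i}=X^+_{10\,i}+H_{ijk}(X)\,\partial_1X^j\,A_0^{+k}$. It brings the GD form into Darboux form: $T_1^*\omega=\omega^{GD}$. It transforms the action into $$S'=\int\big[\mathcal L_0+\tfrac12(\pi^{il}\pi^{jm}H_{klm})(\boldsymbol X)\boldsymbol A_i\boldsymbol A_j\boldsymbol\varepsilon_1\boldsymbol X^k-(\pi^{ij}H_{jkl})(\boldsymbol X)\boldsymbol A_i(\boldsymbol\varepsilon_0\boldsymbol X^k)\boldsymbol d_1\boldsymbol X^l\big]+\mathrm{WZ},$$ that is, $S^{GD}=S'\circ T_1$. On fields with vanishing antifields $S^{GD}$, $S'$ and $S^{cov}$ all equal $S^{cl}$. 2. The map $T_2:(\boldsymbol X,\boldsymbol A)\mapsto(\boldsymbol X'',\boldsymbol A'')$ given by $$\boldsymbol X''^i=\boldsymbol X^i+\tfrac12\Theta^i_{jk}(\boldsymbol X)(\boldsymbol\varepsilon_0\boldsymbol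 X^j)(\boldsymbol\varepsilon_1\boldsymbol X^k),$$ $$\boldsymbol A''_i=\boldsymbol A_i+\tfrac12\Theta^j_{ki}(\boldsymbol X)\big[-(\boldsymbol\varepsilon_0\boldsymbol X^k)(1-\boldsymbol\varepsilon_1)\boldsymbol A_j+(\boldsymbol\varepsilon_1\boldsymbol X^k)(1-\boldsymbol\varepsilon_0)\boldsymbol A_j\big]-\tfrac12(\partial_i\Theta^j_{kl}-\partial_l\Theta^j_{ki}+\partial_k\Theta^j_{li})(\boldsymbol X)(\boldsymbol\varepsilon_0\boldsymbol X^k)(\boldsymbol\varepsilon_1\boldsymbol X^l)\boldsymbol A_j$$ is a bijection of the space of fields. In components, $X$, $c$, $A^+$ are unchanged and $$c_{10}^{+\prime\prime i}=c_{10}^{+i}+\tfrac12\Theta^i_{jk}A_0^{+j}A_1^{+k},\quad A''_{0i}=A_{0i}-\tfrac12\Theta^j_{ki}A_0^{+k}c_j,\quad A''_{1i}=A_{1i}+\tfrac12\Theta^j_{ki}A_1^{+k}c_j,\quad X^{+\prime\prime}_{10\,i}=X^+_{10\,i}+\tfrac12\partial_i\Theta^j_{kl}A_0^{+k}A_1^{+l}c_j.$$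 It is a BV canonical transformation, $T_2^*\omega=\omega$. 3. Let $\Lambda=\tfrac12\int_\Sigma d^2\sigma\,\Theta^i_{jk}(X)A_0^{+j}A_1^{+k}c_i$. There is a Hamiltonian vector field $H_\Lambda$ of $\Lambda$, normalised by $\omega(H_\Lambda,\cdot)=\delta\Lambda$, that is constant along its own flow lines $\Phi\mapsto\Phi+sH_\Lambda(\Phi)$ and satisfies $T_2(\Phi)=\Phi-H_\Lambda(\Phi)$. The exponential series gives $\exp(H_\Lambda)S'=S^{cov}$; equivalently, $S'$ expressed in the new fields is the covariant action, $S'=S^{cov}\circ T_2$. 4. Together, $S^{GD}=S^{cov}\circ T_2\circ T_1$. 5. $S^{cov}$ has the component form $$\int\Big(A_idX^i+\tfrac12\pi^{ij}A_iA_j+A^{+i}\big[dc_i+\pi^{jk}{}_{,i}A_jc_k+\tfrac12\pi^{kl}H_{ijl}(dX^j-\pi^{ja}A_a)c_k\big]+X^+_i\pi^{ji}c_j+\tfrac12c^{+k}(\pi^{ij}{}_{,k}+\pi^{il}\pi^{jm}H_{klm})c_ic_j+\tfrac14\big[\pi^{ij}{}_{,nk}+(\pi^{il}\pi^{jm}H_{klm})_{,n}\big]A^{+n}A^{+k}c_ic_j+\tfrac18\pi^{qi}\pi^{ja}\pi^{bd}H_{nab}H_{kqd}A^{+n}A^{+k}c_ic_j\Big)+\mathrm{WZ},$$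 all coefficient functions being taken at $X$. It is $\mathrm{Diff}(\Sigma)$-covariant: under pullback of the fields as differential forms by a smooth map $\varphi$ of the (universal cover of the) world sheet, the integrands over $\Sigma$ of $S^{cov}$ and of $\omega$ transform as 2-forms (pullback times $\det D\varphi$), and the integrand of $\mathrm{WZ}$ transforms as a 3-form under smooth maps of $N$. -/

import Mathlib

open scoped ContDiff

noncomputable section

namespace HPSM

/-! ### Superfunctions in two odd variables with graded-commutative coefficients -/

section Super

variable {𝒢 : Type*} [NormedRing 𝒢] [NormedAlgebra ℝ 𝒢] (𝒜 : ℤ → Submodule ℝ 𝒢)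

/-- The Koszul sign rule for a `ℤ`-graded algebra: `a b = (-1)^(p q) b a` for `a`, `b` homogeneous
of ghost numbers `p`, `q`. -/
def GradedComm : Prop :=
  ∀ (p q : ℤ) (a b : 𝒢), a ∈ 𝒜 p → b ∈ 𝒜 q → a * b = ((-1 : ℝ) ^ (p * q)) • (b * a)

/-- The parity involution, equal to `(-1)^k` on the homogeneous part of ghost number `k`. -/
def parity [GradedAlgebra 𝒜] : 𝒢 →ₗ[ℝ] 𝒢 :=
  (DirectSum.toModule ℝ ℤ 𝒢 fun k => ((-1 : ℝ) ^ k) • (𝒜 k).subtype) ∘ₗ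
    (DirectSum.decomposeLinearEquiv 𝒜).toLinearMap

theorem parity_of_mem [GradedAlgebra 𝒜] {k : ℤ} {a : 𝒢} (ha : a ∈ 𝒜 k) :
    parity 𝒜 a = ((-1 : ℝ) ^ k) • a := by
  have h : DirectSum.decomposeLinearEquiv 𝒜 a = DirectSum.lof ℝ ℤ (fun i => 𝒜 i) k ⟨a, ha⟩ :=
    DirectSum.decompose_of_mem 𝒜 ha
  rw [parity, LinearMap.comp_apply, LinearEquiv.coe_coe, h, DirectSum.toModule_lof]
  rfl

theorem parity_one [GradedAlgebra 𝒜] : parity 𝒜 1 = 1 := by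
  simp [parity_of_mem 𝒜 (SetLike.GradedOne.one_mem (A := 𝒜))]

theorem parity_mul [GradedAlgebra 𝒜] (a b : 𝒢) :
    parity 𝒜 (a * b) = parity 𝒜 a * parity 𝒜 b := by
  induction a using DirectSum.Decomposition.inductionOn 𝒜 with
  | zero => simp
  | add x y hx hy => simp [add_mul, hx, hy]
  | homogeneous x =>
    rename_i p
    induction b using DirectSum.Decomposition.inductionOn 𝒜 with
    | zero => simp
    | add x y hx hy => simp [mul_add, hx, hy]
    | homogeneous y =>
      rename_i q
      rw [parity_of_mem 𝒜 x.2, parity_of_mem 𝒜 y.2,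
        parity_of_mem 𝒜 (SetLike.GradedMul.mul_mem x.2 y.2), smul_mul_smul_comm,
        zpow_add₀ (by norm_num)]

theorem parity_parity [GradedAlgebra 𝒜] (a : 𝒢) : parity 𝒜 (parity 𝒜 a) = a := by
  induction a using DirectSum.Decomposition.inductionOn 𝒜 with
  | zero => simp
  | add x y hx hy => simp [hx, hy]
  | homogeneous x =>
    rename_i p
    rw [parity_of_mem 𝒜 x.2, map_smul, parity_of_mem 𝒜 x.2, smul_smul, ← mul_zpow]
    simp

/-- An element `one + θ⁰ t0 + θ¹ t1 + θ¹ θ⁰ t10` of `𝒢[θ⁰, θ¹]`. The odd variables `θ⁰`, `θ¹`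
anticommute with each other and with the odd elements of `𝒢`. -/
@[ext]
structure SuperFun {𝒢 : Type*} [NormedRing 𝒢] [NormedAlgebra ℝ 𝒢]
    (_𝒜 : ℤ → Submodule ℝ 𝒢) where
  one : 𝒢
  t0 : 𝒢
  t1 : 𝒢
  t10 : 𝒢

namespace SuperFun

/-- The vector space of superfunctions is `𝒢⁴`. -/
def equivProd : SuperFun 𝒜 ≃ 𝒢 × 𝒢 × 𝒢 × 𝒢 where
  toFun s := (s.one, s.t0, s.t1, s.t10)
  invFun p := ⟨p.1, p.2.1, p.2.2.1, p.2.2.2⟩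
  left_inv _ := rfl
  right_inv _ := rfl

instance : AddCommGroup (SuperFun 𝒜) := (equivProd 𝒜).addCommGroup

instance : Module ℝ (SuperFun 𝒜) := (equivProd 𝒜).module ℝ

variable {𝒜}

@[simp] theorem zero_one : (0 : SuperFun 𝒜).one = 0 := rfl
@[simp] theorem zero_t0 : (0 : SuperFun 𝒜).t0 = 0 := rfl
@[simp] theorem zero_t1 : (0 : SuperFun 𝒜).t1 = 0 := rfl
@[simp] theorem zero_t10 : (0 : SuperFun 𝒜).t10 = 0 := rfl
@[simp] theorem add_one (s t : SuperFun 𝒜) : (s + t).one = s.one + t.one := rfl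
@[simp] theorem add_t0 (s t : SuperFun 𝒜) : (s + t).t0 = s.t0 + t.t0 := rfl
@[simp] theorem add_t1 (s t : SuperFun 𝒜) : (s + t).t1 = s.t1 + t.t1 := rfl
@[simp] theorem add_t10 (s t : SuperFun 𝒜) : (s + t).t10 = s.t10 + t.t10 := rfl
@[simp] theorem neg_one (s : SuperFun 𝒜) : (-s).one = -s.one := rfl
@[simp] theorem neg_t0 (s : SuperFun 𝒜) : (-s).t0 = -s.t0 := rfl
@[simp] theorem neg_t1 (s : SuperFun 𝒜) : (-s).t1 = -s.t1 := rfl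
@[simp] theorem neg_t10 (s : SuperFun 𝒜) : (-s).t10 = -s.t10 := rfl
@[simp] theorem sub_one (s t : SuperFun 𝒜) : (s - t).one = s.one - t.one := rfl
@[simp] theorem sub_t0 (s t : SuperFun 𝒜) : (s - t).t0 = s.t0 - t.t0 := rfl
@[simp] theorem sub_t1 (s t : SuperFun 𝒜) : (s - t).t1 = s.t1 - t.t1 := rfl
@[simp] theorem sub_t10 (s t : SuperFun 𝒜) : (s - t).t10 = s.t10 - t.t10 := rfl
@[simp] theorem smul_one (r : ℝ) (s : SuperFun 𝒜) : (r • s).one = r • s.one := rfl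
@[simp] theorem smul_t0 (r : ℝ) (s : SuperFun 𝒜) : (r • s).t0 = r • s.t0 := rfl
@[simp] theorem smul_t1 (r : ℝ) (s : SuperFun 𝒜) : (r • s).t1 = r • s.t1 := rfl
@[simp] theorem smul_t10 (r : ℝ) (s : SuperFun 𝒜) : (r • s).t10 = r • s.t10 := rfl

instance : One (SuperFun 𝒜) := ⟨⟨1, 0, 0, 0⟩⟩

@[simp] theorem one_one : (1 : SuperFun 𝒜).one = 1 := rfl
@[simp] theorem one_t0 : (1 : SuperFun 𝒜).t0 = 0 := rfl
@[simp] theorem one_t1 : (1 : SuperFun 𝒜).t1 = 0 := rfl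
@[simp] theorem one_t10 : (1 : SuperFun 𝒜).t10 = 0 := rfl

variable [GradedAlgebra 𝒜]

/-- The product determined by `a θ = θ (parity a)` and `θ⁰ θ¹ = - θ¹ θ⁰`. -/
instance : Mul (SuperFun 𝒜) where
  mul s t :=
    ⟨s.one * t.one,
      parity 𝒜 s.one * t.t0 + s.t0 * t.one,
      parity 𝒜 s.one * t.t1 + s.t1 * t.one,
      s.one * t.t10 + s.t10 * t.one + parity 𝒜 s.t1 * t.t0 - parity 𝒜 s.t0 * t.t1⟩

@[simp] theorem mul_body (s t : SuperFun 𝒜) : (s * t).one = s.one * t.one := rfl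
@[simp] theorem mul_t0 (s t : SuperFun 𝒜) :
    (s * t).t0 = parity 𝒜 s.one * t.t0 + s.t0 * t.one := rfl
@[simp] theorem mul_t1 (s t : SuperFun 𝒜) :
    (s * t).t1 = parity 𝒜 s.one * t.t1 + s.t1 * t.one := rfl
@[simp] theorem mul_t10 (s t : SuperFun 𝒜) :
    (s * t).t10 = s.one * t.t10 + s.t10 * t.one + parity 𝒜 s.t1 * t.t0 - parity 𝒜 s.t0 * t.t1 :=
  rfl

instance : Ring (SuperFun 𝒜) :=
  { (inferInstance : AddCommGroup (SuperFun 𝒜)) with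
    one_mul := fun s => by ext <;> simp [parity_one]
    mul_one := fun s => by ext <;> simp
    zero_mul := fun s => by ext <;> simp
    mul_zero := fun s => by ext <;> simp
    mul_assoc := fun s t u => by
      ext <;> simp [parity_mul, parity_parity, mul_add, add_mul, sub_mul, mul_sub, mul_assoc] <;>
        abel
    left_distrib := fun s t u => by ext <;> simp [mul_add] <;> abel
    right_distrib := fun s t u => by ext <;> simp [add_mul] <;> abel }

end SuperFun

variable {𝒜}

/-- The odd coordinate `θ⁰`. -/
def th0 : SuperFun 𝒜 := ⟨0, 1, 0, 0⟩

/-- The odd coordinate `θ¹`. -/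
def th1 : SuperFun 𝒜 := ⟨0, 0, 1, 0⟩

/-- The Euler vector field `ε₀ = θ⁰ ∂/∂θ⁰`. -/
def eps0 (s : SuperFun 𝒜) : SuperFun 𝒜 := ⟨0, s.t0, 0, s.t10⟩

/-- The Euler vector field `ε₁ = θ¹ ∂/∂θ¹`. -/
def eps1 (s : SuperFun 𝒜) : SuperFun 𝒜 := ⟨0, 0, s.t1, s.t10⟩

/-- The total Euler vector field `ε = ε₀ + ε₁`. -/
def eps (s : SuperFun 𝒜) : SuperFun 𝒜 := eps0 s + eps1 s

/-- The Berezin integral, normalised by `∫ d²θ θ¹ θ⁰ = 1`. -/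
def berezin (s : SuperFun 𝒜) : 𝒢 := s.t10

/-- The coefficientwise directional derivative of a superfield on `ℝ × ℝ`. -/
def dirD (v : ℝ × ℝ) (F : ℝ × ℝ → SuperFun 𝒜) (σ : ℝ × ℝ) : SuperFun 𝒜 :=
  ⟨fderiv ℝ (fun s => (F s).one) σ v, fderiv ℝ (fun s => (F s).t0) σ v,
    fderiv ℝ (fun s => (F s).t1) σ v, fderiv ℝ (fun s => (F s).t10) σ v⟩

variable [GradedAlgebra 𝒜]

/-- The odd vector field `d₀ = θ⁰ ∂₀`. -/
def d0 (F : ℝ × ℝ → SuperFun 𝒜) (σ : ℝ × ℝ) : SuperFun 𝒜 := th0 * dirD (1, 0) F σ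

/-- The odd vector field `d₁ = θ¹ ∂₁`. -/
def d1 (F : ℝ × ℝ → SuperFun 𝒜) (σ : ℝ × ℝ) : SuperFun 𝒜 := th1 * dirD (0, 1) F σ

/-- The odd vector field `d = d₀ + d₁`, the de Rham differential. -/
def dd (F : ℝ × ℝ → SuperFun 𝒜) (σ : ℝ × ℝ) : SuperFun 𝒜 := d0 F σ + d1 F σ

end Super

/-! ### The target: a coordinate patch with a twisted Poisson structure -/

section Target

variable {m : ℕ}

/-- The partial derivative `∂f/∂xˡ`. -/
def pd (l : Fin m) (f : (Fin m → ℝ) → ℝ) (x : Fin m → ℝ) : ℝ := fderiv ℝ f x (Pi.single l 1)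

/-- `(π, H)` is a twisted Poisson structure on `U`: a smooth bivector field and a smooth closed
3-form with `½ [π, π] = π♯ H`, written in components. -/
structure IsTwistedPoisson (U : Set (Fin m → ℝ)) (π : (Fin m → ℝ) → Fin m → Fin m → ℝ)
    (H : (Fin m → ℝ) → Fin m → Fin m → Fin m → ℝ) : Prop where
  pi_smooth : ∀ i j, ContDiffOn ℝ ∞ (fun x => π x i j) U
  H_smooth : ∀ i j k, ContDiffOn ℝ ∞ (fun x => H x i j k) U
  pi_anti : ∀ x ∈ U, ∀ i j, π x i j = -π x j i
  H_anti_left : ∀ x ∈ U, ∀ i j k, H x i j k = -H x j i k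
  H_anti_right : ∀ x ∈ U, ∀ i j k, H x i j k = -H x i k j
  H_closed : ∀ x ∈ U, ∀ i j k l,
    pd l (fun y => H y i j k) x - pd i (fun y => H y l j k) x
      + pd j (fun y => H y l i k) x - pd k (fun y => H y l i j) x = 0
  jacobi : ∀ x ∈ U, ∀ i j k,
    ∑ l, (π x i l * pd l (fun y => π y j k) x + π x j l * pd l (fun y => π y k i) x
        + π x k l * pd l (fun y => π y i j) x)
      = ∑ a, ∑ b, ∑ c, π x a i * π x b j * π x c k * H x a b c

/-- `Θ^i_{jk} = π^{il} H_{jkl}`. -/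
def Theta (π : (Fin m → ℝ) → Fin m → Fin m → ℝ) (H : (Fin m → ℝ) → Fin m → Fin m → Fin m → ℝ)
    (i j k : Fin m) (x : Fin m → ℝ) : ℝ :=
  ∑ l, π x i l * H x j k l

/-- `π^{il} π^{jn} H_{kln}`, antisymmetric in `i, j`. -/
def piPiH (π : (Fin m → ℝ) → Fin m → Fin m → ℝ) (H : (Fin m → ℝ) → Fin m → Fin m → Fin m → ℝ)
    (i j k : Fin m) (x : Fin m → ℝ) : ℝ :=
  ∑ l, ∑ n, π x i l * π x j n * H x k l n

/-- `π^{ir} π^{jn} π^{pq} H_{rql} H_{npk}`. -/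
def piPiPiHH (π : (Fin m → ℝ) → Fin m → Fin m → ℝ) (H : (Fin m → ℝ) → Fin m → Fin m → Fin m → ℝ)
    (i j k l : Fin m) (x : Fin m → ℝ) : ℝ :=
  ∑ r, ∑ n, ∑ p, ∑ q, π x i r * π x j n * π x p q * H x r q l * H x n p k

variable {𝒢 : Type*} [NormedRing 𝒢] [NormedAlgebra ℝ 𝒢] {𝒜 : ℤ → Submodule ℝ 𝒢} [GradedAlgebra 𝒜]

/-- The value `f (x + n)` of a smooth function at a real point `x` plus an even superfunction `n`
without `θ`-independent part, by its Taylor expansion; all terms of order three and higher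
vanish since `n` has no `θ`-independent part. -/
def superEval (f : (Fin m → ℝ) → ℝ) (x : Fin m → ℝ) (n : Fin m → SuperFun 𝒜) : SuperFun 𝒜 :=
  f x • 1 + ∑ a, pd a f x • n a + ∑ a, ∑ b, ((1 / 2 : ℝ) * pd b (pd a f) x) • (n a * n b)

end Target

/-! ### Fields -/

/-- The component fields on `Σ`, as functions of `σ = (σ⁰, σ¹)`: the map `X`, the ghosts `c`, the
1-form `A = θ^μ A_μ`, and the antifields `A⁺ = θ^μ A⁺_μ`, `X⁺ = θ¹ θ⁰ X⁺₁₀`,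
`c⁺ = θ¹ θ⁰ c⁺₁₀`. -/
@[ext]
structure SigmaField (m : ℕ) (𝒢 : Type*) where
  X : ℝ × ℝ → Fin m → ℝ
  c : ℝ × ℝ → Fin m → 𝒢
  A0 : ℝ × ℝ → Fin m → 𝒢
  A1 : ℝ × ℝ → Fin m → 𝒢
  Ap0 : ℝ × ℝ → Fin m → 𝒢
  Ap1 : ℝ × ℝ → Fin m → 𝒢
  Xp : ℝ × ℝ → Fin m → 𝒢
  cp : ℝ × ℝ → Fin m → 𝒢

/-- The fields on `Σ` together with the extension `XN` of the map `X` to the solid torus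
`N = D × S¹`, a function of `(z, σ⁰)` with `z` in the closed unit disc of `ℂ`. -/
@[ext]
structure BVField (m : ℕ) (𝒢 : Type*) extends SigmaField m 𝒢 where
  XN : ℂ × ℝ → Fin m → ℝ

section Fields

variable {m : ℕ} {𝒢 : Type*} [NormedRing 𝒢] [NormedAlgebra ℝ 𝒢]

instance : Add (BVField m 𝒢) where
  add Φ Ψ :=
    { X := Φ.X + Ψ.X, c := Φ.c + Ψ.c, A0 := Φ.A0 + Ψ.A0, A1 := Φ.A1 + Ψ.A1,
      Ap0 := Φ.Ap0 + Ψ.Ap0, Ap1 := Φ.Ap1 + Ψ.Ap1, Xp := Φ.Xp + Ψ.Xp, cp := Φ.cp + Ψ.cp,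
      XN := Φ.XN + Ψ.XN }

instance : SMul ℝ (BVField m 𝒢) where
  smul s Φ :=
    { X := s • Φ.X, c := s • Φ.c, A0 := s • Φ.A0, A1 := s • Φ.A1, Ap0 := s • Φ.Ap0,
      Ap1 := s • Φ.Ap1, Xp := s • Φ.Xp, cp := s • Φ.cp, XN := s • Φ.XN }

/-- A smooth function on the torus `Σ = (ℝ / 2πℤ)²` with values of ghost number `k`. -/
structure IsComponent (𝒜 : ℤ → Submodule ℝ 𝒢) (k : ℤ) (f : ℝ × ℝ → Fin m → 𝒢) : Prop where
  smooth : ContDiff ℝ ∞ f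
  periodic0 : ∀ s t, f (s + 2 * Real.pi, t) = f (s, t)
  periodic1 : ∀ s t, f (s, t + 2 * Real.pi) = f (s, t)
  ghost : ∀ σ i, f σ i ∈ 𝒜 k

/-- The solid torus `N = D × S¹` (as the product of the closed disc with the line covering `S¹`). -/
def solidTorus : Set (ℂ × ℝ) := Metric.closedBall 0 1 ×ˢ Set.univ

/-- Smooth, periodic component fields of the right ghost numbers, with `X` the boundary value of
`XN`; these are the tangent vectors of ghost number zero to the space of fields. -/
structure IsTangent (𝒜 : ℤ → Submodule ℝ 𝒢) (Φ : BVField m 𝒢) : Prop where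
  XN_smooth : ContDiffOn ℝ ∞ Φ.XN solidTorus
  XN_periodic : ∀ p ∈ solidTorus, Φ.XN (p.1, p.2 + 2 * Real.pi) = Φ.XN p
  boundary : ∀ σ : ℝ × ℝ, Φ.X σ = Φ.XN (Complex.exp (σ.2 * Complex.I), σ.1)
  c : IsComponent 𝒜 1 Φ.c
  A0 : IsComponent 𝒜 0 Φ.A0
  A1 : IsComponent 𝒜 0 Φ.A1
  Ap0 : IsComponent 𝒜 (-1) Φ.Ap0
  Ap1 : IsComponent 𝒜 (-1) Φ.Ap1
  Xp : IsComponent 𝒜 (-1) Φ.Xp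
  cp : IsComponent 𝒜 (-2) Φ.cp

/-- The space of BV fields with target `U`. -/
def bvFields (𝒜 : ℤ → Submodule ℝ 𝒢) (U : Set (Fin m → ℝ)) : Set (BVField m 𝒢) :=
  {Φ | IsTangent 𝒜 Φ ∧ ∀ p ∈ solidTorus, Φ.XN p ∈ U}

/-- All antifields vanish. -/
def AntifieldFree (Φ : SigmaField m 𝒢) : Prop :=
  Φ.Ap0 = 0 ∧ Φ.Ap1 = 0 ∧ Φ.Xp = 0 ∧ Φ.cp = 0

variable (𝒜 : ℤ → Submodule ℝ 𝒢)

/-- The nilpotent part `- A⁺ + c⁺` of the superfield `𝐗`. -/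
def soul (Φ : SigmaField m 𝒢) (σ : ℝ × ℝ) (i : Fin m) : SuperFun 𝒜 :=
  ⟨0, -Φ.Ap0 σ i, -Φ.Ap1 σ i, Φ.cp σ i⟩

/-- The superfield `𝐗 = X - A⁺ + c⁺`. -/
def SX (Φ : SigmaField m 𝒢) (i : Fin m) (σ : ℝ × ℝ) : SuperFun 𝒜 :=
  ⟨algebraMap ℝ 𝒢 (Φ.X σ i), -Φ.Ap0 σ i, -Φ.Ap1 σ i, Φ.cp σ i⟩

/-- The superfield `𝐀 = - c + A + X⁺`. -/
def SA (Φ : SigmaField m 𝒢) (i : Fin m) (σ : ℝ × ℝ) : SuperFun 𝒜 :=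
  ⟨-Φ.c σ i, Φ.A0 σ i, Φ.A1 σ i, Φ.Xp σ i⟩

variable {𝒜}

/-- The fields with the same `X` and `XN` as `Φ`, and all other components read off from the
superfields `sX` and `sA`. -/
def ofSuper (Φ : BVField m 𝒢) (sX sA : Fin m → ℝ × ℝ → SuperFun 𝒜) : BVField m 𝒢 :=
  { X := Φ.X
    XN := Φ.XN
    c := fun σ i => -(sA i σ).one
    A0 := fun σ i => (sA i σ).t0
    A1 := fun σ i => (sA i σ).t1
    Xp := fun σ i => (sA i σ).t10
    Ap0 := fun σ i => -(sX i σ).t0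
    Ap1 := fun σ i => -(sX i σ).t1
    cp := fun σ i => (sX i σ).t10 }

/-- The value `f(𝐗)` of a function on the target at the superfield `𝐗`. -/
def atX (𝒜 : ℤ → Submodule ℝ 𝒢) [GradedAlgebra 𝒜] (f : (Fin m → ℝ) → ℝ) (Φ : SigmaField m 𝒢)
    (σ : ℝ × ℝ) : SuperFun 𝒜 :=
  superEval f (Φ.X σ) (soul 𝒜 Φ σ)

/-! ### Integration over the torus and the Wess-Zumino term -/

/-- `∫_Σ dσ⁰ dσ¹ L`. -/
def intSigma (L : ℝ × ℝ → 𝒢) : 𝒢 :=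
  ∫ s in (0 : ℝ)..(2 * Real.pi), ∫ t in (0 : ℝ)..(2 * Real.pi), L (s, t)

/-- The coefficient of the pullback of `H` by `XN` with respect to `dx ∧ dy ∧ dσ⁰`. -/
def wzDensity (H : (Fin m → ℝ) → Fin m → Fin m → Fin m → ℝ) (XN : ℂ × ℝ → Fin m → ℝ)
    (p : ℂ × ℝ) : ℝ :=
  ∑ i, ∑ j, ∑ k, H (XN p) i j k * fderiv ℝ XN p (1, 0) i * fderiv ℝ XN p (Complex.I, 0) j
    * fderiv ℝ XN p (0, 1) k

/-- The Wess-Zumino term `∫_N XN^* H`. In its superfield version only the map `XN` itself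
contributes, since all other components of the superfield have positive form degree. -/
def wz (𝒢 : Type*) [NormedRing 𝒢] [NormedAlgebra ℝ 𝒢]
    (H : (Fin m → ℝ) → Fin m → Fin m → Fin m → ℝ) (XN : ℂ × ℝ → Fin m → ℝ) : 𝒢 :=
  algebraMap ℝ 𝒢 (∫ t in (0 : ℝ)..(2 * Real.pi), ∫ z in Metric.ball (0 : ℂ) 1,
    wzDensity H XN (z, t))

/-! ### Actions -/

/-- The classical action `∫_Σ (A_i ∧ dX^i + ½ π^{ij} A_i ∧ A_j) + ∫_N XN^* H`, in components. -/
def Sclass (π : (Fin m → ℝ) → Fin m → Fin m → ℝ) (H : (Fin m → ℝ) → Fin m → Fin m → Fin m → ℝ)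
    (Φ : BVField m 𝒢) : 𝒢 :=
  intSigma (fun σ =>
      ∑ i, (fderiv ℝ Φ.X σ (1, 0) i • Φ.A1 σ i - fderiv ℝ Φ.X σ (0, 1) i • Φ.A0 σ i)
        - ∑ i, ∑ j, π (Φ.X σ) i j • (Φ.A0 σ i * Φ.A1 σ j))
    + wz 𝒢 H Φ.XN

variable (𝒜) [GradedAlgebra 𝒜]
variable (π : (Fin m → ℝ) → Fin m → Fin m → ℝ) (H : (Fin m → ℝ) → Fin m → Fin m → Fin m → ℝ)

/-- `𝐀_i d𝐗^i + ½ π^{ij}(𝐗) 𝐀_i 𝐀_j`. -/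
def psmL (Φ : SigmaField m 𝒢) (σ : ℝ × ℝ) : SuperFun 𝒜 :=
  ∑ i, SA 𝒜 Φ i σ * dd (SX 𝒜 Φ i) σ
    + (1 / 2 : ℝ) • ∑ i, ∑ j, atX 𝒜 (fun x => π x i j) Φ σ * SA 𝒜 Φ i σ * SA 𝒜 Φ j σ

/-- The BV action of the Grigoriev-Damgaard formalism. -/
def SGD (Φ : BVField m 𝒢) : 𝒢 :=
  intSigma (fun σ => berezin (psmL 𝒜 π Φ.toSigmaField σ
      + (1 / 2 : ℝ) • ∑ i, ∑ j, ∑ k, atX 𝒜 (piPiH π H i j k) Φ.toSigmaField σ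
          * SA 𝒜 Φ.toSigmaField i σ * SA 𝒜 Φ.toSigmaField j σ * eps1 (SX 𝒜 Φ.toSigmaField k σ)))
    + wz 𝒢 H Φ.XN

/-- The Grigoriev-Damgaard action written in Darboux coordinates. -/
def SDarboux (Φ : BVField m 𝒢) : 𝒢 :=
  intSigma (fun σ => berezin (psmL 𝒜 π Φ.toSigmaField σ
      + (1 / 2 : ℝ) • ∑ i, ∑ j, ∑ k, atX 𝒜 (piPiH π H i j k) Φ.toSigmaField σ
          * SA 𝒜 Φ.toSigmaField i σ * SA 𝒜 Φ.toSigmaField j σ * eps1 (SX 𝒜 Φ.toSigmaField k σ)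
      - ∑ i, ∑ k, ∑ l, atX 𝒜 (Theta π H i k l) Φ.toSigmaField σ * SA 𝒜 Φ.toSigmaField i σ
          * eps0 (SX 𝒜 Φ.toSigmaField k σ) * d1 (SX 𝒜 Φ.toSigmaField l) σ))
    + wz 𝒢 H Φ.XN

/-- The integrand over `Σ` of the covariant BV action in terms of superfields. -/
def covDensity (Φ : SigmaField m 𝒢) (σ : ℝ × ℝ) : 𝒢 :=
  berezin (psmL 𝒜 π Φ σ
    + (1 / 4 : ℝ) • ∑ i, ∑ j, ∑ k, atX 𝒜 (piPiH π H i j k) Φ σ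
        * SA 𝒜 Φ i σ * SA 𝒜 Φ j σ * eps (SX 𝒜 Φ k σ)
    + (1 / 2 : ℝ) • ∑ i, ∑ j, ∑ k, atX 𝒜 (Theta π H i j k) Φ σ
        * SA 𝒜 Φ i σ * dd (SX 𝒜 Φ j) σ * eps (SX 𝒜 Φ k σ)
    - (1 / 8 : ℝ) • ∑ i, ∑ j, ∑ k, ∑ l, atX 𝒜 (piPiPiHH π H i j k l) Φ σ
        * SA 𝒜 Φ i σ * SA 𝒜 Φ j σ * eps (SX 𝒜 Φ k σ) * eps (SX 𝒜 Φ l σ))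

/-- The covariant BV action in terms of superfields. -/
def Scov (Φ : BVField m 𝒢) : 𝒢 :=
  intSigma (covDensity 𝒜 π H Φ.toSigmaField) + wz 𝒢 H Φ.XN

/-- The forms `X`, `c`, `A`, `A⁺`, `X⁺`, `c⁺` on `Σ` as separate superfields. -/
def formX (Φ : SigmaField m 𝒢) (i : Fin m) (σ : ℝ × ℝ) : SuperFun 𝒜 :=
  ⟨algebraMap ℝ 𝒢 (Φ.X σ i), 0, 0, 0⟩
/-- See `formX`. -/
def formC (Φ : SigmaField m 𝒢) (i : Fin m) (σ : ℝ × ℝ) : SuperFun 𝒜 := ⟨Φ.c σ i, 0, 0, 0⟩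
/-- See `formX`. -/
def formA (Φ : SigmaField m 𝒢) (i : Fin m) (σ : ℝ × ℝ) : SuperFun 𝒜 :=
  ⟨0, Φ.A0 σ i, Φ.A1 σ i, 0⟩
/-- See `formX`. -/
def formAp (Φ : SigmaField m 𝒢) (i : Fin m) (σ : ℝ × ℝ) : SuperFun 𝒜 :=
  ⟨0, Φ.Ap0 σ i, Φ.Ap1 σ i, 0⟩
/-- See `formX`. -/
def formXp (Φ : SigmaField m 𝒢) (i : Fin m) (σ : ℝ × ℝ) : SuperFun 𝒜 := ⟨0, 0, 0, Φ.Xp σ i⟩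
/-- See `formX`. -/
def formCp (Φ : SigmaField m 𝒢) (i : Fin m) (σ : ℝ × ℝ) : SuperFun 𝒜 := ⟨0, 0, 0, Φ.cp σ i⟩

/-- The covariant BV action in terms of the forms `X`, `c`, `A`, `A⁺`, `X⁺`, `c⁺`. -/
def ScovForms (Ψ : BVField m 𝒢) : 𝒢 :=
  let Φ := Ψ.toSigmaField
  intSigma (fun σ => berezin (
      ∑ i, formA 𝒜 Φ i σ * dd (formX 𝒜 Φ i) σ
      + (1 / 2 : ℝ) • ∑ i, ∑ j, π (Φ.X σ) i j • (formA 𝒜 Φ i σ * formA 𝒜 Φ j σ)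
      + ∑ i, formAp 𝒜 Φ i σ * (dd (formC 𝒜 Φ i) σ
          + ∑ j, ∑ k, pd i (fun x => π x j k) (Φ.X σ) • (formA 𝒜 Φ j σ * formC 𝒜 Φ k σ)
          + (1 / 2 : ℝ) • ∑ j, ∑ k, Theta π H k i j (Φ.X σ) •
              ((dd (formX 𝒜 Φ j) σ - ∑ a, π (Φ.X σ) j a • formA 𝒜 Φ a σ) * formC 𝒜 Φ k σ))
      + ∑ i, ∑ j, π (Φ.X σ) j i • (formXp 𝒜 Φ i σ * formC 𝒜 Φ j σ)
      + (1 / 2 : ℝ) • ∑ i, ∑ j, ∑ k, (pd k (fun x => π x i j) (Φ.X σ) + piPiH π H i j k (Φ.X σ)) •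
          (formCp 𝒜 Φ k σ * formC 𝒜 Φ i σ * formC 𝒜 Φ j σ)
      + (1 / 4 : ℝ) • ∑ i, ∑ j, ∑ k, ∑ n,
          (pd n (pd k (fun x => π x i j)) (Φ.X σ) + pd n (piPiH π H i j k) (Φ.X σ)) •
          (formAp 𝒜 Φ n σ * formAp 𝒜 Φ k σ * formC 𝒜 Φ i σ * formC 𝒜 Φ j σ)
      + (1 / 8 : ℝ) • ∑ i, ∑ j, ∑ k, ∑ n,
          (∑ q, ∑ a, ∑ b, ∑ d, π (Φ.X σ) q i * π (Φ.X σ) j a * π (Φ.X σ) b d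
            * H (Φ.X σ) n a b * H (Φ.X σ) k q d) •
          (formAp 𝒜 Φ n σ * formAp 𝒜 Φ k σ * formC 𝒜 Φ i σ * formC 𝒜 Φ j σ)))
    + wz 𝒢 H Ψ.XN

/-! ### Symplectic forms -/

/-- The superfield `δ𝐗^i(V)` of a tangent vector `V`. -/
def dSX (V : SigmaField m 𝒢) (i : Fin m) (σ : ℝ × ℝ) : SuperFun 𝒜 := SX 𝒜 V i σ

/-- The superfield `δ𝐀_i(V)` of a tangent vector `V`. -/
def dSA (V : SigmaField m 𝒢) (i : Fin m) (σ : ℝ × ℝ) : SuperFun 𝒜 := SA 𝒜 V i σ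

/-- The integrand of the contraction `ι_W ι_V` of `∫ δ𝐗^i δ𝐀_i`. -/
def canDensity (V W : SigmaField m 𝒢) (σ : ℝ × ℝ) : 𝒢 :=
  berezin (∑ i, (dSX 𝒜 V i σ * dSA 𝒜 W i σ - dSX 𝒜 W i σ * dSA 𝒜 V i σ))

/-- The Darboux form `∫ d²σ d²θ δ𝐗^i δ𝐀_i`, contracted with `V` and then with `W`. -/
def omegaCan (V W : BVField m 𝒢) : 𝒢 :=
  intSigma (canDensity 𝒜 V.toSigmaField W.toSigmaField)

/-- The form `∫ d²σ d²θ (δ𝐗^i δ𝐀_i + ½ H_{ijk}(𝐗) d₁𝐗^i δ𝐗^j δ𝐗^k)` at `Φ`, contracted with `V`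
and then with `W`. -/
def omegaGD (Φ V W : BVField m 𝒢) : 𝒢 :=
  omegaCan 𝒜 V W
    + intSigma (fun σ => berezin (∑ i, ∑ j, ∑ k, atX 𝒜 (fun x => H x i j k) Φ.toSigmaField σ
        * d1 (SX 𝒜 Φ.toSigmaField i) σ * dSX 𝒜 V.toSigmaField j σ * dSX 𝒜 W.toSigmaField k σ))

/-! ### The transformations -/

/-- `𝐀'_i = 𝐀_i + H_{ijk}(𝐗) (ε₀𝐗^j) d₁𝐗^k`. -/
def primA (Φ : SigmaField m 𝒢) (i : Fin m) (σ : ℝ × ℝ) : SuperFun 𝒜 :=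
  SA 𝒜 Φ i σ + ∑ j, ∑ k, atX 𝒜 (fun x => H x i j k) Φ σ * eps0 (SX 𝒜 Φ j σ) * d1 (SX 𝒜 Φ k) σ

/-- `𝐗''^i = 𝐗^i + ½ Θ^i_{jk}(𝐗) (ε₀𝐗^j) (ε₁𝐗^k)`. -/
def secX (Φ : SigmaField m 𝒢) (i : Fin m) (σ : ℝ × ℝ) : SuperFun 𝒜 :=
  SX 𝒜 Φ i σ + (1 / 2 : ℝ) • ∑ j, ∑ k, atX 𝒜 (Theta π H i j k) Φ σ
    * eps0 (SX 𝒜 Φ j σ) * eps1 (SX 𝒜 Φ k σ)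

/-- `𝐀''_i = 𝐀_i + ½ Θ^j_{ki}(𝐗) [- (ε₀𝐗^k) (1 - ε₁)𝐀_j + (ε₁𝐗^k) (1 - ε₀)𝐀_j]`
`- ½ (∂_i Θ^j_{kl} - ∂_l Θ^j_{ki} + ∂_k Θ^j_{li})(𝐗) (ε₀𝐗^k) (ε₁𝐗^l) 𝐀_j`. -/
def secA (Φ : SigmaField m 𝒢) (i : Fin m) (σ : ℝ × ℝ) : SuperFun 𝒜 :=
  SA 𝒜 Φ i σ
    + (1 / 2 : ℝ) • ∑ j, ∑ k, atX 𝒜 (Theta π H j k i) Φ σ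
        * (-(eps0 (SX 𝒜 Φ k σ) * (SA 𝒜 Φ j σ - eps1 (SA 𝒜 Φ j σ)))
          + eps1 (SX 𝒜 Φ k σ) * (SA 𝒜 Φ j σ - eps0 (SA 𝒜 Φ j σ)))
    - (1 / 2 : ℝ) • ∑ j, ∑ k, ∑ l,
        atX 𝒜 (fun x => pd i (Theta π H j k l) x - pd l (Theta π H j k i) x
            + pd k (Theta π H j l i) x) Φ σ
          * eps0 (SX 𝒜 Φ k σ) * eps1 (SX 𝒜 Φ l σ) * SA 𝒜 Φ j σ

/-- The field redefinition `(𝐗, 𝐀) ↦ (𝐗, 𝐀')`. -/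
def T1 (Φ : BVField m 𝒢) : BVField m 𝒢 :=
  ofSuper Φ (SX 𝒜 Φ.toSigmaField) (primA 𝒜 H Φ.toSigmaField)

/-- The field transformation `(𝐗, 𝐀) ↦ (𝐗'', 𝐀'')`. -/
def T2 (Φ : BVField m 𝒢) : BVField m 𝒢 :=
  ofSuper Φ (secX 𝒜 π H Φ.toSigmaField) (secA 𝒜 π H Φ.toSigmaField)

/-- The tangent map of a transformation of fields: the derivative at `s = 0` of
`T (Φ + s V)`, at every point and for every component. -/
def fieldTangent (T : BVField m 𝒢 → BVField m 𝒢) (Φ V : BVField m 𝒢) : BVField m 𝒢 :=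
  { X := fun σ i => deriv (fun s : ℝ => (T (Φ + s • V)).X σ i) 0
    c := fun σ i => deriv (fun s : ℝ => (T (Φ + s • V)).c σ i) 0
    A0 := fun σ i => deriv (fun s : ℝ => (T (Φ + s • V)).A0 σ i) 0
    A1 := fun σ i => deriv (fun s : ℝ => (T (Φ + s • V)).A1 σ i) 0
    Ap0 := fun σ i => deriv (fun s : ℝ => (T (Φ + s • V)).Ap0 σ i) 0
    Ap1 := fun σ i => deriv (fun s : ℝ => (T (Φ + s • V)).Ap1 σ i) 0
    Xp := fun σ i => deriv (fun s : ℝ => (T (Φ + s • V)).Xp σ i) 0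
    cp := fun σ i => deriv (fun s : ℝ => (T (Φ + s • V)).cp σ i) 0
    XN := fun p i => deriv (fun s : ℝ => (T (Φ + s • V)).XN p i) 0 }

/-- `Λ = ½ ∫_Σ d²σ Θ^i_{jk}(X) A₀^{+j} A₁^{+k} c_i`. -/
def Lam (Φ : BVField m 𝒢) : 𝒢 :=
  intSigma (fun σ => (1 / 2 : ℝ) • ∑ i, ∑ j, ∑ k,
    Theta π H i j k (Φ.X σ) • (Φ.Ap0 σ j * Φ.Ap1 σ k * Φ.c σ i))

/-- `V` is the Hamiltonian vector field of the functional `F` for the Darboux form `ω` on the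
fields with target `U`: at every field, `ω(V, W) = δF(W)` for every tangent vector `W`. -/
def IsHamiltonianVF (U : Set (Fin m → ℝ)) (V : BVField m 𝒢 → BVField m 𝒢)
    (F : BVField m 𝒢 → 𝒢) : Prop :=
  ∀ Φ ∈ bvFields 𝒜 U, IsTangent 𝒜 (V Φ) ∧
    ∀ W, IsTangent 𝒜 W → HasDerivAt (fun s : ℝ => F (Φ + s • W)) (omegaCan 𝒜 (V Φ) W) 0

/-- The derivative of a functional along a vector field. -/
def lieD (V : BVField m 𝒢 → BVField m 𝒢) (F : BVField m 𝒢 → 𝒢) (Φ : BVField m 𝒢) : 𝒢 :=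
  deriv (fun s : ℝ => F (Φ + s • V Φ)) 0

/-- `G = exp(V) F` on the fields with target `U`: the series `∑ (1/n!) Vⁿ F` converges to `G`. -/
def IsExp (U : Set (Fin m → ℝ)) (V : BVField m 𝒢 → BVField m 𝒢)
    (F G : BVField m 𝒢 → 𝒢) : Prop :=
  ∀ Φ ∈ bvFields 𝒜 U,
    HasSum (fun n : ℕ => ((n.factorial : ℝ)⁻¹) • ((lieD V)^[n] F) Φ) (G Φ)

/-! ### Changes of coordinates on the world sheet -/

/-- The Jacobian determinant of a map of the plane. -/
def jac (φ : ℝ × ℝ → ℝ × ℝ) (τ : ℝ × ℝ) : ℝ :=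
  (fderiv ℝ φ τ (1, 0)).1 * (fderiv ℝ φ τ (0, 1)).2
    - (fderiv ℝ φ τ (1, 0)).2 * (fderiv ℝ φ τ (0, 1)).1

/-- The pullback of the fields as differential forms: `X`, `c` as functions, `A`, `A⁺` as 1-forms,
`X⁺`, `c⁺` as 2-forms. -/
def pull (φ : ℝ × ℝ → ℝ × ℝ) (Φ : SigmaField m 𝒢) : SigmaField m 𝒢 :=
  { X := fun τ => Φ.X (φ τ)
    c := fun τ => Φ.c (φ τ)
    A0 := fun τ => (fderiv ℝ φ τ (1, 0)).1 • Φ.A0 (φ τ) + (fderiv ℝ φ τ (1, 0)).2 • Φ.A1 (φ τ)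
    A1 := fun τ => (fderiv ℝ φ τ (0, 1)).1 • Φ.A0 (φ τ) + (fderiv ℝ φ τ (0, 1)).2 • Φ.A1 (φ τ)
    Ap0 := fun τ => (fderiv ℝ φ τ (1, 0)).1 • Φ.Ap0 (φ τ) + (fderiv ℝ φ τ (1, 0)).2 • Φ.Ap1 (φ τ)
    Ap1 := fun τ => (fderiv ℝ φ τ (0, 1)).1 • Φ.Ap0 (φ τ) + (fderiv ℝ φ τ (0, 1)).2 • Φ.Ap1 (φ τ)
    Xp := fun τ => jac φ τ • Φ.Xp (φ τ)
    cp := fun τ => jac φ τ • Φ.cp (φ τ) }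

end Fields

end HPSM

end

open HPSM

/-!
The proof rests on a normal form for the three actions. Expanding the superfields in the odd
variables, each integrand over the torus becomes a kinetic part plus a sum of ordered monomials in
the components (`normalTerm`), with coefficients that are explicit in `π`, `H` and their derivatives
(`gdDensity_eq`, `darbouxDensity_eq`, `covDensity_eq`). Identities between actions turn into
identities between such coefficients.

Both transformations are translations along vector fields that change only some of the fields and
depend only on the others: `T1` is translation by `darbouxShift`, which changes `X⁺` alone, and `T2`
is translation by `-hamLam`, which changes the momenta `A`, `X⁺`, `c⁺` conjugate to `A⁺`, `X`, `c`.
Such a vector field is constant along its flow lines, so that the opposite translation is the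
inverse (`bijOn_of_translation`).

For the symplectic forms the derivatives of the translations are computed explicitly. The
contraction of the Darboux form with `hamLam` is the first variation of `Λ` (`canDensity_hamLam`),
differentiation under the integral being justified by compactness of the torus. Invariance under
`T2` then says that the derivative of `hamLam`, paired with a tangent vector, is symmetric, being a
second derivative of the density of `Λ` (`hamLamCross_symm`); there is no quadratic term, as
`hamLam` changes only momenta. Under `T1` the Darboux form pulls back to the Grigoriev-Damgaard form
up to the derivative of the periodic function `gdPotential`; this is where `dH = 0` enters
(`sum_closed`).

The identity `S' = S^cov ∘ T2` holds already for the integrands. Comparing normal forms, all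
coefficients agree at once except those of `A₀⁺A₁⁺cc`, which have to agree only after
antisymmetrisation in the indices of the ghosts; this is `quartic_identity`, a consequence of the
twisted Jacobi identity, contracted with `H`, and of `dH = 0`. As the densities are at most
quadratic in the momenta, the action is a quadratic polynomial along the flow lines of `hamLam`, so
that the exponential series terminates and sums to the translated action (`isExp_hamLam`).

The component form of `S^cov` differs from its normal form by a total divergence. For covariance,
pullback of the fields is a linear substitution of the odd variables (`linSubst`), an algebra
homomorphism that commutes with the Euler operator `ε` and scales the Berezin integral by the
determinant; it commutes with `d` since second derivatives are symmetric. The Wess-Zumino integrand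
is an alternating 3-form on a 3-dimensional space, hence scales by the determinant.
-/

noncomputable section

namespace HPSM

/-! ### Graded-commutative algebra -/

section Graded

variable {𝒢 : Type*} [NormedRing 𝒢] [NormedAlgebra ℝ 𝒢] {𝒜 : ℤ → Submodule ℝ 𝒢}

theorem GradedComm.comm_of_even (h : GradedComm 𝒜) {p q : ℤ} (hpq : Even (p * q)) {a b : 𝒢}
    (ha : a ∈ 𝒜 p) (hb : b ∈ 𝒜 q) : a * b = b * a := by
  rw [h p q a b ha hb, hpq.neg_one_zpow, _root_.one_smul]

theorem GradedComm.anticomm_of_odd (h : GradedComm 𝒜) {p q : ℤ} (hpq : Odd (p * q)) {a b : 𝒢}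
    (ha : a ∈ 𝒜 p) (hb : b ∈ 𝒜 q) : a * b = -(b * a) := by
  rw [h p q a b ha hb, hpq.neg_one_zpow, _root_.neg_smul, _root_.one_smul]

theorem parity_of_even [GradedAlgebra 𝒜] {p : ℤ} (hp : Even p) {a : 𝒢} (ha : a ∈ 𝒜 p) :
    parity 𝒜 a = a := by
  rw [parity_of_mem 𝒜 ha, hp.neg_one_zpow, _root_.one_smul]

theorem parity_of_odd [GradedAlgebra 𝒜] {p : ℤ} (hp : Odd p) {a : 𝒢} (ha : a ∈ 𝒜 p) :
    parity 𝒜 a = -a := by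
  rw [parity_of_mem 𝒜 ha, hp.neg_one_zpow, _root_.neg_smul, _root_.one_smul]

namespace SuperFun

@[simp] theorem sum_one {ι : Type*} (s : Finset ι) (f : ι → SuperFun 𝒜) :
    (∑ i ∈ s, f i).one = ∑ i ∈ s, (f i).one :=
  map_sum (AddMonoidHom.mk' (fun x : SuperFun 𝒜 => x.one) fun _ _ => rfl) f s

@[simp] theorem sum_t0 {ι : Type*} (s : Finset ι) (f : ι → SuperFun 𝒜) :
    (∑ i ∈ s, f i).t0 = ∑ i ∈ s, (f i).t0 :=
  map_sum (AddMonoidHom.mk' (fun x : SuperFun 𝒜 => x.t0) fun _ _ => rfl) f s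

@[simp] theorem sum_t1 {ι : Type*} (s : Finset ι) (f : ι → SuperFun 𝒜) :
    (∑ i ∈ s, f i).t1 = ∑ i ∈ s, (f i).t1 :=
  map_sum (AddMonoidHom.mk' (fun x : SuperFun 𝒜 => x.t1) fun _ _ => rfl) f s

@[simp] theorem sum_t10 {ι : Type*} (s : Finset ι) (f : ι → SuperFun 𝒜) :
    (∑ i ∈ s, f i).t10 = ∑ i ∈ s, (f i).t10 :=
  map_sum (AddMonoidHom.mk' (fun x : SuperFun 𝒜 => x.t10) fun _ _ => rfl) f s

end SuperFun

end Graded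

section Pointwise

variable {m : ℕ} {𝒢 : Type*} [NormedRing 𝒢] [NormedAlgebra ℝ 𝒢] {𝒜 : ℤ → Submodule ℝ 𝒢}

/-- At the point `σ` of the world sheet all components of the fields have the right ghost
numbers. -/
structure HasGhosts (𝒜 : ℤ → Submodule ℝ 𝒢) (Φ : SigmaField m 𝒢) (σ : ℝ × ℝ) : Prop where
  c : ∀ i, Φ.c σ i ∈ 𝒜 1
  A0 : ∀ i, Φ.A0 σ i ∈ 𝒜 0
  A1 : ∀ i, Φ.A1 σ i ∈ 𝒜 0
  Ap0 : ∀ i, Φ.Ap0 σ i ∈ 𝒜 (-1)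
  Ap1 : ∀ i, Φ.Ap1 σ i ∈ 𝒜 (-1)
  Xp : ∀ i, Φ.Xp σ i ∈ 𝒜 (-1)
  cp : ∀ i, Φ.cp σ i ∈ 𝒜 (-2)

theorem IsTangent.hasGhosts {Φ : BVField m 𝒢} (h : IsTangent 𝒜 Φ) (σ : ℝ × ℝ) :
    HasGhosts 𝒜 Φ.toSigmaField σ :=
  ⟨h.c.ghost σ, h.A0.ghost σ, h.A1.ghost σ, h.Ap0.ghost σ, h.Ap1.ghost σ, h.Xp.ghost σ,
    h.cp.ghost σ⟩

/-- The action of the parity automorphism on the components at a point, as rewriting rules. -/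
structure ParityRules (𝒜 : ℤ → Submodule ℝ 𝒢) [GradedAlgebra 𝒜] (Φ : SigmaField m 𝒢)
    (σ : ℝ × ℝ) : Prop where
  c : ∀ i, parity 𝒜 (Φ.c σ i) = -Φ.c σ i
  A0 : ∀ i, parity 𝒜 (Φ.A0 σ i) = Φ.A0 σ i
  A1 : ∀ i, parity 𝒜 (Φ.A1 σ i) = Φ.A1 σ i
  Ap0 : ∀ i, parity 𝒜 (Φ.Ap0 σ i) = -Φ.Ap0 σ i
  Ap1 : ∀ i, parity 𝒜 (Φ.Ap1 σ i) = -Φ.Ap1 σ i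

theorem HasGhosts.parityRules [GradedAlgebra 𝒜] {Φ : SigmaField m 𝒢} {σ : ℝ × ℝ}
    (h : HasGhosts 𝒜 Φ σ) : ParityRules 𝒜 Φ σ :=
  ⟨fun i => parity_of_odd (by decide) (h.c i), fun i => parity_of_even (by decide) (h.A0 i),
    fun i => parity_of_even (by decide) (h.A1 i), fun i => parity_of_odd (by decide) (h.Ap0 i),
    fun i => parity_of_odd (by decide) (h.Ap1 i)⟩

/-- The rules that bring the monomials occurring in the action densities into the order
`A₀ A₁ c⁺ X⁺ A₀⁺ A₁⁺ c`. A primed rule is the form of the rule inside a right-associated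
product. -/
structure OrderRules (Φ : SigmaField m 𝒢) (σ : ℝ × ℝ) : Prop where
  A1_A0 : ∀ i j, Φ.A1 σ i * Φ.A0 σ j = Φ.A0 σ j * Φ.A1 σ i
  c_A0 : ∀ i j, Φ.c σ i * Φ.A0 σ j = Φ.A0 σ j * Φ.c σ i
  c_A1 : ∀ i j, Φ.c σ i * Φ.A1 σ j = Φ.A1 σ j * Φ.c σ i
  c_cp : ∀ i j, Φ.c σ i * Φ.cp σ j = Φ.cp σ j * Φ.c σ i
  c_Xp : ∀ i j, Φ.c σ i * Φ.Xp σ j = -(Φ.Xp σ j * Φ.c σ i)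
  c_Ap0 : ∀ i j, Φ.c σ i * Φ.Ap0 σ j = -(Φ.Ap0 σ j * Φ.c σ i)
  c_Ap1 : ∀ i j, Φ.c σ i * Φ.Ap1 σ j = -(Φ.Ap1 σ j * Φ.c σ i)
  Ap1_Ap0 : ∀ i j, Φ.Ap1 σ i * Φ.Ap0 σ j = -(Φ.Ap0 σ j * Φ.Ap1 σ i)
  c_A0' : ∀ i j z, Φ.c σ i * (Φ.A0 σ j * z) = Φ.A0 σ j * (Φ.c σ i * z)
  c_A1' : ∀ i j z, Φ.c σ i * (Φ.A1 σ j * z) = Φ.A1 σ j * (Φ.c σ i * z)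
  Ap0_A1' : ∀ i j z, Φ.Ap0 σ i * (Φ.A1 σ j * z) = Φ.A1 σ j * (Φ.Ap0 σ i * z)
  Ap1_A0' : ∀ i j z, Φ.Ap1 σ i * (Φ.A0 σ j * z) = Φ.A0 σ j * (Φ.Ap1 σ i * z)
  c_cp' : ∀ i j z, Φ.c σ i * (Φ.cp σ j * z) = Φ.cp σ j * (Φ.c σ i * z)
  c_Ap0' : ∀ i j z, Φ.c σ i * (Φ.Ap0 σ j * z) = -(Φ.Ap0 σ j * (Φ.c σ i * z))
  c_Ap1' : ∀ i j z, Φ.c σ i * (Φ.Ap1 σ j * z) = -(Φ.Ap1 σ j * (Φ.c σ i * z))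
  Ap1_Ap0' : ∀ i j z, Φ.Ap1 σ i * (Φ.Ap0 σ j * z) = -(Φ.Ap0 σ j * (Φ.Ap1 σ i * z))

theorem HasGhosts.orderRules (h𝒜 : GradedComm 𝒜) {Φ : SigmaField m 𝒢} {σ : ℝ × ℝ}
    (h : HasGhosts 𝒜 Φ σ) : OrderRules Φ σ := by
  have key : ∀ {a b : 𝒢}, a * b = b * a → ∀ z, a * (b * z) = b * (a * z) := fun hab z => by
    rw [← mul_assoc, hab, mul_assoc]
  have key' : ∀ {a b : 𝒢}, a * b = -(b * a) → ∀ z, a * (b * z) = -(b * (a * z)) := fun hab z => by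
    rw [← mul_assoc, hab, neg_mul, mul_assoc]
  have cA0 := fun i j => h𝒜.comm_of_even (by decide) (h.c i) (h.A0 j)
  have cA1 := fun i j => h𝒜.comm_of_even (by decide) (h.c i) (h.A1 j)
  have ccp := fun i j => h𝒜.comm_of_even (by decide) (h.c i) (h.cp j)
  have cAp0 := fun i j => h𝒜.anticomm_of_odd (by decide) (h.c i) (h.Ap0 j)
  have cAp1 := fun i j => h𝒜.anticomm_of_odd (by decide) (h.c i) (h.Ap1 j)
  have Ap1Ap0 := fun i j => h𝒜.anticomm_of_odd (by decide) (h.Ap1 i) (h.Ap0 j)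
  exact
    { A1_A0 := fun i j => h𝒜.comm_of_even (by decide) (h.A1 i) (h.A0 j)
      c_A0 := cA0
      c_A1 := cA1
      c_cp := ccp
      c_Xp := fun i j => h𝒜.anticomm_of_odd (by decide) (h.c i) (h.Xp j)
      c_Ap0 := cAp0
      c_Ap1 := cAp1
      Ap1_Ap0 := Ap1Ap0
      c_A0' := fun i j => key (cA0 i j)
      c_A1' := fun i j => key (cA1 i j)
      Ap0_A1' := fun i j => key (h𝒜.comm_of_even (by decide) (h.Ap0 i) (h.A1 j))
      Ap1_A0' := fun i j => key (h𝒜.comm_of_even (by decide) (h.Ap1 i) (h.A0 j))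
      c_cp' := fun i j => key (ccp i j)
      c_Ap0' := fun i j => key' (cAp0 i j)
      c_Ap1' := fun i j => key' (cAp1 i j)
      Ap1_Ap0' := fun i j => key' (Ap1Ap0 i j) }

/-! ### Components of superfields -/

@[simp] theorem eps0_one (s : SuperFun 𝒜) : (eps0 s).one = 0 := rfl
@[simp] theorem eps0_t0 (s : SuperFun 𝒜) : (eps0 s).t0 = s.t0 := rfl
@[simp] theorem eps0_t1 (s : SuperFun 𝒜) : (eps0 s).t1 = 0 := rfl
@[simp] theorem eps0_t10 (s : SuperFun 𝒜) : (eps0 s).t10 = s.t10 := rfl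
@[simp] theorem eps1_one (s : SuperFun 𝒜) : (eps1 s).one = 0 := rfl
@[simp] theorem eps1_t0 (s : SuperFun 𝒜) : (eps1 s).t0 = 0 := rfl
@[simp] theorem eps1_t1 (s : SuperFun 𝒜) : (eps1 s).t1 = s.t1 := rfl
@[simp] theorem eps1_t10 (s : SuperFun 𝒜) : (eps1 s).t10 = s.t10 := rfl

variable [GradedAlgebra 𝒜]

@[simp] theorem atX_one (f : (Fin m → ℝ) → ℝ) (Φ : SigmaField m 𝒢) (σ : ℝ × ℝ) :
    (atX 𝒜 f Φ σ).one = f (Φ.X σ) • 1 := by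
  simp [atX, superEval, soul]

@[simp] theorem atX_t0 (f : (Fin m → ℝ) → ℝ) (Φ : SigmaField m 𝒢) (σ : ℝ × ℝ) :
    (atX 𝒜 f Φ σ).t0 = -∑ a, pd a f (Φ.X σ) • Φ.Ap0 σ a := by
  simp [atX, superEval, soul]

@[simp] theorem atX_t1 (f : (Fin m → ℝ) → ℝ) (Φ : SigmaField m 𝒢) (σ : ℝ × ℝ) :
    (atX 𝒜 f Φ σ).t1 = -∑ a, pd a f (Φ.X σ) • Φ.Ap1 σ a := by
  simp [atX, superEval, soul]

theorem atX_t10 (h𝒜 : GradedComm 𝒜) (f : (Fin m → ℝ) → ℝ) {Φ : SigmaField m 𝒢} {σ : ℝ × ℝ}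
    (h : HasGhosts 𝒜 Φ σ) :
    (atX 𝒜 f Φ σ).t10 = ∑ a, pd a f (Φ.X σ) • Φ.cp σ a
      + ∑ a, ∑ b, ((1 / 2 : ℝ) * (pd b (pd a f) (Φ.X σ) + pd a (pd b f) (Φ.X σ)))
          • (Φ.Ap0 σ a * Φ.Ap1 σ b) := by
  have hp := h.parityRules
  have ho := h.orderRules h𝒜
  have key : ∑ a, ∑ b, ((1 / 2 : ℝ) * pd b (pd a f) (Φ.X σ)) • (Φ.Ap0 σ b * Φ.Ap1 σ a)
      = ∑ a, ∑ b, ((1 / 2 : ℝ) * pd a (pd b f) (Φ.X σ)) • (Φ.Ap0 σ a * Φ.Ap1 σ b) :=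
    Finset.sum_comm
  simp only [mul_add, add_smul, Finset.sum_add_distrib]
  rw [← key]
  simp [atX, superEval, soul, hp.Ap0, hp.Ap1, ho.Ap1_Ap0, Finset.sum_add_distrib, smul_add]
  abel

theorem d0_comps (F : ℝ × ℝ → SuperFun 𝒜) (σ : ℝ × ℝ) :
    d0 F σ = ⟨0, (dirD (1, 0) F σ).one, 0, -(dirD (1, 0) F σ).t1⟩ := by
  ext <;> simp [d0, th0, parity_one]

theorem d1_comps (F : ℝ × ℝ → SuperFun 𝒜) (σ : ℝ × ℝ) :
    d1 F σ = ⟨0, 0, (dirD (0, 1) F σ).one, (dirD (0, 1) F σ).t0⟩ := by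
  ext <;> simp [d1, th1, parity_one]

theorem fderiv_apply_apply {E : Type*} [NormedAddCommGroup E] [NormedSpace ℝ E]
    {f : ℝ × ℝ → Fin m → E} {σ : ℝ × ℝ} (hf : DifferentiableAt ℝ f σ) (v : ℝ × ℝ) (i : Fin m) :
    fderiv ℝ (fun s => f s i) σ v = fderiv ℝ f σ v i := by
  rw [fderiv_apply hf]
  rfl

theorem fderiv_algebraMap_apply {X : ℝ × ℝ → Fin m → ℝ} {σ : ℝ × ℝ}
    (hX : DifferentiableAt ℝ X σ) (v : ℝ × ℝ) (i : Fin m) :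
    fderiv ℝ (fun s => algebraMap ℝ 𝒢 (X s i)) σ v = fderiv ℝ X σ v i • 1 := by
  have h1 : DifferentiableAt ℝ (fun s => X s i) σ := (differentiableAt_pi.1 hX) i
  have h2 : (fun s => algebraMap ℝ 𝒢 (X s i)) = fun s => X s i • (1 : 𝒢) := by
    funext s; rw [Algebra.algebraMap_eq_smul_one]
  rw [h2, fderiv_smul_const h1, ← fderiv_apply_apply hX]
  rfl

/-- The components of `d₀ 𝐗`. -/
theorem d0_SX {Φ : SigmaField m 𝒢} {σ : ℝ × ℝ} (hX : DifferentiableAt ℝ Φ.X σ) (i : Fin m) :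
    d0 (SX 𝒜 Φ i) σ
      = ⟨0, fderiv ℝ Φ.X σ (1, 0) i • 1, 0, fderiv ℝ (fun s => Φ.Ap1 s i) σ (1, 0)⟩ := by
  rw [d0_comps]
  ext <;> simp [dirD, SX, fderiv_algebraMap_apply hX]

/-- The components of `d₁ 𝐗`. -/
theorem d1_SX {Φ : SigmaField m 𝒢} {σ : ℝ × ℝ} (hX : DifferentiableAt ℝ Φ.X σ) (i : Fin m) :
    d1 (SX 𝒜 Φ i) σ
      = ⟨0, 0, fderiv ℝ Φ.X σ (0, 1) i • 1, -fderiv ℝ (fun s => Φ.Ap0 s i) σ (0, 1)⟩ := by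
  rw [d1_comps]
  ext <;> simp [dirD, SX, fderiv_algebraMap_apply hX]

/-- The component of `d𝐗` along `θ¹θ⁰` is the exterior derivative of `A⁺`. -/
def curlAp (Φ : SigmaField m 𝒢) (σ : ℝ × ℝ) (i : Fin m) : 𝒢 :=
  fderiv ℝ (fun s => Φ.Ap1 s i) σ (1, 0) - fderiv ℝ (fun s => Φ.Ap0 s i) σ (0, 1)

/-- The components of `d𝐗`. -/
theorem dd_SX {Φ : SigmaField m 𝒢} {σ : ℝ × ℝ} (hX : DifferentiableAt ℝ Φ.X σ) (i : Fin m) :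
    dd (SX 𝒜 Φ i) σ
      = ⟨0, fderiv ℝ Φ.X σ (1, 0) i • 1, fderiv ℝ Φ.X σ (0, 1) i • 1, curlAp Φ σ i⟩ := by
  rw [dd, d0_SX hX, d1_SX hX]
  ext <;> simp [curlAp, sub_eq_add_neg]

end Pointwise

/-! ### Normal form of the terms of the action densities -/

section Normal

variable {m : ℕ} {𝒢 : Type*} [NormedRing 𝒢] [NormedAlgebra ℝ 𝒢] {𝒜 : ℤ → Submodule ℝ 𝒢}

/-- The kinetic part `A_i ∧ dX^i - c_i dA^{+i}` of the action densities. -/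
def kinetic (Φ : SigmaField m 𝒢) (σ : ℝ × ℝ) (i : Fin m) : 𝒢 :=
  fderiv ℝ Φ.X σ (1, 0) i • Φ.A1 σ i - fderiv ℝ Φ.X σ (0, 1) i • Φ.A0 σ i
    - Φ.c σ i * curlAp Φ σ i

/-- The general form of the interaction part of the action densities, for fixed indices `i`, `j`
of the two momenta: an ordered polynomial in the components with coefficients `P` (of `A₀A₁` and
`X⁺c`), `K` (of `c⁺cc`), `B1`, `B0` (of `A₀A₁⁺c` and `A₁A₀⁺c`), `E1`, `E0` (of `∂₀X A₁⁺c` and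
`∂₁X A₀⁺c`) and `Q` (of `A₀⁺A₁⁺cc`). -/
def normalTerm (P : ℝ) (K B0 B1 E0 E1 : Fin m → ℝ) (Q : Fin m → Fin m → ℝ)
    (Φ : SigmaField m 𝒢) (σ : ℝ × ℝ) (i j : Fin m) : 𝒢 :=
  -(P • (Φ.A0 σ i * Φ.A1 σ j)) - P • (Φ.Xp σ i * Φ.c σ j)
    + ∑ k, ((1 / 2 : ℝ) * K k) • (Φ.cp σ k * (Φ.c σ i * Φ.c σ j))
    - ∑ k, B1 k • (Φ.A0 σ i * (Φ.Ap1 σ k * Φ.c σ j))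
    + ∑ k, B0 k • (Φ.A1 σ i * (Φ.Ap0 σ k * Φ.c σ j))
    + ∑ k, (E1 k * fderiv ℝ Φ.X σ (1, 0) j) • (Φ.Ap1 σ k * Φ.c σ i)
    - ∑ k, (E0 k * fderiv ℝ Φ.X σ (0, 1) j) • (Φ.Ap0 σ k * Φ.c σ i)
    + ∑ k, ∑ n, Q k n • (Φ.Ap0 σ k * (Φ.Ap1 σ n * (Φ.c σ i * Φ.c σ j)))

theorem normalTerm_add (P P' : ℝ) (K B0 B1 E0 E1 K' B0' B1' E0' E1' : Fin m → ℝ)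
    (Q Q' : Fin m → Fin m → ℝ) (Φ : SigmaField m 𝒢) (σ : ℝ × ℝ) (i j : Fin m) :
    normalTerm P K B0 B1 E0 E1 Q Φ σ i j + normalTerm P' K' B0' B1' E0' E1' Q' Φ σ i j
      = normalTerm (P + P') (K + K') (B0 + B0') (B1 + B1') (E0 + E0') (E1 + E1') (Q + Q')
          Φ σ i j := by
  simp only [normalTerm, Pi.add_apply, add_smul, mul_add, add_mul, Finset.sum_add_distrib]
  abel

theorem smul_normalTerm (r P : ℝ) (K B0 B1 E0 E1 : Fin m → ℝ)
    (Q : Fin m → Fin m → ℝ) (Φ : SigmaField m 𝒢) (σ : ℝ × ℝ) (i j : Fin m) :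
    r • normalTerm P K B0 B1 E0 E1 Q Φ σ i j
      = normalTerm (r • P) (r • K) (r • B0) (r • B1) (r • E0) (r • E1) (r • Q) Φ σ i j := by
  simp only [normalTerm, Pi.smul_apply, smul_eq_mul, smul_add, smul_sub, smul_neg, Finset.smul_sum,
    smul_smul, mul_assoc, mul_left_comm r (1 / 2 : ℝ)]

/-- The factor `½` in front of a double sum absorbs a symmetrisation of the summand. -/
theorem half_smul_sum_sum_eq {ι E : Type*} [Fintype ι] [AddCommGroup E] [Module ℝ E]
    {Z W : ι → ι → E} (h : ∀ i j, Z i j = W i j + W j i) :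
    (1 / 2 : ℝ) • ∑ i, ∑ j, Z i j = ∑ i, ∑ j, W i j := by
  have : ∑ i, ∑ j, Z i j = ∑ i, ∑ j, W i j + ∑ i, ∑ j, W i j := by
    simp only [h, Finset.sum_add_distrib]
    congr 1
    exact Finset.sum_comm
  rw [this, smul_add, ← add_smul]
  norm_num

variable [GradedAlgebra 𝒜]

theorem SA_mul_dd_SX {Φ : SigmaField m 𝒢} {σ : ℝ × ℝ} (h : HasGhosts 𝒜 Φ σ)
    (hX : DifferentiableAt ℝ Φ.X σ) (i : Fin m) :
    (SA 𝒜 Φ i σ * dd (SX 𝒜 Φ i) σ).t10 = kinetic Φ σ i := by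
  have hp := h.parityRules
  simp [dd_SX hX, SA, kinetic, hp.A0, hp.A1]
  abel

/-- The component along `θ¹θ⁰` of `F_{ij}(𝐗) 𝐀_i 𝐀_j`, for fixed `i`, `j`, is a normal term
symmetrised in `i`, `j`. The normal term is passed as a variable `W` with a defining equation, so
that `half_smul_sum_sum_eq` can read it off. -/
theorem atX_mul_SA_mul_SA (h𝒜 : GradedComm 𝒜) {Φ : SigmaField m 𝒢} {σ : ℝ × ℝ}
    (h : HasGhosts 𝒜 Φ σ) (F : Fin m → Fin m → (Fin m → ℝ) → ℝ)
    (hF : ∀ i j, F i j (Φ.X σ) = -F j i (Φ.X σ))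
    (hdF : ∀ a i j, pd a (F i j) (Φ.X σ) = -pd a (F j i) (Φ.X σ))
    (hddF : ∀ a b i j, pd a (pd b (F i j)) (Φ.X σ) = -pd a (pd b (F j i)) (Φ.X σ))
    {W : Fin m → Fin m → 𝒢}
    (hW : W = fun i j => normalTerm (F i j (Φ.X σ)) (fun k => pd k (F i j) (Φ.X σ))
      (fun k => pd k (F i j) (Φ.X σ)) (fun k => pd k (F i j) (Φ.X σ)) 0 0
      (fun k n => (1 / 2 : ℝ) * ((1 / 2 : ℝ) * (pd n (pd k (F i j)) (Φ.X σ)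
        + pd k (pd n (F i j)) (Φ.X σ)))) Φ σ i j) (i j : Fin m) :
    (atX 𝒜 (F i j) Φ σ * SA 𝒜 Φ i σ * SA 𝒜 Φ j σ).t10 = W i j + W j i := by
  have hp := h.parityRules
  have ho := h.orderRules h𝒜
  have hc : Φ.c σ j * Φ.c σ i = -(Φ.c σ i * Φ.c σ j) :=
    h𝒜.anticomm_of_odd (by decide) (h.c j) (h.c i)
  subst hW
  simp only [normalTerm, hF j i, hdF _ j i, hddF _ _ j i, hc]
  simp [atX_t10 h𝒜 _ h, SA, hp.A0, hp.A1, hp.c, hp.Ap0, hp.Ap1, ho.A1_A0, ho.c_A0, ho.c_A1,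
    ho.Ap0_A1', ho.Ap1_A0', ho.c_Xp, mul_add, add_mul, mul_sub,
    Finset.sum_mul, mul_assoc]
  simp only [mul_smul, ← Finset.smul_sum, add_smul, Finset.sum_add_distrib,
    Finset.sum_neg_distrib, neg_smul]
  module

/-- The component along `θ¹θ⁰` of `F_{ijk}(𝐗) 𝐀_i 𝐀_j ε₁𝐗^k`, for fixed `i`, `j`, is a normal term
symmetrised in `i`, `j`. -/
theorem atX_mul_SA_mul_SA_mul_eps1 (h𝒜 : GradedComm 𝒜) {Φ : SigmaField m 𝒢} {σ : ℝ × ℝ}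
    (h : HasGhosts 𝒜 Φ σ) (F : Fin m → Fin m → Fin m → (Fin m → ℝ) → ℝ)
    (hF : ∀ i j k, F i j k (Φ.X σ) = -F j i k (Φ.X σ))
    (hdF : ∀ a i j k, pd a (F i j k) (Φ.X σ) = -pd a (F j i k) (Φ.X σ))
    {W : Fin m → Fin m → 𝒢}
    (hW : W = fun i j => normalTerm 0 (fun k => F i j k (Φ.X σ))
      0 (fun k => F i j k (Φ.X σ)) 0 0
      (fun k n => (1 / 2 : ℝ) * pd k (F i j n) (Φ.X σ)) Φ σ i j) (i j : Fin m) :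
    ∑ k, (atX 𝒜 (F i j k) Φ σ * SA 𝒜 Φ i σ * SA 𝒜 Φ j σ * eps1 (SX 𝒜 Φ k σ)).t10
      = W i j + W j i := by
  have hp := h.parityRules
  have ho := h.orderRules h𝒜
  have hc : Φ.c σ j * Φ.c σ i = -(Φ.c σ i * Φ.c σ j) :=
    h𝒜.anticomm_of_odd (by decide) (h.c j) (h.c i)
  have hs : ∀ f : Fin m → Fin m → 𝒢, ∑ k, ∑ n, f k n = ∑ n, ∑ k, f k n :=
    fun f => Finset.sum_comm
  subst hW
  simp only [normalTerm, hF j i, hdF _ j i, hc]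
  rw [hs fun k n => ((1 / 2 : ℝ) * pd k (F i j n) (Φ.X σ)) •
    (Φ.Ap0 σ k * (Φ.Ap1 σ n * (Φ.c σ i * Φ.c σ j)))]
  rw [hs fun k n => ((1 / 2 : ℝ) * -pd k (F i j n) (Φ.X σ)) •
    (Φ.Ap0 σ k * (Φ.Ap1 σ n * -(Φ.c σ i * Φ.c σ j)))]
  simp [SA, SX, hp.A0, hp.c, hp.Ap0, ho.c_A0',
    ho.c_cp, ho.c_cp', ho.c_Ap1, ho.c_Ap1', mul_add, mul_sub, Finset.sum_mul, mul_assoc,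
    Finset.sum_add_distrib, Finset.sum_sub_distrib]
  simp only [mul_smul, ← Finset.smul_sum]
  module

/-- The component along `θ¹θ⁰` of `F_{ijk}(𝐗) 𝐀_i 𝐀_j ε₀𝐗^k`, for fixed `i`, `j`, is a normal term
symmetrised in `i`, `j`. -/
theorem atX_mul_SA_mul_SA_mul_eps0 (h𝒜 : GradedComm 𝒜) {Φ : SigmaField m 𝒢} {σ : ℝ × ℝ}
    (h : HasGhosts 𝒜 Φ σ) (F : Fin m → Fin m → Fin m → (Fin m → ℝ) → ℝ)
    (hF : ∀ i j k, F i j k (Φ.X σ) = -F j i k (Φ.X σ))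
    (hdF : ∀ a i j k, pd a (F i j k) (Φ.X σ) = -pd a (F j i k) (Φ.X σ))
    {W : Fin m → Fin m → 𝒢}
    (hW : W = fun i j => normalTerm 0 (fun k => F i j k (Φ.X σ))
      (fun k => F i j k (Φ.X σ)) 0 0 0
      (fun k n => (1 / 2 : ℝ) * pd n (F i j k) (Φ.X σ)) Φ σ i j) (i j : Fin m) :
    ∑ k, (atX 𝒜 (F i j k) Φ σ * SA 𝒜 Φ i σ * SA 𝒜 Φ j σ * eps0 (SX 𝒜 Φ k σ)).t10
      = W i j + W j i := by
  have hp := h.parityRules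
  have ho := h.orderRules h𝒜
  have hc : Φ.c σ j * Φ.c σ i = -(Φ.c σ i * Φ.c σ j) :=
    h𝒜.anticomm_of_odd (by decide) (h.c j) (h.c i)
  subst hW
  simp only [normalTerm, hF j i, hdF _ j i, hc]
  simp [SA, SX, hp.A1, hp.c, hp.Ap1, ho.c_A1', ho.Ap1_Ap0',
    ho.c_cp, ho.c_cp', ho.c_Ap0, ho.c_Ap0', mul_add, Finset.sum_mul, mul_assoc,
    Finset.sum_add_distrib]
  simp only [mul_smul, ← Finset.smul_sum]
  module

/-- The component along `θ¹θ⁰` of `F_{ikl}(𝐗) 𝐀_i ε₀𝐗^k d₁𝐗^l`. -/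
theorem atX_mul_SA_mul_eps0_mul_d1 (h𝒜 : GradedComm 𝒜) {Φ : SigmaField m 𝒢} {σ : ℝ × ℝ}
    (h : HasGhosts 𝒜 Φ σ) (hX : DifferentiableAt ℝ Φ.X σ)
    (F : Fin m → Fin m → Fin m → (Fin m → ℝ) → ℝ) (i : Fin m) :
    ∑ k, ∑ l, (atX 𝒜 (F i k l) Φ σ * SA 𝒜 Φ i σ * eps0 (SX 𝒜 Φ k σ) * d1 (SX 𝒜 Φ l) σ).t10
      = ∑ j, normalTerm 0 0 0 0 (fun k => F i k j (Φ.X σ)) 0 0 Φ σ i j := by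
  have hp := h.parityRules
  have ho := h.orderRules h𝒜
  rw [Finset.sum_comm]
  refine Finset.sum_congr rfl fun j _ => ?_
  simp [normalTerm, d1_SX hX, SA, SX, parity_mul, parity_one, hp.c, hp.Ap0, ho.c_Ap0, smul_smul,
    mul_comm]

/-- The component along `θ¹θ⁰` of `F_{ijk}(𝐗) 𝐀_i d𝐗^j ε𝐗^k`. -/
theorem atX_mul_SA_mul_dd_mul_eps (h𝒜 : GradedComm 𝒜) {Φ : SigmaField m 𝒢} {σ : ℝ × ℝ}
    (h : HasGhosts 𝒜 Φ σ) (hX : DifferentiableAt ℝ Φ.X σ)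
    (F : Fin m → Fin m → Fin m → (Fin m → ℝ) → ℝ) (i j : Fin m) :
    ∑ k, (atX 𝒜 (F i j k) Φ σ * SA 𝒜 Φ i σ * dd (SX 𝒜 Φ j) σ * eps (SX 𝒜 Φ k σ)).t10
      = normalTerm 0 0 0 0 (fun k => F i j k (Φ.X σ)) (fun k => F i j k (Φ.X σ)) 0 Φ σ i j := by
  have hp := h.parityRules
  have ho := h.orderRules h𝒜
  simp [normalTerm, dd_SX hX, eps, SA, SX, parity_mul, parity_one, hp.c, ho.c_Ap0, ho.c_Ap1,
    smul_smul, mul_comm, Finset.sum_add_distrib]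
  abel

/-- The component along `θ¹θ⁰` of `F_{ijkl}(𝐗) 𝐀_i 𝐀_j ε𝐗^k ε𝐗^l`. -/
theorem atX_mul_SA_mul_SA_mul_eps_mul_eps (h𝒜 : GradedComm 𝒜) {Φ : SigmaField m 𝒢} {σ : ℝ × ℝ}
    (h : HasGhosts 𝒜 Φ σ) (F : Fin m → Fin m → Fin m → Fin m → (Fin m → ℝ) → ℝ) (i j : Fin m) :
    ∑ k, ∑ l, (atX 𝒜 (F i j k l) Φ σ * SA 𝒜 Φ i σ * SA 𝒜 Φ j σ * eps (SX 𝒜 Φ k σ)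
        * eps (SX 𝒜 Φ l σ)).t10
      = normalTerm 0 0 0 0 0 0 (fun k n => F i j k n (Φ.X σ) + F i j n k (Φ.X σ)) Φ σ i j := by
  have hp := h.parityRules
  have ho := h.orderRules h𝒜
  have hs : ∀ f : Fin m → Fin m → 𝒢, ∑ k, ∑ n, f k n = ∑ n, ∑ k, f k n :=
    fun f => Finset.sum_comm
  simp only [normalTerm, add_smul, Finset.sum_add_distrib]
  rw [hs fun k n => F i j n k (Φ.X σ) • (Φ.Ap0 σ k * (Φ.Ap1 σ n * (Φ.c σ i * Φ.c σ j)))]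
  simp [eps, SA, SX, parity_mul, parity_one, hp.c, hp.Ap0, hp.Ap1, ho.c_Ap0', ho.c_Ap1',
    ho.c_Ap0, ho.c_Ap1, ho.Ap1_Ap0', mul_assoc, mul_add, Finset.sum_add_distrib]
  abel

end Normal

/-! ### Tensor calculus on the target -/

section Tensors

variable {m : ℕ} {U : Set (Fin m → ℝ)} {π : (Fin m → ℝ) → Fin m → Fin m → ℝ}
  {H : (Fin m → ℝ) → Fin m → Fin m → Fin m → ℝ}

theorem pd_eq_of_eqOn (hU : IsOpen U) {f g : (Fin m → ℝ) → ℝ} (h : ∀ x ∈ U, f x = g x)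
    {x : Fin m → ℝ} (hx : x ∈ U) (l : Fin m) : pd l f x = pd l g x := by
  have : f =ᶠ[nhds x] g := Filter.eventually_of_mem (hU.mem_nhds hx) h
  rw [pd, pd, this.fderiv_eq]

theorem pd_neg (f : (Fin m → ℝ) → ℝ) (x : Fin m → ℝ) (l : Fin m) :
    pd l (fun y => -f y) x = -pd l f x := by
  simp [pd, fderiv_fun_neg]

theorem pd_eq_neg_of_eqOn (hU : IsOpen U) {f g : (Fin m → ℝ) → ℝ} (h : ∀ x ∈ U, f x = -g x)
    {x : Fin m → ℝ} (hx : x ∈ U) (l : Fin m) : pd l f x = -pd l g x := by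
  rw [← pd_neg, pd_eq_of_eqOn hU h hx]

theorem pd_mul {f g : (Fin m → ℝ) → ℝ} {x : Fin m → ℝ} (hf : DifferentiableAt ℝ f x)
    (hg : DifferentiableAt ℝ g x) (l : Fin m) :
    pd l (fun y => f y * g y) x = pd l f x * g x + f x * pd l g x := by
  simp [pd, fderiv_fun_mul hf hg]
  ring

theorem pd_sum {ι : Type*} (s : Finset ι) {f : ι → (Fin m → ℝ) → ℝ} {x : Fin m → ℝ}
    (hf : ∀ i ∈ s, DifferentiableAt ℝ (f i) x) (l : Fin m) :
    pd l (fun y => ∑ i ∈ s, f i y) x = ∑ i ∈ s, pd l (f i) x := by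
  simp [pd, fderiv_fun_sum hf]

theorem contDiffOn_pd (hU : IsOpen U) {f : (Fin m → ℝ) → ℝ} (hf : ContDiffOn ℝ ∞ f U) (l : Fin m) :
    ContDiffOn ℝ ∞ (pd l f) U :=
  (hf.fderiv_of_isOpen hU (by norm_num)).clm_apply contDiffOn_const

namespace IsTwistedPoisson

variable (h : IsTwistedPoisson U π H)
include h

theorem Theta_smooth (i j k : Fin m) : ContDiffOn ℝ ∞ (Theta π H i j k) U :=
  ContDiffOn.sum fun l _ => (h.pi_smooth i l).mul (h.H_smooth j k l)

theorem piPiH_smooth (i j k : Fin m) : ContDiffOn ℝ ∞ (piPiH π H i j k) U :=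
  ContDiffOn.sum fun l _ => ContDiffOn.sum fun n _ =>
    ((h.pi_smooth i l).mul (h.pi_smooth j n)).mul (h.H_smooth k l n)

theorem Theta_anti {x : Fin m → ℝ} (hx : x ∈ U) (i j k : Fin m) :
    Theta π H i j k x = -Theta π H i k j x := by
  simp only [Theta, ← Finset.sum_neg_distrib]
  exact Finset.sum_congr rfl fun l _ => by rw [h.H_anti_left x hx]; ring

theorem piPiH_anti {x : Fin m → ℝ} (hx : x ∈ U) (i j k : Fin m) :
    piPiH π H i j k x = -piPiH π H j i k x := by
  simp only [piPiH, ← Finset.sum_neg_distrib]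
  rw [Finset.sum_comm]
  exact Finset.sum_congr rfl fun l _ => Finset.sum_congr rfl fun n _ => by
    rw [h.H_anti_right x hx]; ring

end IsTwistedPoisson

end Tensors

/-! ### The action densities in normal form -/

section Densities

variable {m : ℕ} {𝒢 : Type*} [NormedRing 𝒢] [NormedAlgebra ℝ 𝒢] {𝒜 : ℤ → Submodule ℝ 𝒢}
  [GradedAlgebra 𝒜] {U : Set (Fin m → ℝ)} {π : (Fin m → ℝ) → Fin m → Fin m → ℝ}
  {H : (Fin m → ℝ) → Fin m → Fin m → Fin m → ℝ}

variable (𝒜 π H) in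
/-- The integrand over `Σ` of the Grigoriev-Damgaard action. -/
def gdDensity (Φ : SigmaField m 𝒢) (σ : ℝ × ℝ) : 𝒢 :=
  berezin (psmL 𝒜 π Φ σ
    + (1 / 2 : ℝ) • ∑ i, ∑ j, ∑ k, atX 𝒜 (piPiH π H i j k) Φ σ
        * SA 𝒜 Φ i σ * SA 𝒜 Φ j σ * eps1 (SX 𝒜 Φ k σ))

variable (𝒜 π H) in
/-- The integrand over `Σ` of the Grigoriev-Damgaard action in Darboux coordinates. -/
def darbouxDensity (Φ : SigmaField m 𝒢) (σ : ℝ × ℝ) : 𝒢 :=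
  berezin (psmL 𝒜 π Φ σ
    + (1 / 2 : ℝ) • ∑ i, ∑ j, ∑ k, atX 𝒜 (piPiH π H i j k) Φ σ
        * SA 𝒜 Φ i σ * SA 𝒜 Φ j σ * eps1 (SX 𝒜 Φ k σ)
    - ∑ i, ∑ k, ∑ l, atX 𝒜 (Theta π H i k l) Φ σ * SA 𝒜 Φ i σ
        * eps0 (SX 𝒜 Φ k σ) * d1 (SX 𝒜 Φ l) σ)

theorem SGD_eq (Φ : BVField m 𝒢) :
    SGD 𝒜 π H Φ = intSigma (gdDensity 𝒜 π H Φ.toSigmaField) + wz 𝒢 H Φ.XN := rfl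

theorem SDarboux_eq (Φ : BVField m 𝒢) :
    SDarboux 𝒜 π H Φ = intSigma (darbouxDensity 𝒜 π H Φ.toSigmaField) + wz 𝒢 H Φ.XN := rfl

/-- A quarter of `∂_n ∂_k f + ∂_k ∂_n f`; for `f = π^{ij}` this is the coefficient of
`A₀^{+k} A₁^{+n} c_i c_j` in `½ π(𝐗)𝐀𝐀`. -/
def quarterHess (f : (Fin m → ℝ) → ℝ) (x : Fin m → ℝ) (k n : Fin m) : ℝ :=
  (1 / 2 : ℝ) * ((1 / 2 : ℝ) * (pd n (pd k f) x + pd k (pd n f) x))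

theorem psmL_t10 (h𝒜 : GradedComm 𝒜) (hU : IsOpen U) (hπ : IsTwistedPoisson U π H)
    {Φ : SigmaField m 𝒢} {σ : ℝ × ℝ} (h : HasGhosts 𝒜 Φ σ) (hX : DifferentiableAt ℝ Φ.X σ)
    (hx : Φ.X σ ∈ U) :
    (psmL 𝒜 π Φ σ).t10 = ∑ i, kinetic Φ σ i
      + ∑ i, ∑ j, normalTerm (π (Φ.X σ) i j) (fun k => pd k (fun x => π x i j) (Φ.X σ))
        (fun k => pd k (fun x => π x i j) (Φ.X σ)) (fun k => pd k (fun x => π x i j) (Φ.X σ)) 0 0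
        (quarterHess (fun x => π x i j) (Φ.X σ)) Φ σ i j := by
  have hF : ∀ x ∈ U, ∀ i j, π x i j = -π x j i := hπ.pi_anti
  have hdF : ∀ x ∈ U, ∀ a i j, pd a (fun x => π x i j) x = -pd a (fun x => π x j i) x :=
    fun x hx a i j => pd_eq_neg_of_eqOn hU (fun y hy => hF y hy i j) hx a
  have key := half_smul_sum_sum_eq (atX_mul_SA_mul_SA h𝒜 h (fun i j x => π x i j) (hF _ hx)
    (hdF _ hx)
    (fun a b i j => pd_eq_neg_of_eqOn hU (fun y hy => hdF y hy b i j) hx a) rfl)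
  simp only [psmL, SuperFun.add_t10, SuperFun.sum_t10, SuperFun.smul_t10,
    SA_mul_dd_SX h hX, key]
  rfl

theorem darbouxDensity_eq (h𝒜 : GradedComm 𝒜) (hU : IsOpen U) (hπ : IsTwistedPoisson U π H)
    {Φ : SigmaField m 𝒢} {σ : ℝ × ℝ} (h : HasGhosts 𝒜 Φ σ) (hX : DifferentiableAt ℝ Φ.X σ)
    (hx : Φ.X σ ∈ U) :
    darbouxDensity 𝒜 π H Φ σ = ∑ i, kinetic Φ σ i + ∑ i, ∑ j, normalTerm (π (Φ.X σ) i j)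
      (fun k => pd k (fun x => π x i j) (Φ.X σ) + piPiH π H i j k (Φ.X σ))
      (fun k => pd k (fun x => π x i j) (Φ.X σ))
      (fun k => pd k (fun x => π x i j) (Φ.X σ) + piPiH π H i j k (Φ.X σ))
      (fun k => -Theta π H i k j (Φ.X σ)) 0
      (fun k n => quarterHess (fun x => π x i j) (Φ.X σ) k n
        + (1 / 2 : ℝ) * pd k (piPiH π H i j n) (Φ.X σ)) Φ σ i j := by
  have key := half_smul_sum_sum_eq (atX_mul_SA_mul_SA_mul_eps1 h𝒜 h (piPiH π H)
    (hπ.piPiH_anti hx)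
    (fun a i j k => pd_eq_neg_of_eqOn hU (fun y hy => hπ.piPiH_anti hy i j k) hx a) rfl)
  simp only [darbouxDensity, berezin, SuperFun.add_t10, SuperFun.sub_t10, SuperFun.sum_t10,
    SuperFun.smul_t10, psmL_t10 h𝒜 hU hπ h hX hx, key, atX_mul_SA_mul_eps0_mul_d1 h𝒜 h hX]
  rw [sub_eq_add_neg, ← neg_one_smul ℝ (∑ i, ∑ j, normalTerm _ _ _ _ _ _ _ _ _ _ _)]
  simp only [add_assoc, Finset.smul_sum, ← Finset.sum_add_distrib, smul_normalTerm, normalTerm_add]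
  congr! 6 with i _ j _ <;> (funext; simp)

theorem covDensity_eq (h𝒜 : GradedComm 𝒜) (hU : IsOpen U) (hπ : IsTwistedPoisson U π H)
    {Φ : SigmaField m 𝒢} {σ : ℝ × ℝ} (h : HasGhosts 𝒜 Φ σ) (hX : DifferentiableAt ℝ Φ.X σ)
    (hx : Φ.X σ ∈ U) :
    covDensity 𝒜 π H Φ σ = ∑ i, kinetic Φ σ i + ∑ i, ∑ j, normalTerm (π (Φ.X σ) i j)
      (fun k => pd k (fun x => π x i j) (Φ.X σ) + piPiH π H i j k (Φ.X σ))
      (fun k => pd k (fun x => π x i j) (Φ.X σ) + (1 / 2 : ℝ) * piPiH π H i j k (Φ.X σ))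
      (fun k => pd k (fun x => π x i j) (Φ.X σ) + (1 / 2 : ℝ) * piPiH π H i j k (Φ.X σ))
      (fun k => (1 / 2 : ℝ) * Theta π H i j k (Φ.X σ))
      (fun k => (1 / 2 : ℝ) * Theta π H i j k (Φ.X σ))
      (fun k n => quarterHess (fun x => π x i j) (Φ.X σ) k n
        + (1 / 4 : ℝ) * (pd k (piPiH π H i j n) (Φ.X σ) + pd n (piPiH π H i j k) (Φ.X σ))
        - (1 / 8 : ℝ) * (piPiPiHH π H i j k n (Φ.X σ) + piPiPiHH π H i j n k (Φ.X σ))) Φ σ i j := by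
  have key1 := half_smul_sum_sum_eq (atX_mul_SA_mul_SA_mul_eps1 h𝒜 h (piPiH π H)
    (hπ.piPiH_anti hx)
    (fun a i j k => pd_eq_neg_of_eqOn hU (fun y hy => hπ.piPiH_anti hy i j k) hx a) rfl)
  have key0 := half_smul_sum_sum_eq (atX_mul_SA_mul_SA_mul_eps0 h𝒜 h (piPiH π H)
    (hπ.piPiH_anti hx)
    (fun a i j k => pd_eq_neg_of_eqOn hU (fun y hy => hπ.piPiH_anti hy i j k) hx a) rfl)
  have quarter : (1 / 4 : ℝ) = (1 / 2 : ℝ) * (1 / 2) := by norm_num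
  have eps_split : ∀ i j k, (atX 𝒜 (piPiH π H i j k) Φ σ * SA 𝒜 Φ i σ * SA 𝒜 Φ j σ
      * eps (SX 𝒜 Φ k σ)).t10
      = (atX 𝒜 (piPiH π H i j k) Φ σ * SA 𝒜 Φ i σ * SA 𝒜 Φ j σ * eps0 (SX 𝒜 Φ k σ)).t10
      + (atX 𝒜 (piPiH π H i j k) Φ σ * SA 𝒜 Φ i σ * SA 𝒜 Φ j σ * eps1 (SX 𝒜 Φ k σ)).t10 := by
    intro i j k
    rw [eps, mul_add, SuperFun.add_t10]
  simp only [covDensity, berezin, SuperFun.add_t10, SuperFun.sub_t10, SuperFun.sum_t10,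
    SuperFun.smul_t10, psmL_t10 h𝒜 hU hπ h hX hx, atX_mul_SA_mul_dd_mul_eps h𝒜 h hX,
    atX_mul_SA_mul_SA_mul_eps_mul_eps h𝒜 h, eps_split]
  rw [quarter, mul_smul]
  simp only [Finset.sum_add_distrib]
  rw [smul_add (1 / 2 : ℝ) (Finset.sum _ _) (Finset.sum _ _), key0, key1]
  rw [sub_eq_add_neg, ← neg_smul]
  simp only [add_assoc, Finset.smul_sum, ← Finset.sum_add_distrib, smul_normalTerm,
    normalTerm_add, ← smul_add]
  congr! 6 with i _ j _ <;> first | (simp; ring) | simp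

end Densities

/-! ### Component form of the transformations -/

section BVFieldAlgebra

variable {m : ℕ} {𝒢 : Type*} [NormedRing 𝒢]

section Add

variable (Φ Ψ : BVField m 𝒢)

@[simp] theorem add_X : (Φ + Ψ).X = Φ.X + Ψ.X := rfl
@[simp] theorem add_c : (Φ + Ψ).c = Φ.c + Ψ.c := rfl
@[simp] theorem add_A0 : (Φ + Ψ).A0 = Φ.A0 + Ψ.A0 := rfl
@[simp] theorem add_A1 : (Φ + Ψ).A1 = Φ.A1 + Ψ.A1 := rfl
@[simp] theorem add_Ap0 : (Φ + Ψ).Ap0 = Φ.Ap0 + Ψ.Ap0 := rfl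
@[simp] theorem add_Ap1 : (Φ + Ψ).Ap1 = Φ.Ap1 + Ψ.Ap1 := rfl
@[simp] theorem add_Xp : (Φ + Ψ).Xp = Φ.Xp + Ψ.Xp := rfl
@[simp] theorem add_cp : (Φ + Ψ).cp = Φ.cp + Ψ.cp := rfl
@[simp] theorem add_XN : (Φ + Ψ).XN = Φ.XN + Ψ.XN := rfl

end Add

variable [NormedAlgebra ℝ 𝒢] (Φ Ψ : BVField m 𝒢) (s : ℝ)

@[simp] theorem smul_X : (s • Φ).X = s • Φ.X := rfl
@[simp] theorem smul_c : (s • Φ).c = s • Φ.c := rfl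
@[simp] theorem smul_A0 : (s • Φ).A0 = s • Φ.A0 := rfl
@[simp] theorem smul_A1 : (s • Φ).A1 = s • Φ.A1 := rfl
@[simp] theorem smul_Ap0 : (s • Φ).Ap0 = s • Φ.Ap0 := rfl
@[simp] theorem smul_Ap1 : (s • Φ).Ap1 = s • Φ.Ap1 := rfl
@[simp] theorem smul_Xp : (s • Φ).Xp = s • Φ.Xp := rfl
@[simp] theorem smul_cp : (s • Φ).cp = s • Φ.cp := rfl
@[simp] theorem smul_XN : (s • Φ).XN = s • Φ.XN := rfl

theorem add_smul_add_smul (s t : ℝ) : (Φ + s • Ψ) + t • Ψ = Φ + (s + t) • Ψ := by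
  apply BVField.ext <;> simp [add_smul, add_assoc]

theorem add_zero_smul : Φ + (0 : ℝ) • Ψ = Φ := by
  apply BVField.ext <;> simp

end BVFieldAlgebra

section Transformations

variable {m : ℕ} {𝒢 : Type*} [NormedRing 𝒢] [NormedAlgebra ℝ 𝒢] {𝒜 : ℤ → Submodule ℝ 𝒢}
  {U : Set (Fin m → ℝ)} {π : (Fin m → ℝ) → Fin m → Fin m → ℝ}
  {H : (Fin m → ℝ) → Fin m → Fin m → Fin m → ℝ}

theorem IsTangent.X_eq {Φ : BVField m 𝒢} (h : IsTangent 𝒜 Φ) :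
    Φ.X = fun σ : ℝ × ℝ => Φ.XN (Complex.exp (σ.2 * Complex.I), σ.1) := funext h.boundary

theorem exp_mem_solidTorus (σ : ℝ × ℝ) :
    (Complex.exp (σ.2 * Complex.I), σ.1) ∈ solidTorus := by
  simp [solidTorus, Complex.norm_exp_ofReal_mul_I]

theorem IsTangent.X_smooth {Φ : BVField m 𝒢} (h : IsTangent 𝒜 Φ) : ContDiff ℝ ∞ Φ.X := by
  rw [h.X_eq, ← contDiffOn_univ]
  refine h.XN_smooth.comp (ContDiff.contDiffOn ?_) fun σ _ => exp_mem_solidTorus σ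
  refine ContDiff.prodMk ?_ contDiff_fst
  exact Complex.contDiff_exp.comp
    ((Complex.ofRealCLM.contDiff.comp contDiff_snd).mul contDiff_const)

theorem IsTangent.X_differentiable {Φ : BVField m 𝒢} (h : IsTangent 𝒜 Φ) :
    Differentiable ℝ Φ.X := h.X_smooth.differentiable (by norm_num)

theorem X_mem {Φ : BVField m 𝒢} (h : Φ ∈ bvFields 𝒜 U) (σ : ℝ × ℝ) : Φ.X σ ∈ U := by
  rw [h.1.boundary]
  exact h.2 _ (exp_mem_solidTorus σ)

variable (H) in
/-- The vector field that changes only `X⁺`, by `H_{ijk}(X) ∂₁X^j A₀^{+k}`; the transformation `T1`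
is translation by it. -/
def darbouxShift (Φ : BVField m 𝒢) : BVField m 𝒢 :=
  { X := 0, c := 0, A0 := 0, A1 := 0, Ap0 := 0, Ap1 := 0, cp := 0, XN := 0
    Xp := fun σ i => ∑ j, ∑ k, (H (Φ.X σ) i j k * fderiv ℝ Φ.X σ (0, 1) j) • Φ.Ap0 σ k }

variable (π H) in
/-- The Hamiltonian vector field of `Λ`. It depends on `X`, `c` and `A⁺` only and changes only the
fields conjugate to them, so that its flow is translation. -/
def hamLam (Φ : BVField m 𝒢) : BVField m 𝒢 :=
  { X := 0, c := 0, Ap0 := 0, Ap1 := 0, XN := 0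
    A0 := fun σ i => ∑ j, ∑ k, ((1 / 2 : ℝ) * Theta π H j k i (Φ.X σ)) • (Φ.Ap0 σ k * Φ.c σ j)
    A1 := fun σ i => -∑ j, ∑ k, ((1 / 2 : ℝ) * Theta π H j k i (Φ.X σ)) • (Φ.Ap1 σ k * Φ.c σ j)
    Xp := fun σ i => -∑ j, ∑ k, ∑ l, ((1 / 2 : ℝ) * pd i (Theta π H j k l) (Φ.X σ))
      • (Φ.Ap0 σ k * Φ.Ap1 σ l * Φ.c σ j)
    cp := fun σ i => -∑ j, ∑ k, ((1 / 2 : ℝ) * Theta π H i j k (Φ.X σ))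
      • (Φ.Ap0 σ j * Φ.Ap1 σ k) }

theorem darbouxShift_add (Φ : BVField m 𝒢) (s : ℝ) :
    darbouxShift H (Φ + s • darbouxShift H Φ) = darbouxShift H Φ := by
  apply BVField.ext <;> simp [darbouxShift]

theorem hamLam_add (Φ : BVField m 𝒢) (s : ℝ) :
    hamLam π H (Φ + s • hamLam π H Φ) = hamLam π H Φ := by
  apply BVField.ext <;> simp [hamLam]

variable [GradedAlgebra 𝒜]

theorem secX_eq {Φ : BVField m 𝒢} {σ : ℝ × ℝ}
    (h : HasGhosts 𝒜 Φ.toSigmaField σ) (i : Fin m) :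
    secX 𝒜 π H Φ.toSigmaField i σ
      = SX 𝒜 (Φ + (-1 : ℝ) • hamLam π H Φ).toSigmaField i σ := by
  have hp := h.parityRules
  ext <;> simp [secX, SX, hamLam, hp.Ap0, Finset.smul_sum, smul_smul, parity_one]

/-- The component along `θ¹θ⁰` is the delicate one: the terms with `∂Θ` that come from expanding
`Θ(𝐗)` in the antifields cancel against all but the totally contracted `∂_i Θ^j_{kl}`. -/
theorem secA_eq (h𝒜 : GradedComm 𝒜) {Φ : BVField m 𝒢} {σ : ℝ × ℝ}
    (h : HasGhosts 𝒜 Φ.toSigmaField σ) (i : Fin m) :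
    secA 𝒜 π H Φ.toSigmaField i σ
      = SA 𝒜 (Φ + (-1 : ℝ) • hamLam π H Φ).toSigmaField i σ := by
  have hp := h.parityRules
  have ho := h.orderRules h𝒜
  ext
  · simp [secA, SA, SX, hamLam]
  · simp [secA, SA, SX, hamLam, parity_one, Finset.smul_sum, smul_smul]
  · simp [secA, SA, SX, hamLam, parity_one, Finset.smul_sum, smul_smul]
  · have e : ∀ j, ∑ k, ∑ a, pd a (Theta π H j k i) (Φ.X σ) • (Φ.Ap0 σ a * (Φ.Ap1 σ k * Φ.c σ j))
        = ∑ k, ∑ a, pd k (Theta π H j a i) (Φ.X σ) • (Φ.Ap0 σ k * (Φ.Ap1 σ a * Φ.c σ j)) :=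
      fun j => Finset.sum_comm
    simp [secA, SA, SX, hamLam, hp.Ap0, hp.Ap1, ho.Ap1_Ap0', Finset.sum_mul, mul_assoc,
      add_smul, sub_smul, add_mul, sub_mul, Finset.sum_add_distrib, Finset.sum_sub_distrib, e]
    simp only [mul_smul, ← Finset.smul_sum]
    module

theorem T2_eq (h𝒜 : GradedComm 𝒜) {Φ : BVField m 𝒢} (h : IsTangent 𝒜 Φ) :
    T2 𝒜 π H Φ = Φ + (-1 : ℝ) • hamLam π H Φ := by
  have hX := fun i σ => secX_eq (π := π) (H := H) (h.hasGhosts σ) i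
  have hA := fun i σ => secA_eq (π := π) (H := H) h𝒜 (h.hasGhosts σ) i
  apply BVField.ext <;> simp only [T2, ofSuper, hX, hA] <;> funext σ i <;> simp [SX, SA, hamLam]

/-- The superfield `H_{ijk}(𝐗) (ε₀𝐗^j) d₁𝐗^k` is `θ¹θ⁰` times a function, since both odd factors
start at first order; antisymmetry of `H` turns that function into the shift of `X⁺`. -/
theorem primA_eq {Φ : SigmaField m 𝒢} {σ : ℝ × ℝ}
    (h : HasGhosts 𝒜 Φ σ) (hX : DifferentiableAt ℝ Φ.X σ)
    (hH : ∀ i j k, H (Φ.X σ) i j k = -H (Φ.X σ) i k j) (i : Fin m) :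
    primA 𝒜 H Φ i σ = SA 𝒜 Φ i σ + ⟨0, 0, 0, ∑ j, ∑ k,
      (H (Φ.X σ) i j k * fderiv ℝ Φ.X σ (0, 1) j) • Φ.Ap0 σ k⟩ := by
  have hp := h.parityRules
  have key : ∑ j, ∑ k, (H (Φ.X σ) i j k * fderiv ℝ Φ.X σ (0, 1) j) • Φ.Ap0 σ k
      = -∑ j, ∑ k, (fderiv ℝ Φ.X σ (0, 1) k * H (Φ.X σ) i j k) • Φ.Ap0 σ j := by
    rw [Finset.sum_comm]
    simp only [← Finset.sum_neg_distrib]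
    exact Finset.sum_congr rfl fun j _ => Finset.sum_congr rfl fun k _ => by
      rw [hH, ← neg_smul]; congr 1; ring
  ext <;> simp [primA, SA, SX, d1_SX hX, parity_one, hp.Ap0, key, smul_smul]

theorem T1_eq (hH : ∀ x ∈ U, ∀ i j k, H x i j k = -H x i k j) {Φ : BVField m 𝒢}
    (h : Φ ∈ bvFields 𝒜 U) :
    T1 𝒜 H Φ = Φ + (1 : ℝ) • darbouxShift H Φ := by
  have hA := fun i σ => primA_eq (h.1.hasGhosts σ) (h.1.X_differentiable σ) (hH _ (X_mem h σ)) i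
  apply BVField.ext <;> simp only [T1, ofSuper, hA] <;> funext σ i <;>
    simp [SX, SA, darbouxShift]

end Transformations

/-! ### The transformations are bijections of the space of fields -/

section Bijections

variable {m : ℕ} {𝒢 : Type*} [NormedRing 𝒢] [NormedAlgebra ℝ 𝒢] {𝒜 : ℤ → Submodule ℝ 𝒢}
  {U : Set (Fin m → ℝ)} {π : (Fin m → ℝ) → Fin m → Fin m → ℝ}
  {H : (Fin m → ℝ) → Fin m → Fin m → Fin m → ℝ}

theorem IsComponent.zero (k : ℤ) : IsComponent 𝒜 k (0 : ℝ × ℝ → Fin m → 𝒢) :=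
  ⟨contDiff_const, fun _ _ => rfl, fun _ _ => rfl, fun _ _ => zero_mem _⟩

theorem IsComponent.add_smul {k : ℤ} {f g : ℝ × ℝ → Fin m → 𝒢} (hf : IsComponent 𝒜 k f)
    (hg : IsComponent 𝒜 k g) (s : ℝ) : IsComponent 𝒜 k (f + s • g) :=
  ⟨hf.smooth.add (contDiff_const.smul hg.smooth),
    fun _ _ => by simp [hf.periodic0, hg.periodic0],
    fun _ _ => by simp [hf.periodic1, hg.periodic1],
    fun σ i => add_mem (hf.ghost σ i) (Submodule.smul_mem _ s (hg.ghost σ i))⟩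

theorem IsTangent.add_smul {Φ Ψ : BVField m 𝒢} (hΦ : IsTangent 𝒜 Φ) (hΨ : IsTangent 𝒜 Ψ) (s : ℝ) :
    IsTangent 𝒜 (Φ + s • Ψ) where
  XN_smooth := hΦ.XN_smooth.add (contDiffOn_const.smul hΨ.XN_smooth)
  XN_periodic p hp := by simp [hΦ.XN_periodic p hp, hΨ.XN_periodic p hp]
  boundary σ := by simp [hΦ.boundary, hΨ.boundary]
  c := hΦ.c.add_smul hΨ.c s
  A0 := hΦ.A0.add_smul hΨ.A0 s
  A1 := hΦ.A1.add_smul hΨ.A1 s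
  Ap0 := hΦ.Ap0.add_smul hΨ.Ap0 s
  Ap1 := hΦ.Ap1.add_smul hΨ.Ap1 s
  Xp := hΦ.Xp.add_smul hΨ.Xp s
  cp := hΦ.cp.add_smul hΨ.cp s

theorem add_smul_mem_bvFields {Φ Ψ : BVField m 𝒢} (hΦ : Φ ∈ bvFields 𝒜 U) (hΨ : IsTangent 𝒜 Ψ)
    (h0 : Ψ.XN = 0) (s : ℝ) : Φ + s • Ψ ∈ bvFields 𝒜 U :=
  ⟨hΦ.1.add_smul hΨ s, fun p hp => by simpa [h0] using hΦ.2 p hp⟩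

theorem IsTangent.X_periodic0 {Φ : BVField m 𝒢} (h : IsTangent 𝒜 Φ) (s t : ℝ) :
    Φ.X (s + 2 * Real.pi, t) = Φ.X (s, t) := by
  rw [h.boundary, h.boundary]
  exact h.XN_periodic _ (exp_mem_solidTorus (s, t))

theorem IsTangent.X_periodic1 {Φ : BVField m 𝒢} (h : IsTangent 𝒜 Φ) (s t : ℝ) :
    Φ.X (s, t + 2 * Real.pi) = Φ.X (s, t) := by
  rw [h.boundary, h.boundary]
  have : Complex.exp (((t + 2 * Real.pi : ℝ) : ℂ) * Complex.I) = Complex.exp (t * Complex.I) := by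
    push_cast
    rw [add_mul, Complex.exp_add, Complex.exp_two_pi_mul_I, mul_one]
  simp only [this]

theorem fderiv_add_right {E : Type*} [NormedAddCommGroup E] [NormedSpace ℝ E] {f : ℝ × ℝ → E}
    {a : ℝ × ℝ} (h : ∀ σ, f (σ + a) = f σ) (σ : ℝ × ℝ) : fderiv ℝ f (σ + a) = fderiv ℝ f σ := by
  rw [← fderiv_comp_add_right]
  simp only [h]

theorem fderiv_periodic0 {E : Type*} [NormedAddCommGroup E] [NormedSpace ℝ E] {f : ℝ × ℝ → E}
    (h : ∀ s t, f (s + 2 * Real.pi, t) = f (s, t)) (s t : ℝ) :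
    fderiv ℝ f (s + 2 * Real.pi, t) = fderiv ℝ f (s, t) := by
  have := fderiv_add_right (f := f) (a := (2 * Real.pi, 0)) (fun σ => by
    obtain ⟨a, b⟩ := σ
    simpa using h a b) (s, t)
  simpa using this

theorem fderiv_periodic1 {E : Type*} [NormedAddCommGroup E] [NormedSpace ℝ E] {f : ℝ × ℝ → E}
    (h : ∀ s t, f (s, t + 2 * Real.pi) = f (s, t)) (s t : ℝ) :
    fderiv ℝ f (s, t + 2 * Real.pi) = fderiv ℝ f (s, t) := by
  have := fderiv_add_right (f := f) (a := (0, 2 * Real.pi)) (fun σ => by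
    obtain ⟨a, b⟩ := σ
    simpa using h a b) (s, t)
  simpa using this

theorem contDiff_comp_X {Φ : BVField m 𝒢} (h : Φ ∈ bvFields 𝒜 U) {f : (Fin m → ℝ) → ℝ}
    (hf : ContDiffOn ℝ ∞ f U) : ContDiff ℝ ∞ fun σ => f (Φ.X σ) := by
  rw [← contDiffOn_univ]
  exact hf.comp h.1.X_smooth.contDiffOn fun σ _ => X_mem h σ

theorem contDiff_fderiv_X {Φ : BVField m 𝒢} (h : IsTangent 𝒜 Φ) (v : ℝ × ℝ) (i : Fin m) :
    ContDiff ℝ ∞ fun σ => fderiv ℝ Φ.X σ v i :=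
  contDiff_pi.1 ((h.X_smooth.fderiv_right (m := ∞) (by norm_num)).clm_apply contDiff_const) i

theorem IsComponent.contDiff_apply {k : ℤ} {f : ℝ × ℝ → Fin m → 𝒢} (hf : IsComponent 𝒜 k f)
    (i : Fin m) : ContDiff ℝ ∞ fun σ => f σ i := contDiff_pi.1 hf.smooth i

theorem isTangent_darbouxShift (hH : ∀ i j k, ContDiffOn ℝ ∞ (fun x => H x i j k) U)
    {Φ : BVField m 𝒢} (h : Φ ∈ bvFields 𝒜 U) : IsTangent 𝒜 (darbouxShift H Φ) where
  XN_smooth := contDiffOn_const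
  XN_periodic _ _ := rfl
  boundary _ := rfl
  c := .zero 1
  A0 := .zero 0
  A1 := .zero 0
  Ap0 := .zero (-1)
  Ap1 := .zero (-1)
  Xp :=
    { smooth := by
        dsimp only [darbouxShift]
        exact contDiff_pi.2 fun i => ContDiff.sum fun j _ => ContDiff.sum fun k _ =>
        ((contDiff_comp_X h (hH i j k)).mul (contDiff_fderiv_X h.1 _ j)).smul
          (h.1.Ap0.contDiff_apply k)
      periodic0 := fun s t => by
        simp [darbouxShift, h.1.X_periodic0, h.1.Ap0.periodic0, fderiv_periodic0 h.1.X_periodic0]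
      periodic1 := fun s t => by
        simp [darbouxShift, h.1.X_periodic1, h.1.Ap0.periodic1, fderiv_periodic1 h.1.X_periodic1]
      ghost := fun σ i => by
        dsimp only [darbouxShift]
        exact Submodule.sum_mem _ fun j _ => Submodule.sum_mem _ fun k _ =>
        Submodule.smul_mem _ _ (h.1.Ap0.ghost σ k) }
  cp := .zero (-2)

/-- A translation by a vector field that is constant along its own flow lines is invertible, with
the opposite translation as inverse. -/
theorem bijOn_of_translation {T V : BVField m 𝒢 → BVField m 𝒢} (r : ℝ)
    (hT : ∀ Φ ∈ bvFields 𝒜 U, T Φ = Φ + r • V Φ)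
    (hV : ∀ Φ ∈ bvFields 𝒜 U, IsTangent 𝒜 (V Φ)) (hXN : ∀ Φ, (V Φ).XN = 0)
    (hVV : ∀ Φ (s : ℝ), V (Φ + s • V Φ) = V Φ) :
    Set.BijOn T (bvFields 𝒜 U) (bvFields 𝒜 U) := by
  have hmaps : ∀ s : ℝ, ∀ Φ ∈ bvFields 𝒜 U, Φ + s • V Φ ∈ bvFields 𝒜 U := fun s Φ hΦ =>
    add_smul_mem_bvFields hΦ (hV Φ hΦ) (hXN Φ) s
  refine Set.InvOn.bijOn (f' := fun Φ => Φ + (-r) • V Φ) ⟨fun Φ hΦ => ?_, fun Φ hΦ => ?_⟩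
    (fun Φ hΦ => by rw [hT Φ hΦ]; exact hmaps r Φ hΦ) (hmaps (-r))
  · simp only [hT Φ hΦ, hVV, add_smul_add_smul, add_neg_cancel, add_zero_smul]
  · simp only [hT _ (hmaps (-r) Φ hΦ), hVV, add_smul_add_smul, neg_add_cancel, add_zero_smul]

variable [GradedAlgebra 𝒜]

theorem mul_mem_graded {p q r : ℤ} (hr : p + q = r) {a b : 𝒢} (ha : a ∈ 𝒜 p) (hb : b ∈ 𝒜 q) :
    a * b ∈ 𝒜 r :=
  hr ▸ SetLike.GradedMul.mul_mem ha hb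

theorem isTangent_hamLam (hU : IsOpen U) (hΘ : ∀ i j k, ContDiffOn ℝ ∞ (Theta π H i j k) U)
    {Φ : BVField m 𝒢} (h : Φ ∈ bvFields 𝒜 U) : IsTangent 𝒜 (hamLam π H Φ) where
  XN_smooth := contDiffOn_const
  XN_periodic _ _ := rfl
  boundary _ := rfl
  c := .zero 1
  A0 :=
    { smooth := by
        dsimp only [hamLam]
        exact contDiff_pi.2 fun i => ContDiff.sum fun j _ => ContDiff.sum fun k _ =>
        (contDiff_const.mul (contDiff_comp_X h (hΘ j k i))).smul
          ((h.1.Ap0.contDiff_apply k).mul (h.1.c.contDiff_apply j))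
      periodic0 := fun s t => by
        simp [hamLam, h.1.X_periodic0, h.1.Ap0.periodic0, h.1.c.periodic0]
      periodic1 := fun s t => by
        simp [hamLam, h.1.X_periodic1, h.1.Ap0.periodic1, h.1.c.periodic1]
      ghost := fun σ i => by
        dsimp only [hamLam]
        exact Submodule.sum_mem _ fun j _ => Submodule.sum_mem _ fun k _ =>
        Submodule.smul_mem _ _
          (mul_mem_graded (by norm_num) (h.1.Ap0.ghost σ k) (h.1.c.ghost σ j)) }
  A1 :=
    { smooth := by
        dsimp only [hamLam]
        exact contDiff_pi.2 fun i => ContDiff.neg <| ContDiff.sum fun j _ =>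
        ContDiff.sum fun k _ => (contDiff_const.mul (contDiff_comp_X h (hΘ j k i))).smul
          ((h.1.Ap1.contDiff_apply k).mul (h.1.c.contDiff_apply j))
      periodic0 := fun s t => by
        simp [hamLam, h.1.X_periodic0, h.1.Ap1.periodic0, h.1.c.periodic0]
      periodic1 := fun s t => by
        simp [hamLam, h.1.X_periodic1, h.1.Ap1.periodic1, h.1.c.periodic1]
      ghost := fun σ i => by
        dsimp only [hamLam]
        exact neg_mem <| Submodule.sum_mem _ fun j _ => Submodule.sum_mem _ fun k _ =>
        Submodule.smul_mem _ _
          (mul_mem_graded (by norm_num) (h.1.Ap1.ghost σ k) (h.1.c.ghost σ j)) }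
  Ap0 := .zero (-1)
  Ap1 := .zero (-1)
  Xp :=
    { smooth := by
        dsimp only [hamLam]
        exact contDiff_pi.2 fun i => ContDiff.neg <| ContDiff.sum fun j _ =>
        ContDiff.sum fun k _ => ContDiff.sum fun l _ =>
          (contDiff_const.mul (contDiff_comp_X h (contDiffOn_pd hU (hΘ j k l) i))).smul
          (((h.1.Ap0.contDiff_apply k).mul (h.1.Ap1.contDiff_apply l)).mul
            (h.1.c.contDiff_apply j))
      periodic0 := fun s t => by
        simp [hamLam, h.1.X_periodic0, h.1.Ap0.periodic0, h.1.Ap1.periodic0, h.1.c.periodic0]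
      periodic1 := fun s t => by
        simp [hamLam, h.1.X_periodic1, h.1.Ap0.periodic1, h.1.Ap1.periodic1, h.1.c.periodic1]
      ghost := fun σ i => by
        dsimp only [hamLam]
        exact neg_mem <| Submodule.sum_mem _ fun j _ => Submodule.sum_mem _ fun k _ =>
        Submodule.sum_mem _ fun l _ => Submodule.smul_mem _ _ (mul_mem_graded (p := -2)
          (by norm_num) (mul_mem_graded (by norm_num) (h.1.Ap0.ghost σ k) (h.1.Ap1.ghost σ l))
          (h.1.c.ghost σ j)) }
  cp :=
    { smooth := by
        dsimp only [hamLam]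
        exact contDiff_pi.2 fun i => ContDiff.neg <| ContDiff.sum fun j _ =>
        ContDiff.sum fun k _ => (contDiff_const.mul (contDiff_comp_X h (hΘ i j k))).smul
          ((h.1.Ap0.contDiff_apply j).mul (h.1.Ap1.contDiff_apply k))
      periodic0 := fun s t => by
        simp [hamLam, h.1.X_periodic0, h.1.Ap0.periodic0, h.1.Ap1.periodic0]
      periodic1 := fun s t => by
        simp [hamLam, h.1.X_periodic1, h.1.Ap0.periodic1, h.1.Ap1.periodic1]
      ghost := fun σ i => by
        dsimp only [hamLam]
        exact neg_mem <| Submodule.sum_mem _ fun j _ => Submodule.sum_mem _ fun k _ =>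
        Submodule.smul_mem _ _
          (mul_mem_graded (by norm_num) (h.1.Ap0.ghost σ j) (h.1.Ap1.ghost σ k)) }

theorem bijOn_T1 (hπ : IsTwistedPoisson U π H) :
    Set.BijOn (T1 𝒜 H) (bvFields 𝒜 U) (bvFields 𝒜 U) :=
  bijOn_of_translation 1 (fun _ => T1_eq hπ.H_anti_right)
    (fun _ => isTangent_darbouxShift hπ.H_smooth) (fun _ => rfl) darbouxShift_add

theorem bijOn_T2 (h𝒜 : GradedComm 𝒜) (hU : IsOpen U) (hπ : IsTwistedPoisson U π H) :
    Set.BijOn (T2 𝒜 π H) (bvFields 𝒜 U) (bvFields 𝒜 U) :=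
  bijOn_of_translation (-1) (fun _ h => T2_eq h𝒜 h.1)
    (fun _ => isTangent_hamLam hU hπ.Theta_smooth) (fun _ => rfl) hamLam_add

end Bijections

/-! ### The tensor identity behind the covariance of the quartic term -/

section TensorIdentity

variable {ι E : Type*} [Fintype ι] [AddCommMonoid E]

theorem sum_move2 (f : ι → ι → ι → E) :
    ∑ a, ∑ i, ∑ j, f a i j = ∑ i, ∑ j, ∑ a, f a i j := by
  rw [Finset.sum_comm]
  exact Finset.sum_congr rfl fun i _ => Finset.sum_comm

theorem sum_move3 (f : ι → ι → ι → ι → E) :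
    ∑ a, ∑ i, ∑ j, ∑ k, f a i j k = ∑ i, ∑ j, ∑ k, ∑ a, f a i j k := by
  rw [Finset.sum_comm]
  exact Finset.sum_congr rfl fun i _ => sum_move2 _

theorem sum_move4 (f : ι → ι → ι → ι → ι → E) :
    ∑ a, ∑ i, ∑ j, ∑ k, ∑ n, f a i j k n = ∑ i, ∑ j, ∑ k, ∑ n, ∑ a, f a i j k n := by
  rw [Finset.sum_comm]
  exact Finset.sum_congr rfl fun i _ => sum_move3 _

theorem sum_swap_pairs (f : ι → ι → ι → ι → E) :
    ∑ a, ∑ b, ∑ c, ∑ d, f a b c d = ∑ c, ∑ d, ∑ a, ∑ b, f a b c d := by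
  rw [sum_move3]
  rw [sum_move2 (fun b c d => ∑ a, f a b c d)]
  exact Finset.sum_congr rfl fun c _ => Finset.sum_congr rfl fun d _ => Finset.sum_comm

variable {P : ι → ι → ℝ} {dP : ι → ι → ι → ℝ} {H : ι → ι → ι → ℝ}
  {dH : ι → ι → ι → ι → ℝ}

/-- The difference `D` of the coefficients of `A₀^{+k} A₁^{+n} c_i c_j` in the two actions is
symmetric in `i`, `j`. The terms with `∂_k π` and `∂_n π` are symmetric, the antisymmetric part of
the terms with `∂H` cancels because `H` is closed, and that of the terms with `∂_a π` contracted
with `H_{knb}` is the Jacobiator of `π`, which is `π♯ H` and cancels the remaining terms with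
`π³ H²`. -/
theorem quartic_identity (hP : ∀ i j, P i j = -P j i) (hdP : ∀ a i j, dP a i j = -dP a j i)
    (hHl : ∀ i j k, H i j k = -H j i k) (hHr : ∀ i j k, H i j k = -H i k j)
    (hdHr : ∀ l i j k, dH l i j k = -dH l i k j)
    (hdH : ∀ i j k l, dH l i j k - dH i l j k + dH j l i k - dH k l i j = 0)
    (hJ : ∀ i j k, ∑ l, (P i l * dP l j k + P j l * dP l k i + P k l * dP l i j)
      = ∑ a, ∑ b, ∑ c, P a i * P b j * P c k * H a b c)
    {Th : ι → ι → ι → ℝ} (hTh : ∀ i j k, Th i j k = ∑ l, P i l * H j k l)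
    {PPH : ι → ι → ι → ℝ} (hPPH : ∀ i j k, PPH i j k = ∑ l, ∑ n, P i l * P j n * H k l n)
    {PPPHH : ι → ι → ι → ι → ℝ} (hPPPHH : ∀ i j k l, PPPHH i j k l
      = ∑ r, ∑ n, ∑ p, ∑ q, P i r * P j n * P p q * H r q l * H n p k)
    {dTh : ι → ι → ι → ι → ℝ}
    (hdTh : ∀ a i j k, dTh a i j k = ∑ l, (dP a i l * H j k l + P i l * dH a j k l))
    {dPPH : ι → ι → ι → ι → ℝ}
    (hdPPH : ∀ a i j k, dPPH a i j k = ∑ l, ∑ n, ((dP a i l * P j n + P i l * dP a j n) * H k l n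
      + P i l * P j n * dH a k l n))
    {D : ι → ι → ι → ι → ℝ}
    (hD : ∀ i j k n, D i j k n = 1 / 4 * (dPPH k i j n - dPPH n i j k)
      + 1 / 8 * (PPPHH i j k n + PPPHH i j n k)
      + 1 / 4 * ∑ a, ∑ b, P a b * Th i k a * Th j n b
      + 1 / 2 * ∑ a, P a j * dTh a i k n
      - 1 / 4 * ∑ a, (dP a i j + PPH i j a) * Th a k n
      + 1 / 2 * ∑ a, (dP n a j + 1 / 2 * PPH a j n) * Th i k a
      - 1 / 2 * ∑ a, (dP k a j + 1 / 2 * PPH a j k) * Th i n a) (i j k n : ι) :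
    D i j k n = D j i k n := by
  -- The types of terms: `Y` is `π ∂_k π H`, `J` and `K` are `π ∂_a π H` with `∂_a` contracted,
  -- `V` and `V'` are `π π ∂H`, `Z` and `R` are the two contractions of `π³ H²`.
  obtain ⟨Y, hY⟩ : ∃ Y : ι → ι → ι → ι → ℝ, ∀ i j k n,
    Y i j k n = ∑ a, ∑ b, P i a * dP k j b * H n a b := ⟨_, fun _ _ _ _ => rfl⟩
  obtain ⟨Z, hZ⟩ : ∃ Z : ι → ι → ι → ι → ℝ, ∀ i j k n,
    Z i j k n = ∑ c, ∑ d, ∑ a, ∑ b, P a b * P i c * P j d * H k a c * H n b d :=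
    ⟨_, fun _ _ _ _ => rfl⟩
  obtain ⟨V, hV⟩ : ∃ V : ι → ι → ι → ι → ℝ, ∀ i j k n,
    V i j k n = ∑ a, ∑ b, P i a * P j b * dH k n a b := ⟨_, fun _ _ _ _ => rfl⟩
  obtain ⟨V', hV'⟩ : ∃ V' : ι → ι → ι → ι → ℝ, ∀ i j k n,
    V' i j k n = ∑ a, ∑ b, P i a * P j b * dH b k n a := ⟨_, fun _ _ _ _ => rfl⟩
  obtain ⟨J, hJd⟩ : ∃ J : ι → ι → ι → ι → ℝ, ∀ i j k n,
    J i j k n = ∑ b, ∑ a, P j a * dP a i b * H k n b := ⟨_, fun _ _ _ _ => rfl⟩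
  obtain ⟨K, hK⟩ : ∃ K : ι → ι → ι → ι → ℝ, ∀ i j k n,
    K i j k n = ∑ b, ∑ a, P b a * dP a i j * H k n b := ⟨_, fun _ _ _ _ => rfl⟩
  obtain ⟨R, hR⟩ : ∃ R : ι → ι → ι → ι → ℝ, ∀ i j k n,
    R i j k n = ∑ b, ∑ a, ∑ c, ∑ d, P i a * P j c * P b d * H a c d * H k n b :=
    ⟨_, fun _ _ _ _ => rfl⟩
  have e1 : ∀ i j k n, dPPH k i j n = -Y j i k n + Y i j k n + V i j k n := by
    intro i j k n
    rw [hdPPH, hY, hY, hV, Finset.sum_comm (f := fun a b => P j a * dP k i b * H n a b)]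
    simp only [← Finset.sum_neg_distrib, ← Finset.sum_add_distrib]
    refine Finset.sum_congr rfl fun a _ => Finset.sum_congr rfl fun b _ => ?_
    rw [hHr n b a]; ring
  have e2 : ∀ i j k n, PPPHH i j k n = Z j i k n := by
    intro i j k n
    rw [hPPPHH, hZ, Finset.sum_comm]
    refine Finset.sum_congr rfl fun c _ => Finset.sum_congr rfl fun d _ =>
      Finset.sum_congr rfl fun a _ => Finset.sum_congr rfl fun b _ => ?_
    rw [show H d b n = -H n b d by rw [hHl, hHr, hHl]; ring,
      show H c a k = -H k a c by rw [hHl, hHr, hHl]; ring]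
    ring
  have e2' : ∀ i j k n, Z j i n k = -Z i j k n := by
    intro i j k n
    rw [hZ, hZ, Finset.sum_comm]
    simp only [← Finset.sum_neg_distrib]
    refine Finset.sum_congr rfl fun c _ => Finset.sum_congr rfl fun d _ => ?_
    rw [Finset.sum_comm]
    refine Finset.sum_congr rfl fun a _ => Finset.sum_congr rfl fun b _ => ?_
    rw [hP b a]
    ring
  have e3 : ∀ i j k n, ∑ a, ∑ b, P a b * Th i k a * Th j n b = Z i j k n := by
    intro i j k n
    rw [hZ, sum_swap_pairs]
    refine Finset.sum_congr rfl fun a _ => Finset.sum_congr rfl fun b _ => ?_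
    rw [hTh, hTh, mul_assoc, Finset.sum_mul_sum, Finset.mul_sum]
    refine Finset.sum_congr rfl fun c _ => ?_
    rw [Finset.mul_sum]
    refine Finset.sum_congr rfl fun d _ => ?_
    ring
  have e4 : ∀ i j k n, ∑ a, P a j * dTh a i k n = -J i j k n - V' i j k n := by
    intro i j k n
    rw [hJd, hV', Finset.sum_comm (f := fun b a => P j a * dP a i b * H k n b),
      Finset.sum_comm (f := fun a b => P i a * P j b * dH b k n a)]
    simp only [← Finset.sum_neg_distrib, ← Finset.sum_sub_distrib]
    refine Finset.sum_congr rfl fun a _ => ?_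
    rw [hdTh, Finset.mul_sum]
    refine Finset.sum_congr rfl fun b _ => ?_
    rw [hP a j]; ring
  have e5 : ∀ i j k n, ∑ a, (dP a i j + PPH i j a) * Th a k n = -K i j k n - R i j k n := by
    intro i j k n
    simp only [add_mul, Finset.sum_add_distrib]
    rw [sub_eq_add_neg]
    congr 1
    · rw [hK, Finset.sum_comm, ← Finset.sum_neg_distrib]
      refine Finset.sum_congr rfl fun a _ => ?_
      rw [hTh, Finset.mul_sum, ← Finset.sum_neg_distrib]
      refine Finset.sum_congr rfl fun b _ => ?_
      rw [hP b a]; ring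
    · have : ∀ d, PPH i j d * Th d k n
          = ∑ b, ∑ a, ∑ c, -(P i a * P j c * P b d * H a c d * H k n b) := by
        intro d
        rw [hPPH, hTh, Finset.mul_sum]
        refine Finset.sum_congr rfl fun b _ => ?_
        rw [Finset.sum_mul]
        refine Finset.sum_congr rfl fun a _ => ?_
        rw [Finset.sum_mul]
        refine Finset.sum_congr rfl fun c _ => ?_
        rw [hP b d, show H a c d = H d a c by rw [hHr, hHl]; ring]
        ring
      simp only [this, hR, ← Finset.sum_neg_distrib]
      exact sum_move3 _
  have e6 : ∀ i j k n, ∑ a, (dP n a j + 1 / 2 * PPH a j n) * Th i k a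
      = Y i j n k + 1 / 2 * Z i j k n := by
    intro i j k n
    simp only [add_mul, Finset.sum_add_distrib]
    congr 1
    · rw [hY, Finset.sum_comm]
      refine Finset.sum_congr rfl fun a _ => ?_
      rw [hTh, Finset.mul_sum]
      refine Finset.sum_congr rfl fun b _ => ?_
      rw [hHr, hdP]; ring
    · have : ∀ a, 1 / 2 * PPH a j n * Th i k a
          = ∑ c, ∑ d, ∑ b, 1 / 2 * (P a b * P i c * P j d * H k a c * H n b d) := by
        intro a
        rw [hPPH, hTh, Finset.mul_sum]
        refine Finset.sum_congr rfl fun c _ => ?_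
        rw [mul_assoc, Finset.sum_mul, Finset.mul_sum, Finset.sum_comm]
        refine Finset.sum_congr rfl fun b _ => ?_
        rw [Finset.sum_mul, Finset.mul_sum]
        refine Finset.sum_congr rfl fun d _ => ?_
        ring
      simp only [this, hZ, Finset.mul_sum]
      exact sum_move2 _
  have j1 : ∀ i j k n, J i j k n - J j i k n - K i j k n = R i j k n := by
    intro i j k n
    rw [hJd, hJd, hK, hR]
    simp only [← Finset.sum_sub_distrib]
    refine Finset.sum_congr rfl fun b _ => ?_
    have := congrArg (fun x => -(x * H k n b)) (hJ i j b)
    simp only [Finset.sum_mul, ← Finset.sum_neg_distrib] at this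
    refine Eq.trans (Finset.sum_congr rfl fun a _ => ?_) (this.trans ?_)
    · rw [hdP a b i]; ring
    · refine Finset.sum_congr rfl fun a _ => Finset.sum_congr rfl fun c _ =>
        Finset.sum_congr rfl fun d _ => ?_
      rw [hP a i, hP c j, hP d b]; ring
  have v1 : V i j k n - V i j n k - V' i j k n + V' j i k n = 0 := by
    rw [hV, hV, hV', hV', Finset.sum_comm (f := fun a b => P j a * P i b * dH b k n a)]
    simp only [← Finset.sum_add_distrib, ← Finset.sum_sub_distrib]
    refine Finset.sum_eq_zero fun a _ => Finset.sum_eq_zero fun b _ => ?_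
    have := hdH n a b k
    linear_combination (P i a * P j b) * this
  have v2 : ∀ k n, V j i k n = -V i j k n := by
    intro k n
    rw [hV, hV, Finset.sum_comm]
    simp only [← Finset.sum_neg_distrib]
    refine Finset.sum_congr rfl fun a _ => Finset.sum_congr rfl fun b _ => ?_
    rw [hdHr]; ring
  -- `j1` is the twisted Jacobi identity, `v1` the closedness of `H`.
  rw [hD, hD]
  simp only [e1, e2, e3, e4, e5, e6]
  linarith [e2' i j k n, e2' j i k n, j1 i j k n, j1 j i k n, v1, v2 k n, v2 n k]

end TensorIdentity

/-! ### The canonical transformation maps the action to the covariant one -/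

section Shift

variable {m : ℕ} {𝒢 : Type*} [NormedRing 𝒢] [NormedAlgebra ℝ 𝒢] {𝒜 : ℤ → Submodule ℝ 𝒢}

/-- A coefficient of `A₀⁺A₁⁺cc` that is symmetric in the indices of the ghosts does not
contribute. -/
theorem sum_normalTerm_symm (h𝒜 : GradedComm 𝒜) {Φ : SigmaField m 𝒢} {σ : ℝ × ℝ}
    (h : HasGhosts 𝒜 Φ σ) {Q : Fin m → Fin m → Fin m → Fin m → ℝ}
    (hQ : ∀ i j k n, Q i j k n = Q j i k n) :
    ∑ i, ∑ j, normalTerm 0 0 0 0 0 0 (Q i j) Φ σ i j = 0 := by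
  have key : ∑ i, ∑ j, normalTerm 0 0 0 0 0 0 (Q i j) Φ σ i j
      = -∑ i, ∑ j, normalTerm 0 0 0 0 0 0 (Q i j) Φ σ i j := by
    conv_lhs => rw [Finset.sum_comm]
    simp only [← Finset.sum_neg_distrib]
    refine Finset.sum_congr rfl fun i _ => Finset.sum_congr rfl fun j _ => ?_
    have hc : Φ.c σ j * Φ.c σ i = -(Φ.c σ i * Φ.c σ j) :=
      h𝒜.anticomm_of_odd (by decide) (h.c j) (h.c i)
    simp [normalTerm, hc, hQ j i]
  have h2 : (2 : ℝ) • ∑ i, ∑ j, normalTerm 0 0 0 0 0 0 (Q i j) Φ σ i j = 0 := by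
    rw [two_smul]
    nth_rewrite 2 [key]
    exact add_neg_cancel _
  exact (smul_eq_zero.1 h2).resolve_left two_ne_zero

variable (Φ : SigmaField m 𝒢) (σ : ℝ × ℝ) (T : Fin m → Fin m → Fin m → ℝ)

/-- The shift `T^j_{ki} A₀^{+k} c_j` of `A₀`. -/
def shiftA0 (i : Fin m) : 𝒢 := ∑ j, ∑ k, T j k i • (Φ.Ap0 σ k * Φ.c σ j)

/-- The shift `T^j_{ki} A₁^{+k} c_j` of `A₁`. -/
def shiftA1 (i : Fin m) : 𝒢 := ∑ j, ∑ k, T j k i • (Φ.Ap1 σ k * Φ.c σ j)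

/-- The shift `T^i_{jk} A₀^{+j} A₁^{+k}` of `c⁺`. -/
def shiftCp (i : Fin m) : 𝒢 := ∑ j, ∑ k, T i j k • (Φ.Ap0 σ j * Φ.Ap1 σ k)

/-- The shift `∂_i T^j_{kl} A₀^{+k} A₁^{+l} c_j` of `X⁺`. -/
def shiftXp (dT : Fin m → Fin m → Fin m → Fin m → ℝ) (i : Fin m) : 𝒢 :=
  ∑ j, ∑ k, ∑ l, dT i j k l • (Φ.Ap0 σ k * Φ.Ap1 σ l * Φ.c σ j)

/-- The effect on the interaction part of a shift of the fields conjugate to `X`, `c` and `A⁺`. -/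
theorem normalTerm_shift {Ψ : SigmaField m 𝒢} (dT : Fin m → Fin m → Fin m → Fin m → ℝ)
    (hX : Ψ.X = Φ.X) (hc : Ψ.c = Φ.c) (hAp0 : Ψ.Ap0 = Φ.Ap0) (hAp1 : Ψ.Ap1 = Φ.Ap1)
    (hA0 : ∀ i, Ψ.A0 σ i = Φ.A0 σ i - shiftA0 Φ σ T i)
    (hA1 : ∀ i, Ψ.A1 σ i = Φ.A1 σ i + shiftA1 Φ σ T i)
    (hXp : ∀ i, Ψ.Xp σ i = Φ.Xp σ i + shiftXp Φ σ dT i)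
    (hcp : ∀ i, Ψ.cp σ i = Φ.cp σ i + shiftCp Φ σ T i)
    (P : ℝ) (K B0 B1 E0 E1 : Fin m → ℝ) (Q : Fin m → Fin m → ℝ) (i j : Fin m) :
    normalTerm P K B0 B1 E0 E1 Q Ψ σ i j = normalTerm P K B0 B1 E0 E1 Q Φ σ i j
      + (-(P • (Φ.A0 σ i * shiftA1 Φ σ T j)) + P • (shiftA0 Φ σ T i * Φ.A1 σ j)
        + P • (shiftA0 Φ σ T i * shiftA1 Φ σ T j) - P • (shiftXp Φ σ dT i * Φ.c σ j)
        + ∑ k, ((1 / 2 : ℝ) * K k) • (shiftCp Φ σ T k * (Φ.c σ i * Φ.c σ j))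
        + ∑ k, B1 k • (shiftA0 Φ σ T i * (Φ.Ap1 σ k * Φ.c σ j))
        + ∑ k, B0 k • (shiftA1 Φ σ T i * (Φ.Ap0 σ k * Φ.c σ j))) := by
  simp only [normalTerm, hX, hc, hAp0, hAp1, hA0, hA1, hXp, hcp, add_mul, sub_mul, mul_add,
    smul_add, smul_sub, Finset.sum_add_distrib, Finset.sum_sub_distrib]
  abel

theorem sum_smul_shiftA0 (x : Fin m → ℝ) : ∑ i, x i • shiftA0 Φ σ T i
    = ∑ i, ∑ j, ∑ k, (T i k j * x j) • (Φ.Ap0 σ k * Φ.c σ i) := by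
  rw [Finset.sum_comm]
  simp only [shiftA0, Finset.smul_sum, smul_smul, mul_comm]

theorem sum_smul_shiftA1 (x : Fin m → ℝ) : ∑ i, x i • shiftA1 Φ σ T i
    = ∑ i, ∑ j, ∑ k, (T i k j * x j) • (Φ.Ap1 σ k * Φ.c σ i) := by
  rw [Finset.sum_comm]
  simp only [shiftA1, Finset.smul_sum, smul_smul, mul_comm]

theorem sum_A0_mul_shiftA1 (P : Fin m → Fin m → ℝ) :
    ∑ i, ∑ j, P i j • (Φ.A0 σ i * shiftA1 Φ σ T j)
      = ∑ i, ∑ j, ∑ k, (∑ a, P i a * T j k a) • (Φ.A0 σ i * (Φ.Ap1 σ k * Φ.c σ j)) := by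
  refine Finset.sum_congr rfl fun i _ => ?_
  simp only [shiftA1, Finset.mul_sum, Finset.smul_sum, mul_smul_comm, smul_smul, Finset.sum_smul]
  exact sum_move2 _

variable {Φ σ}

theorem sum_shiftA0_mul_A1 (ho : OrderRules Φ σ) (P : Fin m → Fin m → ℝ) :
    ∑ i, ∑ j, P i j • (shiftA0 Φ σ T i * Φ.A1 σ j)
      = ∑ i, ∑ j, ∑ k, (∑ a, P a i * T j k a) • (Φ.A1 σ i * (Φ.Ap0 σ k * Φ.c σ j)) := by
  rw [Finset.sum_comm]
  refine Finset.sum_congr rfl fun i _ => ?_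
  simp only [shiftA0, Finset.sum_mul, Finset.smul_sum, smul_mul_assoc, smul_smul, Finset.sum_smul,
    mul_assoc, ho.c_A1, ho.Ap0_A1']
  exact sum_move2 _

theorem sum_shiftA0_mul_shiftA1 (ho : OrderRules Φ σ) (P : Fin m → Fin m → ℝ) :
    ∑ i, ∑ j, P i j • (shiftA0 Φ σ T i * shiftA1 Φ σ T j)
      = ∑ i, ∑ j, ∑ k, ∑ n, (-∑ a, ∑ b, P a b * T i k a * T j n b)
        • (Φ.Ap0 σ k * (Φ.Ap1 σ n * (Φ.c σ i * Φ.c σ j))) := by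
  have key : ∀ a b, P a b • (shiftA0 Φ σ T a * shiftA1 Φ σ T b)
      = ∑ i, ∑ j, ∑ k, ∑ n, (-(P a b * T i k a * T j n b))
        • (Φ.Ap0 σ k * (Φ.Ap1 σ n * (Φ.c σ i * Φ.c σ j))) := by
    intro a b
    simp only [shiftA0, shiftA1, Finset.sum_mul, Finset.mul_sum, Finset.smul_sum]
    rw [sum_swap_pairs]
    refine Finset.sum_congr rfl fun i _ => ?_
    rw [Finset.sum_comm]
    refine Finset.sum_congr rfl fun j _ => Finset.sum_congr rfl fun k _ =>
      Finset.sum_congr rfl fun n _ => ?_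
    simp only [smul_mul_assoc, mul_smul_comm, mul_assoc, ho.c_Ap1', mul_neg, smul_neg, neg_smul,
      smul_smul]
    congr 2; ring
  simp only [key, ← Finset.sum_neg_distrib, Finset.sum_smul]
  exact (Finset.sum_congr rfl fun a _ => sum_move4 _).trans (sum_move4 _)

theorem sum_shiftXp_mul_c (P : Fin m → Fin m → ℝ) (dT : Fin m → Fin m → Fin m → Fin m → ℝ) :
    ∑ i, ∑ j, P i j • (shiftXp Φ σ dT i * Φ.c σ j)
      = ∑ i, ∑ j, ∑ k, ∑ n, (∑ a, P a j * dT a i k n)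
        • (Φ.Ap0 σ k * (Φ.Ap1 σ n * (Φ.c σ i * Φ.c σ j))) := by
  have key : ∀ a j, P a j • (shiftXp Φ σ dT a * Φ.c σ j)
      = ∑ i, ∑ k, ∑ n, (P a j * dT a i k n)
        • (Φ.Ap0 σ k * (Φ.Ap1 σ n * (Φ.c σ i * Φ.c σ j))) := by
    intro a j
    simp only [shiftXp, Finset.sum_mul, Finset.smul_sum, smul_mul_assoc, mul_assoc, smul_smul]
  simp only [key, Finset.sum_smul]
  refine Eq.trans ?_ (sum_move4 _)
  exact Finset.sum_congr rfl fun a _ => Finset.sum_comm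

theorem sum_shiftCp_mul_c_mul_c (K : Fin m → Fin m → Fin m → ℝ) :
    ∑ i, ∑ j, ∑ k, K i j k • (shiftCp Φ σ T k * (Φ.c σ i * Φ.c σ j))
      = ∑ i, ∑ j, ∑ k, ∑ n, (∑ a, K i j a * T a k n)
        • (Φ.Ap0 σ k * (Φ.Ap1 σ n * (Φ.c σ i * Φ.c σ j))) := by
  refine Finset.sum_congr rfl fun i _ => Finset.sum_congr rfl fun j _ => ?_
  simp only [shiftCp, Finset.sum_mul, Finset.smul_sum, smul_mul_assoc, mul_assoc, smul_smul,
    Finset.sum_smul]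
  exact sum_move2 _

theorem sum_shiftA0_mul_Ap1_mul_c (ho : OrderRules Φ σ) (B : Fin m → Fin m → Fin m → ℝ) :
    ∑ i, ∑ j, ∑ k, B i j k • (shiftA0 Φ σ T i * (Φ.Ap1 σ k * Φ.c σ j))
      = ∑ i, ∑ j, ∑ k, ∑ n, (-∑ a, B a j n * T i k a)
        • (Φ.Ap0 σ k * (Φ.Ap1 σ n * (Φ.c σ i * Φ.c σ j))) := by
  have key : ∀ a j n, B a j n • (shiftA0 Φ σ T a * (Φ.Ap1 σ n * Φ.c σ j))
      = ∑ i, ∑ k, (-(B a j n * T i k a))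
        • (Φ.Ap0 σ k * (Φ.Ap1 σ n * (Φ.c σ i * Φ.c σ j))) := by
    intro a j n
    simp only [shiftA0, Finset.sum_mul, Finset.smul_sum, smul_mul_assoc, mul_assoc, smul_smul,
      ho.c_Ap1', mul_neg, smul_neg, neg_smul]
  simp only [key, ← Finset.sum_neg_distrib, Finset.sum_smul]
  refine Eq.trans ?_ (sum_move4 _)
  refine Finset.sum_congr rfl fun a _ => ?_
  rw [Finset.sum_comm (f := fun i j => ∑ k, ∑ n, (-(B a j n * T i k a))
        • (Φ.Ap0 σ k * (Φ.Ap1 σ n * (Φ.c σ i * Φ.c σ j))))]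
  exact Finset.sum_congr rfl fun j _ => sum_move2 _

theorem sum_shiftA1_mul_Ap0_mul_c (ho : OrderRules Φ σ) (B : Fin m → Fin m → Fin m → ℝ) :
    ∑ i, ∑ j, ∑ k, B i j k • (shiftA1 Φ σ T i * (Φ.Ap0 σ k * Φ.c σ j))
      = ∑ i, ∑ j, ∑ k, ∑ n, (∑ a, B a j k * T i n a)
        • (Φ.Ap0 σ k * (Φ.Ap1 σ n * (Φ.c σ i * Φ.c σ j))) := by
  have key : ∀ a j k, B a j k • (shiftA1 Φ σ T a * (Φ.Ap0 σ k * Φ.c σ j))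
      = ∑ i, ∑ n, (B a j k * T i n a)
        • (Φ.Ap0 σ k * (Φ.Ap1 σ n * (Φ.c σ i * Φ.c σ j))) := by
    intro a j k
    simp only [shiftA1, Finset.sum_mul, Finset.smul_sum, smul_mul_assoc, mul_assoc, smul_smul,
      ho.c_Ap0', ho.Ap1_Ap0', mul_neg, neg_neg]
  simp only [key, Finset.sum_smul]
  refine Eq.trans ?_ (sum_move4 _)
  refine Finset.sum_congr rfl fun a _ => ?_
  rw [Finset.sum_comm (f := fun i j => ∑ k, ∑ n, (B a j k * T i n a)
        • (Φ.Ap0 σ k * (Φ.Ap1 σ n * (Φ.c σ i * Φ.c σ j))))]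
  exact Finset.sum_congr rfl fun j _ => Finset.sum_comm

/-- The effect of a shift of the fields conjugate to `X`, `c` and `A⁺` on a density of the general
form. -/
theorem sum_kinetic_add_sum_normalTerm_shift (ho : OrderRules Φ σ) {Ψ : SigmaField m 𝒢}
    (dT : Fin m → Fin m → Fin m → Fin m → ℝ)
    (hX : Ψ.X = Φ.X) (hc : Ψ.c = Φ.c) (hAp0 : Ψ.Ap0 = Φ.Ap0) (hAp1 : Ψ.Ap1 = Φ.Ap1)
    (hA0 : ∀ i, Ψ.A0 σ i = Φ.A0 σ i - shiftA0 Φ σ T i)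
    (hA1 : ∀ i, Ψ.A1 σ i = Φ.A1 σ i + shiftA1 Φ σ T i)
    (hXp : ∀ i, Ψ.Xp σ i = Φ.Xp σ i + shiftXp Φ σ dT i)
    (hcp : ∀ i, Ψ.cp σ i = Φ.cp σ i + shiftCp Φ σ T i)
    (P : Fin m → Fin m → ℝ) (K B0 B1 E0 E1 : Fin m → Fin m → Fin m → ℝ)
    (Q : Fin m → Fin m → Fin m → Fin m → ℝ) :
    ∑ i, kinetic Ψ σ i
      + ∑ i, ∑ j, normalTerm (P i j) (K i j) (B0 i j) (B1 i j) (E0 i j) (E1 i j) (Q i j) Ψ σ i j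
    = ∑ i, kinetic Φ σ i
      + ∑ i, ∑ j, normalTerm (P i j) (K i j) (fun k => B0 i j k + ∑ a, P a i * T j k a)
        (fun k => B1 i j k + ∑ a, P i a * T j k a) (fun k => E0 i j k - T i k j)
        (fun k => E1 i j k + T i k j)
        (fun k n => Q i j k n - ∑ a, ∑ b, P a b * T i k a * T j n b - ∑ a, P a j * dT a i k n
          + ∑ a, 1 / 2 * K i j a * T a k n - ∑ a, B1 a j n * T i k a + ∑ a, B0 a j k * T i n a)
        Φ σ i j := by
  have hkin : ∀ i, kinetic Ψ σ i = kinetic Φ σ i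
      + (fderiv ℝ Φ.X σ (1, 0) i • shiftA1 Φ σ T i
        + fderiv ℝ Φ.X σ (0, 1) i • shiftA0 Φ σ T i) := fun i => by
    simp only [kinetic, curlAp, hX, hc, hAp0, hAp1, hA0, hA1, smul_add, smul_sub]
    abel
  simp only [hkin, normalTerm_shift Φ σ T dT hX hc hAp0 hAp1 hA0 hA1 hXp hcp,
    Finset.sum_add_distrib, Finset.sum_sub_distrib, Finset.sum_neg_distrib,
    sum_smul_shiftA0, sum_smul_shiftA1, sum_A0_mul_shiftA1, sum_shiftA0_mul_A1 T ho,
    sum_shiftA0_mul_shiftA1 T ho, sum_shiftXp_mul_c, sum_shiftCp_mul_c_mul_c,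
    sum_shiftA0_mul_Ap1_mul_c T ho, sum_shiftA1_mul_Ap0_mul_c T ho]
  simp only [normalTerm, add_smul, sub_smul, add_mul, sub_mul, Finset.sum_add_distrib,
    Finset.sum_sub_distrib, neg_smul, Finset.sum_neg_distrib]
  abel

end Shift

section Covariant

variable {m : ℕ} {𝒢 : Type*} [NormedRing 𝒢] [NormedAlgebra ℝ 𝒢] {𝒜 : ℤ → Submodule ℝ 𝒢}
  [GradedAlgebra 𝒜] {U : Set (Fin m → ℝ)} {π : (Fin m → ℝ) → Fin m → Fin m → ℝ}
  {H : (Fin m → ℝ) → Fin m → Fin m → Fin m → ℝ}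

theorem sum_pi_mul_Theta (x : Fin m → ℝ) (i j k : Fin m) :
    ∑ a, π x i a * Theta π H j k a x = piPiH π H i j k x := by
  simp only [Theta, piPiH, Finset.mul_sum, mul_assoc]

theorem pd_Theta (hU : IsOpen U) (hπ : IsTwistedPoisson U π H) {x : Fin m → ℝ} (hx : x ∈ U)
    (a i j k : Fin m) : pd a (Theta π H i j k) x
      = ∑ l, (pd a (fun y => π y i l) x * H x j k l + π x i l * pd a (fun y => H y j k l) x) := by
  have dπ : ∀ i j, DifferentiableAt ℝ (fun y => π y i j) x := fun i j =>
    ((hπ.pi_smooth i j).contDiffAt (hU.mem_nhds hx)).differentiableAt (by norm_num)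
  have dH : ∀ i j k, DifferentiableAt ℝ (fun y => H y i j k) x := fun i j k =>
    ((hπ.H_smooth i j k).contDiffAt (hU.mem_nhds hx)).differentiableAt (by norm_num)
  have : Theta π H i j k = fun y => ∑ l, π y i l * H y j k l := rfl
  rw [this, pd_sum _ fun l _ => (dπ i l).fun_mul (dH j k l)]
  exact Finset.sum_congr rfl fun l _ => pd_mul (dπ i l) (dH j k l) a

theorem pd_piPiH (hU : IsOpen U) (hπ : IsTwistedPoisson U π H) {x : Fin m → ℝ} (hx : x ∈ U)
    (a i j k : Fin m) : pd a (piPiH π H i j k) x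
      = ∑ l, ∑ n, ((pd a (fun y => π y i l) x * π x j n + π x i l * pd a (fun y => π y j n) x)
        * H x k l n + π x i l * π x j n * pd a (fun y => H y k l n) x) := by
  have dπ : ∀ i j, DifferentiableAt ℝ (fun y => π y i j) x := fun i j =>
    ((hπ.pi_smooth i j).contDiffAt (hU.mem_nhds hx)).differentiableAt (by norm_num)
  have dH : ∀ i j k, DifferentiableAt ℝ (fun y => H y i j k) x := fun i j k =>
    ((hπ.H_smooth i j k).contDiffAt (hU.mem_nhds hx)).differentiableAt (by norm_num)
  have : piPiH π H i j k = fun y => ∑ l, ∑ n, π y i l * π y j n * H y k l n := rfl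
  rw [this, pd_sum _ fun l _ => DifferentiableAt.fun_sum fun n _ =>
    ((dπ i l).fun_mul (dπ j n)).fun_mul (dH k l n)]
  refine Finset.sum_congr rfl fun l _ => ?_
  rw [pd_sum _ fun n _ => ((dπ i l).fun_mul (dπ j n)).fun_mul (dH k l n)]
  refine Finset.sum_congr rfl fun n _ => ?_
  rw [pd_mul ((dπ i l).fun_mul (dπ j n)) (dH k l n), pd_mul (dπ i l) (dπ j n)]

/-- The action density in Darboux coordinates equals the covariant one at the transformed fields,
already before integration. -/
theorem darbouxDensity_eq_covDensity (h𝒜 : GradedComm 𝒜) (hU : IsOpen U)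
    (hπ : IsTwistedPoisson U π H) {Φ : BVField m 𝒢} (h : Φ ∈ bvFields 𝒜 U) (σ : ℝ × ℝ) :
    darbouxDensity 𝒜 π H Φ.toSigmaField σ
      = covDensity 𝒜 π H (Φ + (-1 : ℝ) • hamLam π H Φ).toSigmaField σ := by
  have hΨ := add_smul_mem_bvFields h (isTangent_hamLam hU hπ.Theta_smooth h) rfl (-1)
  have hg := h.1.hasGhosts σ
  have ho := hg.orderRules h𝒜
  have hx := X_mem h σ
  set Ψ : BVField m 𝒢 := Φ + (-1 : ℝ) • hamLam π H Φ with hΨdef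
  have hX : Ψ.X = Φ.X := by simp [Ψ, hamLam]
  have hc : Ψ.c = Φ.c := by simp [Ψ, hamLam]
  have hAp0 : Ψ.Ap0 = Φ.Ap0 := by simp [Ψ, hamLam]
  have hAp1 : Ψ.Ap1 = Φ.Ap1 := by simp [Ψ, hamLam]
  -- The coefficients are taken opaque here; only their values below matter.
  obtain ⟨T, hT⟩ : ∃ T : Fin m → Fin m → Fin m → ℝ,
    ∀ i j k, T i j k = 1 / 2 * Theta π H i j k (Φ.X σ) := ⟨_, fun _ _ _ => rfl⟩
  obtain ⟨dT, hdT⟩ : ∃ dT : Fin m → Fin m → Fin m → Fin m → ℝ,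
    ∀ a i j k, dT a i j k = 1 / 2 * pd a (Theta π H i j k) (Φ.X σ) := ⟨_, fun _ _ _ _ => rfl⟩
  have hA0 : ∀ i, Ψ.A0 σ i = Φ.A0 σ i - shiftA0 Φ.toSigmaField σ T i := fun i => by
    simp [Ψ, hamLam, shiftA0, hT, sub_eq_add_neg]
  have hA1 : ∀ i, Ψ.A1 σ i = Φ.A1 σ i + shiftA1 Φ.toSigmaField σ T i := fun i => by
    simp [Ψ, hamLam, shiftA1, hT]
  have hXp : ∀ i, Ψ.Xp σ i = Φ.Xp σ i + shiftXp Φ.toSigmaField σ dT i := fun i => by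
    simp [Ψ, hamLam, shiftXp, hdT]
  have hcp : ∀ i, Ψ.cp σ i = Φ.cp σ i + shiftCp Φ.toSigmaField σ T i := fun i => by
    simp [Ψ, hamLam, shiftCp, hT]
  rw [darbouxDensity_eq h𝒜 hU hπ hg (h.1.X_differentiable σ) hx,
    covDensity_eq h𝒜 hU hπ (hΨ.1.hasGhosts σ) (hΨ.1.X_differentiable σ) (X_mem hΨ σ),
    sum_kinetic_add_sum_normalTerm_shift T ho dT hX hc hAp0 hAp1 hA0 hA1 hXp hcp, hX]
  have hπl := hπ.pi_anti _ hx
  have b1 : ∀ i j k, ∑ a, π (Φ.X σ) i a * T j k a = 1 / 2 * piPiH π H i j k (Φ.X σ) := by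
    intro i j k
    rw [← sum_pi_mul_Theta, Finset.mul_sum]
    exact Finset.sum_congr rfl fun a _ => by rw [hT]; ring
  have b0 : ∀ i j k, ∑ a, π (Φ.X σ) a i * T j k a = -(1 / 2 * piPiH π H i j k (Φ.X σ)) := by
    intro i j k
    rw [← b1, ← Finset.sum_neg_distrib]
    exact Finset.sum_congr rfl fun a _ => by rw [hπl]; ring
  -- The difference of the coefficients of `A₀⁺A₁⁺cc`.
  obtain ⟨D, hD⟩ : ∃ D : Fin m → Fin m → Fin m → Fin m → ℝ, ∀ i j k n, D i j k n =
      1 / 4 * (pd k (piPiH π H i j n) (Φ.X σ) - pd n (piPiH π H i j k) (Φ.X σ))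
      + 1 / 8 * (piPiPiHH π H i j k n (Φ.X σ) + piPiPiHH π H i j n k (Φ.X σ))
      + ∑ a, ∑ b, π (Φ.X σ) a b * T i k a * T j n b + ∑ a, π (Φ.X σ) a j * dT a i k n
      - ∑ a, 1 / 2 * (pd a (fun x => π x i j) (Φ.X σ) + piPiH π H i j a (Φ.X σ)) * T a k n
      + ∑ a, (pd n (fun x => π x a j) (Φ.X σ) + 1 / 2 * piPiH π H a j n (Φ.X σ)) * T i k a
      - ∑ a, (pd k (fun x => π x a j) (Φ.X σ) + 1 / 2 * piPiH π H a j k (Φ.X σ)) * T i n a :=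
    ⟨_, fun _ _ _ _ => rfl⟩
  have hDsymm : ∀ i j k n, D i j k n = D j i k n := by
    refine quartic_identity (Th := fun i j k => Theta π H i j k (Φ.X σ))
      (PPH := fun i j k => piPiH π H i j k (Φ.X σ))
      (PPPHH := fun i j k l => piPiPiHH π H i j k l (Φ.X σ)) hπl
      (fun a i j => pd_eq_neg_of_eqOn hU (fun y hy => hπ.pi_anti y hy i j) hx a)
      (hπ.H_anti_left _ hx) (hπ.H_anti_right _ hx)
      (fun l i j k => pd_eq_neg_of_eqOn hU (fun y hy => hπ.H_anti_right y hy i j k) hx l)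
      (hπ.H_closed _ hx) (hπ.jacobi _ hx) (fun _ _ _ => rfl) (fun _ _ _ => rfl)
      (fun _ _ _ _ => rfl) (pd_Theta hU hπ hx) (pd_piPiH hU hπ hx) fun i j k n => ?_
    have f1 : ∑ a, ∑ b, π (Φ.X σ) a b * T i k a * T j n b = 1 / 4 * ∑ a, ∑ b, π (Φ.X σ) a b
        * Theta π H i k a (Φ.X σ) * Theta π H j n b (Φ.X σ) := by
      simp only [Finset.mul_sum, hT]
      exact Finset.sum_congr rfl fun a _ => Finset.sum_congr rfl fun b _ => by ring
    have f2 : ∑ a, π (Φ.X σ) a j * dT a i k n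
        = 1 / 2 * ∑ a, π (Φ.X σ) a j * pd a (Theta π H i k n) (Φ.X σ) := by
      simp only [Finset.mul_sum, hdT]
      exact Finset.sum_congr rfl fun a _ => by ring
    have f3 : ∑ a, 1 / 2 * (pd a (fun x => π x i j) (Φ.X σ) + piPiH π H i j a (Φ.X σ)) * T a k n
        = 1 / 4 * ∑ a, (pd a (fun x => π x i j) (Φ.X σ) + piPiH π H i j a (Φ.X σ))
          * Theta π H a k n (Φ.X σ) := by
      simp only [Finset.mul_sum, hT]
      exact Finset.sum_congr rfl fun a _ => by ring
    have f4 : ∀ k n, ∑ a, (pd n (fun x => π x a j) (Φ.X σ) + 1 / 2 * piPiH π H a j n (Φ.X σ))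
        * T i k a = 1 / 2 * ∑ a, (pd n (fun x => π x a j) (Φ.X σ)
          + 1 / 2 * piPiH π H a j n (Φ.X σ)) * Theta π H i k a (Φ.X σ) := by
      intro k n
      simp only [Finset.mul_sum, hT]
      exact Finset.sum_congr rfl fun a _ => by ring
    rw [hD, f1, f2, f3, f4, f4]
  rw [← sub_eq_zero, add_sub_add_left_eq_sub, ← sum_normalTerm_symm h𝒜 hg hDsymm, sub_eq_add_neg,
    ← neg_one_smul ℝ (Finset.sum _ _)]
  simp only [Finset.smul_sum, ← Finset.sum_add_distrib, smul_normalTerm, normalTerm_add]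
  refine Finset.sum_congr rfl fun i _ => Finset.sum_congr rfl fun j _ => ?_
  congr 1
  · simp
  · funext k; simp
  · funext k; simp [b0]
  · funext k; simp [b1]; ring
  · funext k
    simp only [Pi.add_apply, Pi.smul_apply, hT, hπ.Theta_anti hx i k j, smul_eq_mul, Pi.zero_apply]
    ring
  · funext k
    simp only [Pi.add_apply, Pi.smul_apply, hT, hπ.Theta_anti hx i k j, smul_eq_mul, Pi.zero_apply]
    ring
  · funext k n
    simp only [Pi.add_apply, Pi.smul_apply, smul_eq_mul, hD]
    ring

end Covariant

/-! ### The transformation to Darboux coordinates -/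

section DarbouxTransformation

variable {m : ℕ} {𝒢 : Type*} [NormedRing 𝒢] [NormedAlgebra ℝ 𝒢] {𝒜 : ℤ → Submodule ℝ 𝒢}
  [GradedAlgebra 𝒜] {U : Set (Fin m → ℝ)} {π : (Fin m → ℝ) → Fin m → Fin m → ℝ}
  {H : (Fin m → ℝ) → Fin m → Fin m → Fin m → ℝ}

theorem gdDensity_eq (h𝒜 : GradedComm 𝒜) (hU : IsOpen U) (hπ : IsTwistedPoisson U π H)
    {Φ : SigmaField m 𝒢} {σ : ℝ × ℝ} (h : HasGhosts 𝒜 Φ σ) (hX : DifferentiableAt ℝ Φ.X σ)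
    (hx : Φ.X σ ∈ U) :
    gdDensity 𝒜 π H Φ σ = ∑ i, kinetic Φ σ i + ∑ i, ∑ j, normalTerm (π (Φ.X σ) i j)
      (fun k => pd k (fun x => π x i j) (Φ.X σ) + piPiH π H i j k (Φ.X σ))
      (fun k => pd k (fun x => π x i j) (Φ.X σ))
      (fun k => pd k (fun x => π x i j) (Φ.X σ) + piPiH π H i j k (Φ.X σ)) 0 0
      (fun k n => quarterHess (fun x => π x i j) (Φ.X σ) k n
        + (1 / 2 : ℝ) * pd k (piPiH π H i j n) (Φ.X σ)) Φ σ i j := by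
  have key := half_smul_sum_sum_eq (atX_mul_SA_mul_SA_mul_eps1 h𝒜 h (piPiH π H)
    (hπ.piPiH_anti hx)
    (fun a i j k => pd_eq_neg_of_eqOn hU (fun y hy => hπ.piPiH_anti hy i j k) hx a) rfl)
  simp only [gdDensity, berezin, SuperFun.add_t10, SuperFun.sum_t10,
    SuperFun.smul_t10, psmL_t10 h𝒜 hU hπ h hX hx, key]
  simp only [add_assoc, ← Finset.sum_add_distrib, normalTerm_add]
  congr! 6 with i _ j _ <;> simp

/-- The shift of `X⁺` in the term `π^{ij} X⁺_i c_j` of `½ π^{ij}(𝐗) 𝐀_i 𝐀_j` compensates the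
additional term of the action in Darboux coordinates. -/
theorem gdDensity_eq_darbouxDensity (h𝒜 : GradedComm 𝒜) (hU : IsOpen U)
    (hπ : IsTwistedPoisson U π H) {Φ : BVField m 𝒢} (h : Φ ∈ bvFields 𝒜 U) (σ : ℝ × ℝ) :
    gdDensity 𝒜 π H Φ.toSigmaField σ
      = darbouxDensity 𝒜 π H (Φ + (1 : ℝ) • darbouxShift H Φ).toSigmaField σ := by
  have hΨ := add_smul_mem_bvFields h (isTangent_darbouxShift hπ.H_smooth h) rfl 1
  have hg := h.1.hasGhosts σ
  have hx := X_mem h σ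
  set Ψ : BVField m 𝒢 := Φ + (1 : ℝ) • darbouxShift H Φ with hΨdef
  have hX : Ψ.X = Φ.X := by simp [Ψ, darbouxShift]
  have hc : Ψ.c = Φ.c := by simp [Ψ, darbouxShift]
  have hA0 : Ψ.A0 = Φ.A0 := by simp [Ψ, darbouxShift]
  have hA1 : Ψ.A1 = Φ.A1 := by simp [Ψ, darbouxShift]
  have hAp0 : Ψ.Ap0 = Φ.Ap0 := by simp [Ψ, darbouxShift]
  have hAp1 : Ψ.Ap1 = Φ.Ap1 := by simp [Ψ, darbouxShift]
  have hcp : Ψ.cp = Φ.cp := by simp [Ψ, darbouxShift]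
  have hXp : ∀ i, Ψ.Xp σ i = Φ.Xp σ i
      + ∑ j, ∑ k, (H (Φ.X σ) i j k * fderiv ℝ Φ.X σ (0, 1) j) • Φ.Ap0 σ k := by
    simp [Ψ, darbouxShift]
  rw [gdDensity_eq h𝒜 hU hπ hg (h.1.X_differentiable σ) hx,
    darbouxDensity_eq h𝒜 hU hπ (hΨ.1.hasGhosts σ) (hΨ.1.X_differentiable σ) (X_mem hΨ σ)]
  have key : ∑ i, ∑ j, π (Φ.X σ) i j • ((∑ a, ∑ k,
        (H (Φ.X σ) i a k * fderiv ℝ Φ.X σ (0, 1) a) • Φ.Ap0 σ k) * Φ.c σ j)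
      = ∑ i, ∑ j, ∑ k, (Theta π H i k j (Φ.X σ) * fderiv ℝ Φ.X σ (0, 1) j)
        • (Φ.Ap0 σ k * Φ.c σ i) := by
    rw [Finset.sum_comm]
    refine Finset.sum_congr rfl fun i _ => ?_
    simp only [Finset.sum_mul, Finset.smul_sum, smul_mul_assoc, smul_smul, Theta, Finset.sum_smul]
    rw [sum_move2]
    refine Finset.sum_congr rfl fun j _ => Finset.sum_congr rfl fun k _ =>
      Finset.sum_congr rfl fun a _ => ?_
    rw [hπ.pi_anti _ hx a i, hπ.H_anti_left _ hx k j a, hπ.H_anti_right _ hx j k a,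
      hπ.H_anti_left _ hx j a k]
    congr 1; ring
  have hkin : ∀ i, kinetic Ψ.toSigmaField σ i = kinetic Φ.toSigmaField σ i := fun i => by
    simp only [kinetic, curlAp, hX, hc, hA0, hA1, hAp0, hAp1]
  simp only [hkin, normalTerm, hX, hc, hA0, hA1, hAp0, hAp1, hcp, hXp, add_mul, smul_add,
    Finset.sum_add_distrib, Finset.sum_sub_distrib, neg_mul, neg_smul, Finset.sum_neg_distrib, key]
  simp
  abel

theorem SGD_eq_SDarboux (h𝒜 : GradedComm 𝒜) (hU : IsOpen U) (hπ : IsTwistedPoisson U π H)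
    {Φ : BVField m 𝒢} (h : Φ ∈ bvFields 𝒜 U) :
    SGD 𝒜 π H Φ = SDarboux 𝒜 π H (T1 𝒜 H Φ) := by
  rw [SGD_eq, SDarboux_eq, T1_eq hπ.H_anti_right h]
  congr 2
  · exact funext (gdDensity_eq_darbouxDensity h𝒜 hU hπ h)
  · simp [darbouxShift]

/-! ### The classical limit -/

theorem kinetic_of_antifieldFree {Φ : SigmaField m 𝒢} (h : AntifieldFree Φ) (σ : ℝ × ℝ)
    (i : Fin m) : kinetic Φ σ i
      = fderiv ℝ Φ.X σ (1, 0) i • Φ.A1 σ i - fderiv ℝ Φ.X σ (0, 1) i • Φ.A0 σ i := by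
  simp [kinetic, curlAp, h.1, h.2.1]

theorem normalTerm_of_antifieldFree {Φ : SigmaField m 𝒢} (h : AntifieldFree Φ) (σ : ℝ × ℝ)
    (i j : Fin m) (P : ℝ) (K B0 B1 E0 E1 : Fin m → ℝ) (Q : Fin m → Fin m → ℝ) :
    normalTerm P K B0 B1 E0 E1 Q Φ σ i j = -(P • (Φ.A0 σ i * Φ.A1 σ j)) := by
  simp [normalTerm, h.1, h.2.1, h.2.2.1, h.2.2.2]

/-- The three densities differ only in coefficients of monomials that contain an antifield. -/
theorem actions_of_antifieldFree (h𝒜 : GradedComm 𝒜) (hU : IsOpen U)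
    (hπ : IsTwistedPoisson U π H) {Φ : BVField m 𝒢} (h : Φ ∈ bvFields 𝒜 U)
    (h0 : AntifieldFree Φ.toSigmaField) :
    SGD 𝒜 π H Φ = Sclass π H Φ ∧ SDarboux 𝒜 π H Φ = Sclass π H Φ
      ∧ Scov 𝒜 π H Φ = Sclass π H Φ := by
  have hg := h.1.hasGhosts
  have hd := h.1.X_differentiable
  have hx := X_mem h
  refine ⟨?_, ?_, ?_⟩
  · rw [SGD_eq, Sclass]
    congr 2
    funext σ
    simp [gdDensity_eq h𝒜 hU hπ (hg σ) (hd σ) (hx σ), kinetic_of_antifieldFree h0,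
      normalTerm_of_antifieldFree h0, sub_eq_add_neg]
  · rw [SDarboux_eq, Sclass]
    congr 2
    funext σ
    simp [darbouxDensity_eq h𝒜 hU hπ (hg σ) (hd σ) (hx σ), kinetic_of_antifieldFree h0,
      normalTerm_of_antifieldFree h0, sub_eq_add_neg]
  · rw [Scov, Sclass]
    congr 2
    funext σ
    simp [covDensity_eq h𝒜 hU hπ (hg σ) (hd σ) (hx σ), kinetic_of_antifieldFree h0,
      normalTerm_of_antifieldFree h0, sub_eq_add_neg]

end DarbouxTransformation

/-! ### Covariance under changes of coordinates on the world sheet -/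

section Covariance

variable {m : ℕ} {𝒢 : Type*} [NormedRing 𝒢] [NormedAlgebra ℝ 𝒢] {𝒜 : ℤ → Submodule ℝ 𝒢}

/-- The linear substitution of the odd variables: `θ⁰`, `θ¹` are replaced by `a θ⁰ + c θ¹`,
`b θ⁰ + d θ¹`. Pullback of forms by a map with this Jacobian matrix at a point is this
substitution of superfunctions. -/
def linSubst (a b c d : ℝ) (s : SuperFun 𝒜) : SuperFun 𝒜 :=
  ⟨s.one, a • s.t0 + b • s.t1, c • s.t0 + d • s.t1, (a * d - b * c) • s.t10⟩

section

variable (a b c d : ℝ)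

theorem linSubst_add (s t : SuperFun 𝒜) :
    linSubst a b c d (s + t) = linSubst a b c d s + linSubst a b c d t := by
  ext <;> simp [linSubst] <;> abel

theorem linSubst_sub (s t : SuperFun 𝒜) :
    linSubst a b c d (s - t) = linSubst a b c d s - linSubst a b c d t := by
  ext <;> simp [linSubst, smul_sub] <;> abel

theorem linSubst_smul (r : ℝ) (s : SuperFun 𝒜) :
    linSubst a b c d (r • s) = r • linSubst a b c d s := by
  ext <;> simp [linSubst, smul_comm r]

theorem linSubst_sum {ι : Type*} (u : Finset ι) (f : ι → SuperFun 𝒜) :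
    linSubst a b c d (∑ i ∈ u, f i) = ∑ i ∈ u, linSubst a b c d (f i) :=
  map_sum (AddMonoidHom.mk' (linSubst a b c d) (linSubst_add a b c d)) f u

theorem linSubst_one : linSubst a b c d (1 : SuperFun 𝒜) = 1 := by
  ext <;> simp [linSubst]

theorem linSubst_eps (s : SuperFun 𝒜) :
    eps (linSubst a b c d s) = linSubst a b c d (eps s) := by
  ext <;> simp [linSubst, eps]

theorem berezin_linSubst (s : SuperFun 𝒜) :
    berezin (linSubst a b c d s) = (a * d - b * c) • berezin s := rfl

theorem linSubst_mul [GradedAlgebra 𝒜] (s t : SuperFun 𝒜) :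
    linSubst a b c d (s * t) = linSubst a b c d s * linSubst a b c d t := by
  ext
  · simp [linSubst]
  · simp [linSubst, mul_add, add_mul]; abel
  · simp [linSubst, mul_add, add_mul]; abel
  · simp [linSubst, mul_add, add_mul, smul_smul, smul_add, smul_sub]
    module

end

variable {φ : ℝ × ℝ → ℝ × ℝ}

variable (𝒜) in
/-- The substitution of the odd variables by the Jacobian matrix of `φ` at `τ`. -/
def jacSubst (φ : ℝ × ℝ → ℝ × ℝ) (τ : ℝ × ℝ) : SuperFun 𝒜 → SuperFun 𝒜 :=
  linSubst (fderiv ℝ φ τ (1, 0)).1 (fderiv ℝ φ τ (1, 0)).2 (fderiv ℝ φ τ (0, 1)).1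
    (fderiv ℝ φ τ (0, 1)).2

theorem SX_pull (Φ : SigmaField m 𝒢) (i : Fin m) (τ : ℝ × ℝ) :
    SX 𝒜 (pull φ Φ) i τ = jacSubst 𝒜 φ τ (SX 𝒜 Φ i (φ τ)) := by
  ext <;> simp [SX, pull, jacSubst, linSubst, jac] <;> abel

theorem soul_pull (Φ : SigmaField m 𝒢) (i : Fin m) (τ : ℝ × ℝ) :
    soul 𝒜 (pull φ Φ) τ i = jacSubst 𝒜 φ τ (soul 𝒜 Φ (φ τ) i) := by
  ext <;> simp [soul, pull, jacSubst, linSubst, jac] <;> abel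

theorem SA_pull (Φ : SigmaField m 𝒢) (i : Fin m) (τ : ℝ × ℝ) :
    SA 𝒜 (pull φ Φ) i τ = jacSubst 𝒜 φ τ (SA 𝒜 Φ i (φ τ)) := by
  ext <;> simp [SA, pull, jacSubst, linSubst, jac]

/-- Pullback commutes with the exterior derivative, here of the 1-form `A⁺`. -/
theorem curlAp_pull (hφ : ContDiff ℝ ∞ φ) {Φ : SigmaField m 𝒢} {τ : ℝ × ℝ}
    (h0 : DifferentiableAt ℝ Φ.Ap0 (φ τ)) (h1 : DifferentiableAt ℝ Φ.Ap1 (φ τ)) (i : Fin m) :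
    curlAp (pull φ Φ) τ i = jac φ τ • curlAp Φ (φ τ) i := by
  have hφ' : DifferentiableAt ℝ φ τ := hφ.differentiable (by norm_num) τ
  have hφ2 : Differentiable ℝ (fderiv ℝ φ) :=
    (hφ.fderiv_right (m := 1)
      (by rw [one_add_one_eq_two]; exact ENat.LEInfty.out)).differentiable (by norm_num)
  have hsymm : fderiv ℝ (fderiv ℝ φ) τ (1, 0) (0, 1) = fderiv ℝ (fderiv ℝ φ) τ (0, 1) (1, 0) :=
    (hφ.contDiffAt.isSymmSndFDerivAt (by simpa using ENat.LEInfty.out (m := 2))).eq _ _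
  have hcomp : ∀ {f : ℝ × ℝ → Fin m → 𝒢}, DifferentiableAt ℝ f (φ τ) → ∀ v,
      fderiv ℝ (fun s => f (φ s) i) τ v
        = (fderiv ℝ φ τ v).1 • fderiv ℝ (fun s => f s i) (φ τ) (1, 0)
          + (fderiv ℝ φ τ v).2 • fderiv ℝ (fun s => f s i) (φ τ) (0, 1) := by
    intro f hf v
    have hfi : DifferentiableAt ℝ (fun s => f s i) (φ τ) := differentiableAt_pi.1 hf i
    have e : fderiv ℝ (fun s => f (φ s) i) τ
        = (fderiv ℝ (fun s => f s i) (φ τ)).comp (fderiv ℝ φ τ) := fderiv_comp τ hfi hφ'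
    have e2 : fderiv ℝ φ τ v = (fderiv ℝ φ τ v).1 • ((1, 0) : ℝ × ℝ)
        + (fderiv ℝ φ τ v).2 • ((0, 1) : ℝ × ℝ) := by ext <;> simp
    rw [e, ContinuousLinearMap.comp_apply]
    conv_lhs => rw [e2, map_add, map_smul, map_smul]
  have hentry : ∀ w, HasFDerivAt (fun s => fderiv ℝ φ s w)
      ((ContinuousLinearMap.apply ℝ (ℝ × ℝ) w).comp (fderiv ℝ (fderiv ℝ φ) τ)) τ := fun w =>
    (ContinuousLinearMap.apply ℝ (ℝ × ℝ) w).hasFDerivAt.comp τ (hφ2 τ).hasFDerivAt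
  have hpull : ∀ w v, fderiv ℝ (fun s => (fderiv ℝ φ s w).1 • Φ.Ap0 (φ s) i
        + (fderiv ℝ φ s w).2 • Φ.Ap1 (φ s) i) τ v
      = ((fderiv ℝ φ τ w).1 • fderiv ℝ (fun s => Φ.Ap0 (φ s) i) τ v
          + (fderiv ℝ (fderiv ℝ φ) τ v w).1 • Φ.Ap0 (φ τ) i)
        + ((fderiv ℝ φ τ w).2 • fderiv ℝ (fun s => Φ.Ap1 (φ s) i) τ v
          + (fderiv ℝ (fderiv ℝ φ) τ v w).2 • Φ.Ap1 (φ τ) i) := by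
    intro w v
    have ha0 : HasFDerivAt (fun s => Φ.Ap0 (φ s) i) (fderiv ℝ (fun s => Φ.Ap0 (φ s) i) τ) τ :=
      ((differentiableAt_pi.1 h0 i).comp τ hφ').hasFDerivAt
    have ha1 : HasFDerivAt (fun s => Φ.Ap1 (φ s) i) (fderiv ℝ (fun s => Φ.Ap1 (φ s) i) τ) τ :=
      ((differentiableAt_pi.1 h1 i).comp τ hφ').hasFDerivAt
    have := (((hentry w).fst.fun_smul ha0).fun_add ((hentry w).snd.fun_smul ha1)).fderiv
    rw [this]
    simp
  simp only [curlAp, pull, Pi.add_apply, Pi.smul_apply]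
  rw [hpull, hpull, hsymm]
  simp only [hcomp h0, hcomp h1, jac]
  module

variable [GradedAlgebra 𝒜]

theorem atX_pull (f : (Fin m → ℝ) → ℝ) (Φ : SigmaField m 𝒢) (τ : ℝ × ℝ) :
    atX 𝒜 f (pull φ Φ) τ = jacSubst 𝒜 φ τ (atX 𝒜 f Φ (φ τ)) := by
  simp only [atX, superEval, soul_pull, jacSubst, linSubst_add, linSubst_sum, linSubst_smul,
    linSubst_mul, linSubst_one]
  rfl

theorem dd_SX_pull (hφ : ContDiff ℝ ∞ φ) {Φ : SigmaField m 𝒢} {τ : ℝ × ℝ}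
    (hX : DifferentiableAt ℝ Φ.X (φ τ))
    (h0 : DifferentiableAt ℝ Φ.Ap0 (φ τ)) (h1 : DifferentiableAt ℝ Φ.Ap1 (φ τ)) (i : Fin m) :
    dd (SX 𝒜 (pull φ Φ) i) τ = jacSubst 𝒜 φ τ (dd (SX 𝒜 Φ i) (φ τ)) := by
  have hφ' : DifferentiableAt ℝ φ τ := hφ.differentiable (by norm_num) τ
  have hX' : DifferentiableAt ℝ (pull φ Φ).X τ := hX.comp τ hφ'
  have hd : ∀ v, fderiv ℝ (pull φ Φ).X τ v i = (fderiv ℝ φ τ v).1 * fderiv ℝ Φ.X (φ τ) (1, 0) i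
      + (fderiv ℝ φ τ v).2 * fderiv ℝ Φ.X (φ τ) (0, 1) i := by
    intro v
    have e : fderiv ℝ (pull φ Φ).X τ = (fderiv ℝ Φ.X (φ τ)).comp (fderiv ℝ φ τ) :=
      fderiv_comp τ hX hφ'
    have e2 : fderiv ℝ φ τ v = (fderiv ℝ φ τ v).1 • ((1, 0) : ℝ × ℝ)
        + (fderiv ℝ φ τ v).2 • ((0, 1) : ℝ × ℝ) := by ext <;> simp
    rw [e, ContinuousLinearMap.comp_apply]
    conv_lhs => rw [e2, map_add, map_smul, map_smul]
    rfl
  rw [dd_SX hX', dd_SX hX]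
  ext <;> simp [jacSubst, linSubst, hd, add_smul, smul_smul, curlAp_pull hφ h0 h1, jac]

theorem covDensity_pull (π : (Fin m → ℝ) → Fin m → Fin m → ℝ)
    (H : (Fin m → ℝ) → Fin m → Fin m → Fin m → ℝ) (hφ : ContDiff ℝ ∞ φ) {Φ : SigmaField m 𝒢}
    {τ : ℝ × ℝ} (hX : DifferentiableAt ℝ Φ.X (φ τ))
    (h0 : DifferentiableAt ℝ Φ.Ap0 (φ τ)) (h1 : DifferentiableAt ℝ Φ.Ap1 (φ τ)) :
    covDensity 𝒜 π H (pull φ Φ) τ = jac φ τ • covDensity 𝒜 π H Φ (φ τ) := by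
  have hb : ∀ s : SuperFun 𝒜, jac φ τ • berezin s = berezin (jacSubst 𝒜 φ τ s) := fun s => by
    rw [jacSubst, berezin_linSubst, jac]
  have he : ∀ s : SuperFun 𝒜, eps (jacSubst 𝒜 φ τ s) = jacSubst 𝒜 φ τ (eps s) :=
    linSubst_eps _ _ _ _
  rw [covDensity, covDensity, hb]
  simp only [psmL, atX_pull, SA_pull, SX_pull, dd_SX_pull hφ hX h0 h1, he]
  simp only [jacSubst, ← linSubst_mul, ← linSubst_add, ← linSubst_sub, ← linSubst_smul,
    ← linSubst_sum]

theorem canDensity_pull (V W : SigmaField m 𝒢) (τ : ℝ × ℝ) :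
    canDensity 𝒜 (pull φ V) (pull φ W) τ = jac φ τ • canDensity 𝒜 V W (φ τ) := by
  have hb : ∀ s : SuperFun 𝒜, jac φ τ • berezin s = berezin (jacSubst 𝒜 φ τ s) := fun s => by
    rw [jacSubst, berezin_linSubst, jac]
  rw [canDensity, canDensity, hb]
  simp only [dSX, dSA, SA_pull, SX_pull]
  simp only [jacSubst, ← linSubst_mul, ← linSubst_sub, ← linSubst_sum]

/-- The pullback of the 3-form `H` at a point, as an alternating map. -/
def pullbackThreeForm {E : Type*} [AddCommGroup E] [Module ℝ E] (h : Fin m → Fin m → Fin m → ℝ)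
    (hl : ∀ i j k, h i j k = -h j i k) (hr : ∀ i j k, h i j k = -h i k j)
    (L : E →ₗ[ℝ] Fin m → ℝ) : E [⋀^Fin 3]→ₗ[ℝ] ℝ where
  toFun v := ∑ i, ∑ j, ∑ k, h i j k * L (v 0) i * L (v 1) j * L (v 2) k
  map_update_add' v n x y := by
    rename_i inst
    obtain rfl : inst = instDecidableEqFin 3 := Subsingleton.elim _ _
    fin_cases n <;> simp [Function.update, mul_add, add_mul, Finset.sum_add_distrib]
  map_update_smul' v n r x := by
    rename_i inst
    obtain rfl : inst = instDecidableEqFin 3 := Subsingleton.elim _ _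
    fin_cases n <;> simp [Function.update, Finset.mul_sum] <;>
      exact Finset.sum_congr rfl fun i _ => Finset.sum_congr rfl fun j _ =>
        Finset.sum_congr rfl fun k _ => by ring
  map_eq_zero_of_eq' v a b hab hne := by
    have h01 : ∀ u w : Fin m → ℝ, ∑ i, ∑ j, ∑ k, h i j k * u i * u j * w k = 0 := by
      intro u w
      have : ∑ i, ∑ j, ∑ k, h i j k * u i * u j * w k
          = -∑ i, ∑ j, ∑ k, h i j k * u i * u j * w k := by
        conv_lhs => rw [Finset.sum_comm]
        simp only [← Finset.sum_neg_distrib]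
        exact Finset.sum_congr rfl fun i _ => Finset.sum_congr rfl fun j _ =>
          Finset.sum_congr rfl fun k _ => by rw [hl j i k]; ring
      linarith
    have h12 : ∀ u w : Fin m → ℝ, ∑ i, ∑ j, ∑ k, h i j k * w i * u j * u k = 0 := by
      intro u w
      have : ∀ i, ∑ j, ∑ k, h i j k * w i * u j * u k = 0 := by
        intro i
        have : ∑ j, ∑ k, h i j k * w i * u j * u k = -∑ j, ∑ k, h i j k * w i * u j * u k := by
          conv_lhs => rw [Finset.sum_comm]
          simp only [← Finset.sum_neg_distrib]
          exact Finset.sum_congr rfl fun j _ => Finset.sum_congr rfl fun k _ => by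
            rw [hr i k j]; ring
        linarith
      simp [this]
    have h02 : ∀ u w : Fin m → ℝ, ∑ i, ∑ j, ∑ k, h i j k * u i * w j * u k = 0 := by
      intro u w
      rw [← neg_eq_zero, ← h12 u w, Finset.sum_comm]
      simp only [← Finset.sum_neg_distrib]
      exact Finset.sum_congr rfl fun i _ => Finset.sum_congr rfl fun j _ =>
        Finset.sum_congr rfl fun k _ => by rw [hl i j k]; ring
    fin_cases a <;> fin_cases b <;>
      first | exact absurd rfl hne | (simp at hab; simp [hab, h01, h02, h12])

/-- An alternating 3-form on a 3-dimensional space is a multiple of the determinant. -/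
theorem wzDensity_comp (H : (Fin m → ℝ) → Fin m → Fin m → Fin m → ℝ) {ψ : ℂ × ℝ → ℂ × ℝ}
    {XN : ℂ × ℝ → Fin m → ℝ} {p : ℂ × ℝ} (hψ : DifferentiableAt ℝ ψ p)
    (hX : DifferentiableAt ℝ XN (ψ p))
    (hl : ∀ i j k, H (XN (ψ p)) i j k = -H (XN (ψ p)) j i k)
    (hr : ∀ i j k, H (XN (ψ p)) i j k = -H (XN (ψ p)) i k j) :
    wzDensity H (fun q => XN (ψ q)) p
      = LinearMap.det (fderiv ℝ ψ p : ℂ × ℝ →ₗ[ℝ] ℂ × ℝ) * wzDensity H XN (ψ p) := by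
  -- The basis `1, I` of the disc factor and `1` of the circle factor, as in `wzDensity`.
  let e : Module.Basis (Fin 3) ℝ (ℂ × ℝ) :=
    (Complex.basisOneI.prod (Module.Basis.singleton (Fin 1) ℝ)).reindex finSumFinEquiv
  have e0 : e 0 = (1, 0) := by
    have : (0 : Fin 3) = finSumFinEquiv (Sum.inl (0 : Fin 2) : Fin 2 ⊕ Fin 1) := rfl
    simp [e, this, -finSumFinEquiv_apply_left]
  have e1 : e 1 = (Complex.I, 0) := by
    have : (1 : Fin 3) = finSumFinEquiv (Sum.inl (1 : Fin 2) : Fin 2 ⊕ Fin 1) := rfl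
    simp [e, this, -finSumFinEquiv_apply_left]
  have e2 : e 2 = (0, 1) := by
    have : (2 : Fin 3) = finSumFinEquiv (Sum.inr (0 : Fin 1) : Fin 2 ⊕ Fin 1) := rfl
    simp [e, this, -finSumFinEquiv_apply_right]
  let α := pullbackThreeForm (H (XN (ψ p))) hl hr (fderiv ℝ XN (ψ p) : ℂ × ℝ →ₗ[ℝ] Fin m → ℝ)
  have h1 : wzDensity H XN (ψ p) = α e := by
    simp [wzDensity, α, pullbackThreeForm, e0, e1, e2]
  have h2 : wzDensity H (fun q => XN (ψ q)) p = α ((fderiv ℝ ψ p : ℂ × ℝ →ₗ[ℝ] ℂ × ℝ) ∘ e) := by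
    have : fderiv ℝ (fun q => XN (ψ q)) p = (fderiv ℝ XN (ψ p)).comp (fderiv ℝ ψ p) :=
      fderiv_comp p hX hψ
    simp [wzDensity, α, pullbackThreeForm, e0, e1, e2, this]
  have h3 : ∀ v, α v = α e * e.det v := fun v => by
    conv_lhs => rw [α.eq_smul_basis_det e]
    rfl
  rw [h1, h2, h3, Module.Basis.det_comp, Module.Basis.det_self, mul_one, mul_comm]

end Covariance

/-! ### Integration over the torus -/

section Integration

open MeasureTheory

variable {𝒢 : Type*} [NormedRing 𝒢] [NormedAlgebra ℝ 𝒢]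

/-- The closed fundamental domain of the torus. -/
def torusCell : Set (ℝ × ℝ) := Set.Icc 0 (2 * Real.pi) ×ˢ Set.Icc 0 (2 * Real.pi)

theorem isCompact_torusCell : IsCompact torusCell := isCompact_Icc.prod isCompact_Icc

theorem intSigma_eq_setIntegral {f : ℝ × ℝ → 𝒢} (hf : ContinuousOn f torusCell) :
    intSigma f = ∫ σ in torusCell, f σ := by
  have h2 : (0 : ℝ) ≤ 2 * Real.pi := Real.two_pi_pos.le
  have hi : IntegrableOn f torusCell := hf.integrableOn_compact isCompact_torusCell
  rw [torusCell, Measure.volume_eq_prod, setIntegral_prod f hi, intSigma,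
    intervalIntegral.integral_of_le h2, ← integral_Icc_eq_integral_Ioc]
  simp only [intervalIntegral.integral_of_le h2, ← integral_Icc_eq_integral_Ioc]

theorem intSigma_add {f g : ℝ × ℝ → 𝒢} (hf : Continuous f) (hg : Continuous g) :
    intSigma (fun σ => f σ + g σ) = intSigma f + intSigma g := by
  rw [intSigma_eq_setIntegral hf.continuousOn, intSigma_eq_setIntegral hg.continuousOn,
    intSigma_eq_setIntegral (f := fun σ => f σ + g σ) (hf.add hg).continuousOn]
  exact integral_add (hf.continuousOn.integrableOn_compact isCompact_torusCell)
    (hg.continuousOn.integrableOn_compact isCompact_torusCell)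

theorem intSigma_smul (r : ℝ) (f : ℝ × ℝ → 𝒢) :
    intSigma (fun σ => r • f σ) = r • intSigma f := by
  simp [intSigma, intervalIntegral.integral_smul]

theorem exists_ball_prod_torusCell_subset {O : Set (ℝ × (ℝ × ℝ))} (hO : IsOpen O)
    (h0 : ∀ σ ∈ torusCell, ((0 : ℝ), σ) ∈ O) :
    ∃ δ > 0, ∀ s ∈ Metric.closedBall (0 : ℝ) δ, ∀ σ ∈ torusCell, (s, σ) ∈ O := by
  obtain ⟨u, v, hu, hv, h0u, hv', huv⟩ := generalized_tube_lemma
    (isCompact_singleton (x := (0 : ℝ))) isCompact_torusCell hO (by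
      rintro ⟨s, σ⟩ ⟨rfl, hσ⟩
      exact h0 σ hσ)
  obtain ⟨δ, hδ, hδu⟩ := Metric.nhds_basis_closedBall.mem_iff.1 (hu.mem_nhds (h0u rfl))
  exact ⟨δ, hδ, fun s hs σ hσ => huv ⟨hδu hs, hv' hσ⟩⟩

/-- Differentiation under the integral over the torus. -/
theorem hasDerivAt_intSigma {F : ℝ × (ℝ × ℝ) → 𝒢} {O : Set (ℝ × (ℝ × ℝ))} (hO : IsOpen O)
    (hF : ContDiffOn ℝ 1 F O) (h0 : ∀ σ, ((0 : ℝ), σ) ∈ O) {f' : ℝ × ℝ → 𝒢}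
    (hf' : ∀ σ, HasDerivAt (fun s => F (s, σ)) (f' σ) 0) :
    HasDerivAt (fun s => intSigma fun σ => F (s, σ)) (intSigma f') 0 := by
  obtain ⟨δ, hδ, hsub⟩ := exists_ball_prod_torusCell_subset hO fun σ _ => h0 σ
  have hD : ContinuousOn (fun p => fderiv ℝ F p (1, 0)) O :=
    (hF.continuousOn_fderiv_of_isOpen hO le_rfl).clm_apply continuousOn_const
  have hslice : ∀ s ∈ Metric.closedBall (0 : ℝ) δ, ∀ σ ∈ torusCell,
      HasDerivAt (fun s => F (s, σ)) (fderiv ℝ F (s, σ) (1, 0)) s := fun s hs σ hσ => by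
    have hd : HasFDerivAt F (fderiv ℝ F (s, σ)) (s, σ) :=
      ((hF.contDiffAt (hO.mem_nhds (hsub s hs σ hσ))).differentiableAt (by norm_num)).hasFDerivAt
    have := hd.comp_hasDerivAt s ((hasDerivAt_id s).prodMk (hasDerivAt_const s σ))
    exact this
  have hcell : ∀ s ∈ Metric.closedBall (0 : ℝ) δ,
      ContinuousOn (fun σ => F (s, σ)) torusCell := fun s hs =>
    hF.continuousOn.comp (by fun_prop) fun σ hσ => hsub s hs σ hσ
  obtain ⟨C, hC⟩ := ((isCompact_closedBall (0 : ℝ) δ).prod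
    isCompact_torusCell).exists_bound_of_continuousOn (hD.mono fun p hp => hsub p.1 hp.1 p.2 hp.2)
  have h00 : (0 : ℝ) ∈ Metric.closedBall (0 : ℝ) δ := Metric.mem_closedBall_self hδ.le
  have hnhds : Metric.closedBall (0 : ℝ) δ ∈ nhds (0 : ℝ) := Metric.closedBall_mem_nhds 0 hδ
  have hf'eq : ∀ σ ∈ torusCell, f' σ = fderiv ℝ F (0, σ) (1, 0) := fun σ hσ =>
    (hf' σ).unique (hslice 0 h00 σ hσ)
  have hcD : ContinuousOn (fun σ => fderiv ℝ F (0, σ) (1, 0)) torusCell :=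
    hD.comp (by fun_prop) fun σ hσ => hsub 0 h00 σ hσ
  have hmeas : MeasurableSet torusCell := isCompact_torusCell.measurableSet
  have key := (hasDerivAt_integral_of_dominated_loc_of_deriv_le (μ := volume.restrict torusCell)
    (F := fun s σ => F (s, σ)) (F' := fun s σ => fderiv ℝ F (s, σ) (1, 0)) (x₀ := (0 : ℝ))
    (bound := fun _ => C) hnhds
    (Filter.eventually_of_mem hnhds fun s hs => (hcell s hs).aestronglyMeasurable hmeas)
    ((hcell 0 h00).integrableOn_compact isCompact_torusCell)
    (hcD.aestronglyMeasurable hmeas)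
    (ae_restrict_of_forall_mem hmeas fun σ hσ s hs => hC (s, σ) ⟨hs, hσ⟩)
    (integrableOn_const isCompact_torusCell.measure_lt_top.ne)
    (ae_restrict_of_forall_mem hmeas fun σ hσ s hs => hslice s hs σ hσ)).2
  rw [intSigma_eq_setIntegral (hcD.congr hf'eq), setIntegral_congr_fun hmeas hf'eq]
  refine key.congr_of_eventuallyEq (Filter.eventually_of_mem hnhds fun s hs => ?_)
  exact intSigma_eq_setIntegral (hcell s hs)

/-- Total derivatives of periodic functions integrate to zero over the torus. -/
theorem intSigma_divergence {f g : ℝ × ℝ → 𝒢} (hf : ContDiff ℝ ∞ f) (hg : ContDiff ℝ ∞ g)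
    (hf0 : ∀ s t, f (s + 2 * Real.pi, t) = f (s, t))
    (hg1 : ∀ s t, g (s, t + 2 * Real.pi) = g (s, t)) :
    intSigma (fun σ => fderiv ℝ f σ (1, 0) + fderiv ℝ g σ (0, 1)) = 0 := by
  have hc : Continuous (fun σ => fderiv ℝ f σ (1, 0) + fderiv ℝ g σ (0, 1)) :=
    ((hf.continuous_fderiv (by norm_num)).clm_apply continuous_const).add
      ((hg.continuous_fderiv (by norm_num)).clm_apply continuous_const)
  rw [intSigma, integral2_divergence_prod_of_hasFDerivAt f g (fderiv ℝ f) (fderiv ℝ g)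
    0 0 (2 * Real.pi) (2 * Real.pi) hf.continuous.continuousOn hg.continuous.continuousOn
    (fun σ _ => (hf.differentiable (by norm_num) σ).hasFDerivAt)
    (fun σ _ => (hg.differentiable (by norm_num) σ).hasFDerivAt)
    (hc.continuousOn.integrableOn_compact (isCompact_uIcc.prod isCompact_uIcc))]
  have e0 : ∀ y, f (2 * Real.pi, y) = f (0, y) := fun y => by simpa using hf0 0 y
  have e1 : ∀ x, g (x, 2 * Real.pi) = g (x, 0) := fun x => by simpa using hg1 x 0
  simp [e0, e1]

end Integration

/-! ### Invariance of the Darboux form and the Hamiltonian vector field -/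

section Symplectic

variable {m : ℕ} {𝒢 : Type*} [NormedRing 𝒢] [NormedAlgebra ℝ 𝒢] {𝒜 : ℤ → Submodule ℝ 𝒢}
  {U : Set (Fin m → ℝ)} {π : (Fin m → ℝ) → Fin m → Fin m → ℝ}
  {H : (Fin m → ℝ) → Fin m → Fin m → Fin m → ℝ}

/-- The derivative of `f` at `x` in the direction `v`, in coordinates. -/
def dirPd (f : (Fin m → ℝ) → ℝ) (x v : Fin m → ℝ) : ℝ := ∑ a, pd a f x * v a

theorem fderiv_eq_dirPd (f : (Fin m → ℝ) → ℝ) (x v : Fin m → ℝ) : fderiv ℝ f x v = dirPd f x v := by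
  conv_lhs => rw [pi_eq_sum_univ' v]
  simp [dirPd, pd, mul_comm]

theorem hasDerivAt_comp_line {f : (Fin m → ℝ) → ℝ} {x : Fin m → ℝ} (hf : DifferentiableAt ℝ f x)
    (v : Fin m → ℝ) : HasDerivAt (fun s : ℝ => f (x + s • v)) (dirPd f x v) 0 := by
  have h1 : HasDerivAt (fun s : ℝ => x + s • v) v 0 := by
    simpa using ((hasDerivAt_id (0 : ℝ)).smul_const v).const_add x
  have h2 : HasFDerivAt f (fderiv ℝ f x) (x + (0 : ℝ) • v) := by simpa using hf.hasFDerivAt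
  rw [← fderiv_eq_dirPd]
  exact h2.comp_hasDerivAt 0 h1

theorem hasDerivAt_line {E : Type*} [NormedAddCommGroup E] [NormedSpace ℝ E] (a v : E) :
    HasDerivAt (fun s : ℝ => a + s • v) v 0 := by
  simpa using ((hasDerivAt_id (0 : ℝ)).smul_const v).const_add a

theorem hasDerivAt_smul_mul_line (r : ℝ) {f : (Fin m → ℝ) → ℝ} {x : Fin m → ℝ}
    (hf : DifferentiableAt ℝ f x) (v : Fin m → ℝ) (a a' b b' : 𝒢) :
    HasDerivAt (fun s : ℝ => (r * f (x + s • v)) • ((a + s • a') * (b + s • b')))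
      (r • (f x • (a' * b + a * b') + dirPd f x v • (a * b))) 0 := by
  have := ((hasDerivAt_comp_line hf v).const_mul r).fun_smul
    ((hasDerivAt_line a a').fun_mul (hasDerivAt_line b b'))
  simpa [smul_add, smul_smul] using this

theorem hasDerivAt_smul_mul_mul_line (r : ℝ) {f : (Fin m → ℝ) → ℝ} {x : Fin m → ℝ}
    (hf : DifferentiableAt ℝ f x) (v : Fin m → ℝ) (a a' b b' c c' : 𝒢) :
    HasDerivAt
      (fun s : ℝ => (r * f (x + s • v)) • ((a + s • a') * (b + s • b') * (c + s • c')))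
      (r • (f x • ((a' * b + a * b') * c + a * b * c') + dirPd f x v • (a * b * c))) 0 := by
  have := ((hasDerivAt_comp_line hf v).const_mul r).fun_smul
    (((hasDerivAt_line a a').fun_mul (hasDerivAt_line b b')).fun_mul (hasDerivAt_line c c'))
  simpa [smul_add, smul_smul] using this

variable (π H) in
/-- The derivative of `Θ^i_{jk}` at `X` in the direction of the tangent vector `V`. -/
def dTheta (Φ V : SigmaField m 𝒢) (σ : ℝ × ℝ) (i j k : Fin m) : ℝ :=
  dirPd (Theta π H i j k) (Φ.X σ) (V.X σ)

variable (π H) in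
/-- The derivative of the vector field `hamLam` at `Φ` in the direction of the tangent
vector `V`. -/
def hamLamDeriv (Φ V : BVField m 𝒢) : BVField m 𝒢 :=
  { X := 0, c := 0, Ap0 := 0, Ap1 := 0, XN := 0
    A0 := fun σ i => ∑ j, ∑ k, (1 / 2 : ℝ) • (Theta π H j k i (Φ.X σ)
      • (V.Ap0 σ k * Φ.c σ j + Φ.Ap0 σ k * V.c σ j)
      + dTheta π H Φ.toSigmaField V.toSigmaField σ j k i • (Φ.Ap0 σ k * Φ.c σ j))
    A1 := fun σ i => -∑ j, ∑ k, (1 / 2 : ℝ) • (Theta π H j k i (Φ.X σ)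
      • (V.Ap1 σ k * Φ.c σ j + Φ.Ap1 σ k * V.c σ j)
      + dTheta π H Φ.toSigmaField V.toSigmaField σ j k i • (Φ.Ap1 σ k * Φ.c σ j))
    Xp := fun σ i => -∑ j, ∑ k, ∑ l, (1 / 2 : ℝ) • (pd i (Theta π H j k l) (Φ.X σ)
      • ((V.Ap0 σ k * Φ.Ap1 σ l + Φ.Ap0 σ k * V.Ap1 σ l) * Φ.c σ j
        + Φ.Ap0 σ k * Φ.Ap1 σ l * V.c σ j)
      + dirPd (pd i (Theta π H j k l)) (Φ.X σ) (V.X σ) • (Φ.Ap0 σ k * Φ.Ap1 σ l * Φ.c σ j))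
    cp := fun σ i => -∑ j, ∑ k, (1 / 2 : ℝ) • (Theta π H i j k (Φ.X σ)
      • (V.Ap0 σ j * Φ.Ap1 σ k + Φ.Ap0 σ j * V.Ap1 σ k)
      + dTheta π H Φ.toSigmaField V.toSigmaField σ i j k • (Φ.Ap0 σ j * Φ.Ap1 σ k)) }

variable [GradedAlgebra 𝒜]

theorem fieldTangent_T2 (h𝒜 : GradedComm 𝒜) (hU : IsOpen U) (hπ : IsTwistedPoisson U π H)
    {Φ V : BVField m 𝒢} (h : Φ ∈ bvFields 𝒜 U) (hV : IsTangent 𝒜 V) :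
    fieldTangent (T2 𝒜 π H) Φ V = V + (-1 : ℝ) • hamLamDeriv π H Φ V := by
  have hT : ∀ s : ℝ, T2 𝒜 π H (Φ + s • V) = (Φ + s • V) + (-1 : ℝ) • hamLam π H (Φ + s • V) :=
    fun s => T2_eq h𝒜 (h.1.add_smul hV s)
  have hd : ∀ σ i j k, DifferentiableAt ℝ (Theta π H i j k) (Φ.X σ) := fun σ i j k =>
    ((hπ.Theta_smooth i j k).contDiffAt (hU.mem_nhds (X_mem h σ))).differentiableAt (by norm_num)
  have hdd : ∀ σ a i j k, DifferentiableAt ℝ (pd a (Theta π H i j k)) (Φ.X σ) := fun σ a i j k =>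
    ((contDiffOn_pd hU (hπ.Theta_smooth i j k) a).contDiffAt
      (hU.mem_nhds (X_mem h σ))).differentiableAt (by norm_num)
  apply BVField.ext
  case A0 =>
    funext σ i
    have key := (hasDerivAt_line (Φ.A0 σ i) (V.A0 σ i)).fun_add
      ((HasDerivAt.fun_sum (u := Finset.univ) fun j _ =>
        HasDerivAt.fun_sum (u := Finset.univ) fun k _ =>
        hasDerivAt_smul_mul_line (1 / 2) (hd σ j k i) (V.X σ)
          (Φ.Ap0 σ k) (V.Ap0 σ k) (Φ.c σ j) (V.c σ j)).const_smul (-1 : ℝ))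
    have e := key.deriv
    simp only [fieldTangent, hT, hamLam, hamLamDeriv, dTheta, add_A0, smul_A0, Pi.add_apply,
      Pi.smul_apply, add_X, add_c, add_Ap0, add_Ap1, smul_X, smul_c, smul_Ap0, smul_Ap1]
    exact e
  case A1 =>
    funext σ i
    have key := (hasDerivAt_line (Φ.A1 σ i) (V.A1 σ i)).fun_add
      ((HasDerivAt.fun_sum (u := Finset.univ) fun j _ =>
        HasDerivAt.fun_sum (u := Finset.univ) fun k _ =>
        hasDerivAt_smul_mul_line (1 / 2) (hd σ j k i) (V.X σ)
          (Φ.Ap1 σ k) (V.Ap1 σ k) (Φ.c σ j) (V.c σ j)).fun_neg.const_smul (-1 : ℝ))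
    have e := key.deriv
    simp only [fieldTangent, hT, hamLam, hamLamDeriv, dTheta, add_A1, smul_A1, Pi.add_apply,
      Pi.smul_apply, add_X, add_c, add_Ap0, add_Ap1, smul_X, smul_c, smul_Ap0, smul_Ap1]
    exact e
  case cp =>
    funext σ i
    have key := (hasDerivAt_line (Φ.cp σ i) (V.cp σ i)).fun_add
      ((HasDerivAt.fun_sum (u := Finset.univ) fun j _ =>
        HasDerivAt.fun_sum (u := Finset.univ) fun k _ =>
        hasDerivAt_smul_mul_line (1 / 2) (hd σ i j k) (V.X σ)
          (Φ.Ap0 σ j) (V.Ap0 σ j) (Φ.Ap1 σ k) (V.Ap1 σ k)).fun_neg.const_smul (-1 : ℝ))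
    have e := key.deriv
    simp only [fieldTangent, hT, hamLam, hamLamDeriv, dTheta, add_cp, smul_cp, Pi.add_apply,
      Pi.smul_apply, add_X, add_c, add_Ap0, add_Ap1, smul_X, smul_c, smul_Ap0, smul_Ap1]
    exact e
  case Xp =>
    funext σ i
    have key := (hasDerivAt_line (Φ.Xp σ i) (V.Xp σ i)).fun_add
      ((HasDerivAt.fun_sum (u := Finset.univ) fun j _ =>
        HasDerivAt.fun_sum (u := Finset.univ) fun k _ =>
        HasDerivAt.fun_sum (u := Finset.univ) fun l _ =>
        hasDerivAt_smul_mul_mul_line (1 / 2) (hdd σ i j k l) (V.X σ)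
          (Φ.Ap0 σ k) (V.Ap0 σ k) (Φ.Ap1 σ l) (V.Ap1 σ l)
          (Φ.c σ j) (V.c σ j)).fun_neg.const_smul (-1 : ℝ))
    have e := key.deriv
    simp only [fieldTangent, hT, hamLam, hamLamDeriv, dTheta, add_Xp, smul_Xp, Pi.add_apply,
      Pi.smul_apply, add_X, add_c, add_Ap0, add_Ap1, smul_X, smul_c, smul_Ap0, smul_Ap1]
    exact e
  case X =>
    funext σ i
    simp only [fieldTangent, hT]
    exact ((hasDerivAt_line (Φ.X σ i) (V.X σ i)).add_const ((-1 : ℝ) • (0 : ℝ))).deriv.trans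
      (show V.X σ i = V.X σ i + (-1 : ℝ) • (0 : ℝ) by simp)
  case c =>
    funext σ i
    simp only [fieldTangent, hT]
    exact ((hasDerivAt_line (Φ.c σ i) (V.c σ i)).add_const ((-1 : ℝ) • (0 : 𝒢))).deriv.trans
      (show V.c σ i = V.c σ i + (-1 : ℝ) • (0 : 𝒢) by simp)
  case Ap0 =>
    funext σ i
    simp only [fieldTangent, hT]
    exact ((hasDerivAt_line (Φ.Ap0 σ i) (V.Ap0 σ i)).add_const ((-1 : ℝ) • (0 : 𝒢))).deriv.trans
      (show V.Ap0 σ i = V.Ap0 σ i + (-1 : ℝ) • (0 : 𝒢) by simp)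
  case Ap1 =>
    funext σ i
    simp only [fieldTangent, hT]
    exact ((hasDerivAt_line (Φ.Ap1 σ i) (V.Ap1 σ i)).add_const ((-1 : ℝ) • (0 : 𝒢))).deriv.trans
      (show V.Ap1 σ i = V.Ap1 σ i + (-1 : ℝ) • (0 : 𝒢) by simp)
  case XN =>
    funext σ i
    simp only [fieldTangent, hT]
    exact ((hasDerivAt_line (Φ.XN σ i) (V.XN σ i)).add_const ((-1 : ℝ) • (0 : ℝ))).deriv.trans
      (show V.XN σ i = V.XN σ i + (-1 : ℝ) • (0 : ℝ) by simp)

end Symplectic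

section SymplecticInvariance

variable {m : ℕ} {𝒢 : Type*} [NormedRing 𝒢] [NormedAlgebra ℝ 𝒢] {𝒜 : ℤ → Submodule ℝ 𝒢}
  {U : Set (Fin m → ℝ)} {π : (Fin m → ℝ) → Fin m → Fin m → ℝ}
  {H : (Fin m → ℝ) → Fin m → Fin m → Fin m → ℝ}

/-- The component of `δ𝐗^i(V) δ𝐀_i(W)` along `θ¹θ⁰`. -/
def pairing (V W : SigmaField m 𝒢) (σ : ℝ × ℝ) : 𝒢 :=
  ∑ i, (V.X σ i • W.Xp σ i - V.cp σ i * W.c σ i + V.Ap1 σ i * W.A0 σ i - V.Ap0 σ i * W.A1 σ i)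

/-- The density of the Darboux form is the antisymmetrised pairing of the fields with the conjugate
fields. -/
theorem canDensity_eq [GradedAlgebra 𝒜] {V W : SigmaField m 𝒢} {σ : ℝ × ℝ}
    (hV0 : ∀ i, V.Ap0 σ i ∈ 𝒜 (-1)) (hV1 : ∀ i, V.Ap1 σ i ∈ 𝒜 (-1))
    (hW0 : ∀ i, W.Ap0 σ i ∈ 𝒜 (-1)) (hW1 : ∀ i, W.Ap1 σ i ∈ 𝒜 (-1)) :
    canDensity 𝒜 V W σ = pairing V W σ - pairing W V σ := by
  have e1 := fun i => parity_of_odd (by decide) (hV0 i)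
  have e2 := fun i => parity_of_odd (by decide) (hV1 i)
  have e3 := fun i => parity_of_odd (by decide) (hW0 i)
  have e4 := fun i => parity_of_odd (by decide) (hW1 i)
  simp only [canDensity, berezin, pairing, dSX, dSA, SuperFun.sum_t10, SuperFun.sub_t10,
    ← Finset.sum_sub_distrib]
  refine Finset.sum_congr rfl fun i _ => ?_
  simp [SX, SA, e1, e2, e3, e4]
  simp only [Algebra.algebraMap_eq_smul_one, smul_mul_assoc, one_mul]
  abel

theorem sum_X_smul_hamLamDeriv_Xp (Φ V W : BVField m 𝒢) (σ : ℝ × ℝ) :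
    ∑ i, V.X σ i • (hamLamDeriv π H Φ W).Xp σ i
      = ∑ j, ∑ k, ∑ l, (-(1 / 2) : ℝ) • (dTheta π H Φ.toSigmaField V.toSigmaField σ j k l
        • ((W.Ap0 σ k * Φ.Ap1 σ l + Φ.Ap0 σ k * W.Ap1 σ l) * Φ.c σ j
          + Φ.Ap0 σ k * Φ.Ap1 σ l * W.c σ j)
        + (∑ a, V.X σ a * dirPd (pd a (Theta π H j k l)) (Φ.X σ) (W.X σ))
          • (Φ.Ap0 σ k * Φ.Ap1 σ l * Φ.c σ j)) := by
  simp only [hamLamDeriv, smul_neg, Finset.smul_sum, ← Finset.sum_neg_distrib]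
  rw [sum_move3]
  refine Finset.sum_congr rfl fun j _ => Finset.sum_congr rfl fun k _ =>
    Finset.sum_congr rfl fun l _ => ?_
  rw [dTheta, dirPd, Finset.sum_smul, Finset.sum_smul, ← Finset.sum_add_distrib, Finset.smul_sum]
  exact Finset.sum_congr rfl fun i _ => by module

theorem sum_hamLamDeriv_cp_mul_c (Φ V W : BVField m 𝒢) (σ : ℝ × ℝ) :
    ∑ i, (hamLamDeriv π H Φ V).cp σ i * W.c σ i
      = ∑ j, ∑ k, ∑ l, (-(1 / 2) : ℝ) • (Theta π H j k l (Φ.X σ)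
        • ((V.Ap0 σ k * Φ.Ap1 σ l + Φ.Ap0 σ k * V.Ap1 σ l) * W.c σ j)
        + dTheta π H Φ.toSigmaField V.toSigmaField σ j k l
          • (Φ.Ap0 σ k * Φ.Ap1 σ l * W.c σ j)) := by
  simp only [hamLamDeriv, neg_mul, Finset.sum_mul, ← Finset.sum_neg_distrib]
  refine Finset.sum_congr rfl fun j _ => Finset.sum_congr rfl fun k _ =>
    Finset.sum_congr rfl fun l _ => ?_
  simp only [smul_mul_assoc, add_mul]
  module

theorem sum_Ap1_mul_hamLamDeriv_A0 (Φ V W : BVField m 𝒢) (σ : ℝ × ℝ) :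
    ∑ i, V.Ap1 σ i * (hamLamDeriv π H Φ W).A0 σ i
      = ∑ j, ∑ k, ∑ l, (1 / 2 : ℝ) • (Theta π H j k l (Φ.X σ)
        • (V.Ap1 σ l * (W.Ap0 σ k * Φ.c σ j + Φ.Ap0 σ k * W.c σ j))
        + dTheta π H Φ.toSigmaField W.toSigmaField σ j k l
          • (V.Ap1 σ l * (Φ.Ap0 σ k * Φ.c σ j))) := by
  simp only [hamLamDeriv, Finset.mul_sum]
  rw [sum_move2]
  refine Finset.sum_congr rfl fun j _ => Finset.sum_congr rfl fun k _ =>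
    Finset.sum_congr rfl fun l _ => ?_
  simp only [mul_smul_comm, mul_add]

theorem dirPd_Theta_anti (hU : IsOpen U) (hπ : IsTwistedPoisson U π H) {x : Fin m → ℝ}
    (hx : x ∈ U) (v : Fin m → ℝ) (i j k : Fin m) :
    dirPd (Theta π H i j k) x v = -dirPd (Theta π H i k j) x v := by
  simp only [dirPd, ← Finset.sum_neg_distrib, ← neg_mul]
  exact Finset.sum_congr rfl fun a _ => by
    rw [pd_eq_neg_of_eqOn hU (fun y hy => hπ.Theta_anti hy i j k) hx a]

theorem sum_Ap0_mul_hamLamDeriv_A1 (hU : IsOpen U) (hπ : IsTwistedPoisson U π H)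
    {Φ : BVField m 𝒢} (V W : BVField m 𝒢) {σ : ℝ × ℝ} (hx : Φ.X σ ∈ U) :
    ∑ i, V.Ap0 σ i * (hamLamDeriv π H Φ W).A1 σ i
      = ∑ j, ∑ k, ∑ l, (1 / 2 : ℝ) • (Theta π H j k l (Φ.X σ)
        • (V.Ap0 σ k * (W.Ap1 σ l * Φ.c σ j + Φ.Ap1 σ l * W.c σ j))
        + dTheta π H Φ.toSigmaField W.toSigmaField σ j k l
          • (V.Ap0 σ k * (Φ.Ap1 σ l * Φ.c σ j))) := by
  simp only [hamLamDeriv, mul_neg, Finset.mul_sum, ← Finset.sum_neg_distrib]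
  rw [Finset.sum_comm]
  refine Finset.sum_congr rfl fun j _ => Finset.sum_congr rfl fun k _ =>
    Finset.sum_congr rfl fun l _ => ?_
  rw [dTheta, dTheta, hπ.Theta_anti hx j l k, dirPd_Theta_anti hU hπ hx _ j l k]
  simp only [mul_smul_comm, mul_add]
  module

/-- The part of the pairing that is linear in the derivative of `hamLam`. -/
def hamLamCross (π : (Fin m → ℝ) → Fin m → Fin m → ℝ) (H : (Fin m → ℝ) → Fin m → Fin m → Fin m → ℝ)
    (Φ V W : BVField m 𝒢) (σ : ℝ × ℝ) : 𝒢 :=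
  ∑ i, V.X σ i • (hamLamDeriv π H Φ W).Xp σ i - ∑ i, (hamLamDeriv π H Φ V).cp σ i * W.c σ i
    + ∑ i, V.Ap1 σ i * (hamLamDeriv π H Φ W).A0 σ i
    - ∑ i, V.Ap0 σ i * (hamLamDeriv π H Φ W).A1 σ i

theorem pairing_add_hamLamDeriv (Φ V W : BVField m 𝒢) (σ : ℝ × ℝ) :
    pairing (V + (-1 : ℝ) • hamLamDeriv π H Φ V).toSigmaField
        (W + (-1 : ℝ) • hamLamDeriv π H Φ W).toSigmaField σ
      = pairing V.toSigmaField W.toSigmaField σ - hamLamCross π H Φ V W σ := by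
  simp only [hamLamCross, pairing, ← Finset.sum_sub_distrib, ← Finset.sum_add_distrib]
  refine Finset.sum_congr rfl fun i _ => ?_
  have e1 : (hamLamDeriv π H Φ V).X = 0 := rfl
  have e2 : (hamLamDeriv π H Φ V).Ap0 = 0 := rfl
  have e3 : (hamLamDeriv π H Φ V).Ap1 = 0 := rfl
  have e4 : (hamLamDeriv π H Φ W).c = 0 := rfl
  simp only [add_X, smul_X, add_Ap0, smul_Ap0, add_Ap1, smul_Ap1, add_c, smul_c, e1, e2, e3, e4,
    add_cp, smul_cp, add_A0, smul_A0, add_A1, smul_A1, add_Xp, smul_Xp, smul_zero, add_zero,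
    Pi.add_apply, Pi.smul_apply, Pi.zero_apply, add_zero, mul_add, add_mul, smul_add,
    mul_smul_comm, smul_mul_assoc]
  module

/-- Symmetry of the second derivative. -/
theorem dirPd_pd_symm (hU : IsOpen U) {f : (Fin m → ℝ) → ℝ} (hf : ContDiffOn ℝ ∞ f U)
    {x : Fin m → ℝ} (hx : x ∈ U) (v w : Fin m → ℝ) :
    ∑ a, v a * dirPd (pd a f) x w = ∑ a, w a * dirPd (pd a f) x v := by
  have hsymm : ∀ a b, pd a (pd b f) x = pd b (pd a f) x := by
    have hd : DifferentiableAt ℝ (fderiv ℝ f) x :=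
      ((hf.fderiv_of_isOpen (m := 1) hU
        (by rw [one_add_one_eq_two]; exact ENat.LEInfty.out)).contDiffAt
        (hU.mem_nhds hx)).differentiableAt (by norm_num)
    have e : ∀ a b, pd a (pd b f) x
        = fderiv ℝ (fderiv ℝ f) x (Pi.single a 1) (Pi.single b 1) := fun a b => by
      have h1 : HasFDerivAt (pd b f)
          ((ContinuousLinearMap.apply ℝ ℝ (Pi.single b 1 : Fin m → ℝ)).comp
            (fderiv ℝ (fderiv ℝ f) x)) x :=
        (ContinuousLinearMap.apply ℝ ℝ (Pi.single b 1 : Fin m → ℝ)).hasFDerivAt.comp x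
          hd.hasFDerivAt
      rw [pd, h1.fderiv]
      rfl
    intro a b
    rw [e, e]
    exact ((hf.contDiffAt (hU.mem_nhds hx)).isSymmSndFDerivAt
      (by simpa using ENat.LEInfty.out (m := 2))).eq _ _
  simp only [dirPd, Finset.mul_sum]
  rw [Finset.sum_comm]
  exact Finset.sum_congr rfl fun a _ => Finset.sum_congr rfl fun b _ => by
    rw [hsymm a b]; ring

/-- The cross terms are symmetric: they are a second derivative of the density of `Λ`. -/
theorem hamLamCross_symm (h𝒜 : GradedComm 𝒜) (hU : IsOpen U) (hπ : IsTwistedPoisson U π H)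
    {Φ V W : BVField m 𝒢} {σ : ℝ × ℝ} (hx : Φ.X σ ∈ U) (hΦ : HasGhosts 𝒜 Φ.toSigmaField σ)
    (hV : HasGhosts 𝒜 V.toSigmaField σ) (hW : HasGhosts 𝒜 W.toSigmaField σ) :
    hamLamCross π H Φ V W σ = hamLamCross π H Φ W V σ := by
  simp only [hamLamCross, sum_X_smul_hamLamDeriv_Xp, sum_hamLamDeriv_cp_mul_c,
    sum_Ap1_mul_hamLamDeriv_A0, sum_Ap0_mul_hamLamDeriv_A1 hU hπ _ _ hx,
    ← Finset.sum_sub_distrib, ← Finset.sum_add_distrib]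
  refine Finset.sum_congr rfl fun j _ => Finset.sum_congr rfl fun k _ =>
    Finset.sum_congr rfl fun l _ => ?_
  rw [dirPd_pd_symm hU (hπ.Theta_smooth j k l) hx (W.X σ) (V.X σ)]
  have swap : ∀ {a b : 𝒢}, a ∈ 𝒜 (-1) → b ∈ 𝒜 (-1) → ∀ z, b * (a * z) = -(a * (b * z)) :=
    fun ha hb z => by
      rw [← mul_assoc, h𝒜.anticomm_of_odd (by decide) hb ha, neg_mul, mul_assoc]
  simp only [mul_add, add_mul, mul_assoc, swap (hW.Ap0 k) (hV.Ap1 l), swap (hΦ.Ap0 k) (hV.Ap1 l),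
    swap (hV.Ap0 k) (hW.Ap1 l), swap (hΦ.Ap0 k) (hW.Ap1 l)]
  module

theorem canDensity_T2 [GradedAlgebra 𝒜] (h𝒜 : GradedComm 𝒜) (hU : IsOpen U)
    (hπ : IsTwistedPoisson U π H) {Φ V W : BVField m 𝒢} (h : Φ ∈ bvFields 𝒜 U)
    (hV : IsTangent 𝒜 V) (hW : IsTangent 𝒜 W) (σ : ℝ × ℝ) :
    canDensity 𝒜 (V + (-1 : ℝ) • hamLamDeriv π H Φ V).toSigmaField
        (W + (-1 : ℝ) • hamLamDeriv π H Φ W).toSigmaField σ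
      = canDensity 𝒜 V.toSigmaField W.toSigmaField σ := by
  have e0 : ∀ Z : BVField m 𝒢, (Z + (-1 : ℝ) • hamLamDeriv π H Φ Z).Ap0 = Z.Ap0 := fun Z => by
    simp [hamLamDeriv]
  have e1 : ∀ Z : BVField m 𝒢, (Z + (-1 : ℝ) • hamLamDeriv π H Φ Z).Ap1 = Z.Ap1 := fun Z => by
    simp [hamLamDeriv]
  rw [canDensity_eq (by rw [e0]; exact hV.Ap0.ghost σ) (by rw [e1]; exact hV.Ap1.ghost σ)
      (by rw [e0]; exact hW.Ap0.ghost σ) (by rw [e1]; exact hW.Ap1.ghost σ),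
    canDensity_eq (hV.Ap0.ghost σ) (hV.Ap1.ghost σ) (hW.Ap0.ghost σ) (hW.Ap1.ghost σ),
    pairing_add_hamLamDeriv, pairing_add_hamLamDeriv,
    hamLamCross_symm h𝒜 hU hπ (X_mem h σ) (h.1.hasGhosts σ) (hV.hasGhosts σ) (hW.hasGhosts σ)]
  abel

theorem omegaCan_T2 [GradedAlgebra 𝒜] (h𝒜 : GradedComm 𝒜) (hU : IsOpen U)
    (hπ : IsTwistedPoisson U π H) {Φ V W : BVField m 𝒢} (h : Φ ∈ bvFields 𝒜 U)
    (hV : IsTangent 𝒜 V) (hW : IsTangent 𝒜 W) :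
    omegaCan 𝒜 (fieldTangent (T2 𝒜 π H) Φ V) (fieldTangent (T2 𝒜 π H) Φ W)
      = omegaCan 𝒜 V W := by
  rw [fieldTangent_T2 h𝒜 hU hπ h hV, fieldTangent_T2 h𝒜 hU hπ h hW, omegaCan, omegaCan]
  congr 1
  exact funext (canDensity_T2 h𝒜 hU hπ h hV hW)

end SymplecticInvariance

section Hamiltonian

variable {m : ℕ} {𝒢 : Type*} [NormedRing 𝒢] [NormedAlgebra ℝ 𝒢] {𝒜 : ℤ → Submodule ℝ 𝒢}
  {U : Set (Fin m → ℝ)} {π : (Fin m → ℝ) → Fin m → Fin m → ℝ}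
  {H : (Fin m → ℝ) → Fin m → Fin m → Fin m → ℝ}

/-- The contraction of the Darboux form with `hamLam` is the first variation of the density
of `Λ`. -/
theorem canDensity_hamLam [GradedAlgebra 𝒜] (h𝒜 : GradedComm 𝒜) (hπ : IsTwistedPoisson U π H)
    {Φ W : BVField m 𝒢} {σ : ℝ × ℝ} (hx : Φ.X σ ∈ U) (hΦ : HasGhosts 𝒜 Φ.toSigmaField σ)
    (hW : HasGhosts 𝒜 W.toSigmaField σ) :
    canDensity 𝒜 (hamLam π H Φ).toSigmaField W.toSigmaField σ
      = (1 / 2 : ℝ) • ∑ j, ∑ k, ∑ l, (1 : ℝ) • (Theta π H j k l (Φ.X σ)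
          • ((W.Ap0 σ k * Φ.Ap1 σ l + Φ.Ap0 σ k * W.Ap1 σ l) * Φ.c σ j
            + Φ.Ap0 σ k * Φ.Ap1 σ l * W.c σ j)
          + dirPd (Theta π H j k l) (Φ.X σ) (W.X σ) • (Φ.Ap0 σ k * Φ.Ap1 σ l * Φ.c σ j)) := by
  have hXp : ∑ i, W.X σ i • (hamLam π H Φ).Xp σ i = ∑ j, ∑ k, ∑ l,
      (-(1 / 2) : ℝ) • dirPd (Theta π H j k l) (Φ.X σ) (W.X σ)
        • (Φ.Ap0 σ k * Φ.Ap1 σ l * Φ.c σ j) := by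
    simp only [hamLam, smul_neg, Finset.smul_sum, ← Finset.sum_neg_distrib]
    rw [sum_move3]
    refine Finset.sum_congr rfl fun j _ => Finset.sum_congr rfl fun k _ =>
      Finset.sum_congr rfl fun l _ => ?_
    rw [dirPd, Finset.sum_smul, Finset.smul_sum]
    exact Finset.sum_congr rfl fun i _ => by module
  have hcp : ∑ i, (hamLam π H Φ).cp σ i * W.c σ i = ∑ j, ∑ k, ∑ l,
      (-(1 / 2) : ℝ) • Theta π H j k l (Φ.X σ) • (Φ.Ap0 σ k * Φ.Ap1 σ l * W.c σ j) := by
    simp only [hamLam, neg_mul, Finset.sum_mul, ← Finset.sum_neg_distrib]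
    refine Finset.sum_congr rfl fun j _ => Finset.sum_congr rfl fun k _ =>
      Finset.sum_congr rfl fun l _ => ?_
    simp only [smul_mul_assoc]
    module
  have hA0 : ∑ i, W.Ap1 σ i * (hamLam π H Φ).A0 σ i = ∑ j, ∑ k, ∑ l,
      (1 / 2 : ℝ) • Theta π H j k l (Φ.X σ) • (W.Ap1 σ l * (Φ.Ap0 σ k * Φ.c σ j)) := by
    simp only [hamLam, Finset.mul_sum]
    rw [sum_move2]
    refine Finset.sum_congr rfl fun j _ => Finset.sum_congr rfl fun k _ =>
      Finset.sum_congr rfl fun l _ => ?_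
    simp only [mul_smul_comm, mul_smul]
  have hA1 : ∑ i, W.Ap0 σ i * (hamLam π H Φ).A1 σ i = ∑ j, ∑ k, ∑ l,
      (1 / 2 : ℝ) • Theta π H j k l (Φ.X σ) • (W.Ap0 σ k * (Φ.Ap1 σ l * Φ.c σ j)) := by
    simp only [hamLam, mul_neg, Finset.mul_sum, ← Finset.sum_neg_distrib]
    rw [Finset.sum_comm]
    refine Finset.sum_congr rfl fun j _ => Finset.sum_congr rfl fun k _ =>
      Finset.sum_congr rfl fun l _ => ?_
    rw [hπ.Theta_anti hx j l k]
    simp only [mul_smul_comm]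
    module
  have e0 : (hamLam π H Φ).X = 0 := rfl
  have e1 : (hamLam π H Φ).Ap0 = 0 := rfl
  have e2 : (hamLam π H Φ).Ap1 = 0 := rfl
  have e3 : (hamLam π H Φ).c = 0 := rfl
  rw [canDensity_eq (by rw [e1]; exact fun _ => zero_mem _) (by rw [e2]; exact fun _ => zero_mem _)
    hW.Ap0 hW.Ap1]
  simp only [pairing, e0, e1, e2, e3, Pi.zero_apply, zero_smul, zero_mul, mul_zero, zero_sub,
    sub_zero, add_zero, Finset.sum_add_distrib, Finset.sum_sub_distrib, Finset.sum_neg_distrib,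
    hXp, hcp, hA0, hA1]
  simp only [Finset.smul_sum, ← Finset.sum_neg_distrib, ← Finset.sum_sub_distrib,
    ← Finset.sum_add_distrib]
  refine Finset.sum_congr rfl fun j _ => Finset.sum_congr rfl fun k _ =>
    Finset.sum_congr rfl fun l _ => ?_
  have swap : ∀ z, W.Ap1 σ l * (Φ.Ap0 σ k * z) = -(Φ.Ap0 σ k * (W.Ap1 σ l * z)) := fun z => by
    rw [← mul_assoc, h𝒜.anticomm_of_odd (by decide) (hW.Ap1 l) (hΦ.Ap0 k), neg_mul, mul_assoc]
  simp only [add_mul, mul_assoc, swap]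
  module

theorem hasDerivAt_Lam [GradedAlgebra 𝒜] (h𝒜 : GradedComm 𝒜) (hU : IsOpen U)
    (hπ : IsTwistedPoisson U π H) {Φ W : BVField m 𝒢} (h : Φ ∈ bvFields 𝒜 U)
    (hW : IsTangent 𝒜 W) :
    HasDerivAt (fun s : ℝ => Lam π H (Φ + s • W)) (omegaCan 𝒜 (hamLam π H Φ) W) 0 := by
  have hx := X_mem h
  set F : ℝ × (ℝ × ℝ) → 𝒢 := fun p => (1 / 2 : ℝ) • ∑ i, ∑ j, ∑ k,
    ((1 : ℝ) * Theta π H i j k (Φ.X p.2 + p.1 • W.X p.2))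
      • ((Φ.Ap0 p.2 j + p.1 • W.Ap0 p.2 j) * (Φ.Ap1 p.2 k + p.1 • W.Ap1 p.2 k)
        * (Φ.c p.2 i + p.1 • W.c p.2 i)) with hF
  -- Off `U` nothing is known about `Θ`, so smoothness holds only on the open set `O`, which
  -- contains the slice `s = 0`.
  set O : Set (ℝ × (ℝ × ℝ)) := {p | Φ.X p.2 + p.1 • W.X p.2 ∈ U} with hOdef
  have hline : ∀ {a v : ℝ × ℝ → Fin m → 𝒢},
      ContDiff ℝ ∞ a → ContDiff ℝ ∞ v →
      ContDiff ℝ ∞ fun p : ℝ × (ℝ × ℝ) => a p.2 + p.1 • v p.2 := fun ha hv =>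
    (ha.comp contDiff_snd).add (contDiff_fst.smul (hv.comp contDiff_snd))
  have hXl : ContDiff ℝ ∞ fun p : ℝ × (ℝ × ℝ) => Φ.X p.2 + p.1 • W.X p.2 :=
    (h.1.X_smooth.comp contDiff_snd).add (contDiff_fst.smul (hW.X_smooth.comp contDiff_snd))
  have hO : IsOpen O := hU.preimage hXl.continuous
  have hFs : ContDiffOn ℝ ∞ F O := by
    refine ContDiffOn.const_smul (1 / 2 : ℝ) (ContDiffOn.sum fun i _ => ContDiffOn.sum fun j _ =>
      ContDiffOn.sum fun k _ => ?_)
    refine (contDiffOn_const.mul ((hπ.Theta_smooth i j k).comp hXl.contDiffOn fun p hp => hp)).smul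
      (ContDiff.contDiffOn ?_)
    exact ((contDiff_pi.1 (hline h.1.Ap0.smooth hW.Ap0.smooth) j).mul
      (contDiff_pi.1 (hline h.1.Ap1.smooth hW.Ap1.smooth) k)).mul
      (contDiff_pi.1 (hline h.1.c.smooth hW.c.smooth) i)
  have key := hasDerivAt_intSigma hO (hFs.of_le (by norm_num)) (fun σ => by simpa [O] using hx σ)
    (f' := fun σ => canDensity 𝒜 (hamLam π H Φ).toSigmaField W.toSigmaField σ) fun σ => by
      rw [canDensity_hamLam h𝒜 hπ (hx σ) (h.1.hasGhosts σ) (hW.hasGhosts σ)]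
      exact (HasDerivAt.fun_sum (u := Finset.univ) fun i _ =>
        HasDerivAt.fun_sum (u := Finset.univ) fun j _ =>
        HasDerivAt.fun_sum (u := Finset.univ) fun k _ =>
        hasDerivAt_smul_mul_mul_line 1
          (((hπ.Theta_smooth i j k).contDiffAt (hU.mem_nhds (hx σ))).differentiableAt
            (by norm_num)) (W.X σ) (Φ.Ap0 σ j) (W.Ap0 σ j) (Φ.Ap1 σ k) (W.Ap1 σ k) (Φ.c σ i)
          (W.c σ i)).const_smul (1 / 2 : ℝ)
  have e : (fun s : ℝ => Lam π H (Φ + s • W)) = fun s => intSigma fun σ => F (s, σ) := by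
    funext s
    simp [Lam, F]
  rw [e]
  exact key

theorem isHamiltonianVF_hamLam [GradedAlgebra 𝒜] (h𝒜 : GradedComm 𝒜) (hU : IsOpen U)
    (hπ : IsTwistedPoisson U π H) : IsHamiltonianVF 𝒜 U (hamLam π H) (Lam π H) := fun _ h =>
  ⟨isTangent_hamLam hU hπ.Theta_smooth h, fun _ hW => hasDerivAt_Lam h𝒜 hU hπ h hW⟩

end Hamiltonian

/-! ### The Grigoriev-Damgaard form in Darboux coordinates -/

section DarbouxForm

variable {m : ℕ} {𝒢 : Type*} [NormedRing 𝒢] [NormedAlgebra ℝ 𝒢] {𝒜 : ℤ → Submodule ℝ 𝒢}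
  {U : Set (Fin m → ℝ)} {π : (Fin m → ℝ) → Fin m → Fin m → ℝ}
  {H : (Fin m → ℝ) → Fin m → Fin m → Fin m → ℝ}

theorem hasDerivAt_mul_smul_line {f : (Fin m → ℝ) → ℝ} {x : Fin m → ℝ}
    (hf : DifferentiableAt ℝ f x) (v : Fin m → ℝ) (p p' : ℝ) (a a' : 𝒢) :
    HasDerivAt (fun s : ℝ => (f (x + s • v) * (p + s • p')) • (a + s • a'))
      ((f x * p) • a' + (dirPd f x v * p + f x * p') • a) 0 := by
  have := ((hasDerivAt_comp_line hf v).fun_mul (hasDerivAt_line p p')).fun_smul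
    (hasDerivAt_line a a')
  simpa using this

variable (H) in
/-- The derivative of the vector field `darbouxShift` at `Φ` in the direction of the tangent
vector `V`. -/
def darbouxShiftDeriv (Φ V : BVField m 𝒢) : BVField m 𝒢 :=
  { X := 0, c := 0, A0 := 0, A1 := 0, Ap0 := 0, Ap1 := 0, cp := 0, XN := 0
    Xp := fun σ i => ∑ j, ∑ k, ((H (Φ.X σ) i j k * fderiv ℝ Φ.X σ (0, 1) j) • V.Ap0 σ k
      + (dirPd (fun x => H x i j k) (Φ.X σ) (V.X σ) * fderiv ℝ Φ.X σ (0, 1) j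
        + H (Φ.X σ) i j k * fderiv ℝ V.X σ (0, 1) j) • Φ.Ap0 σ k) }

theorem fieldTangent_T1 [GradedAlgebra 𝒜] (hU : IsOpen U) (hπ : IsTwistedPoisson U π H)
    {Φ V : BVField m 𝒢} (h : Φ ∈ bvFields 𝒜 U) (hV : IsTangent 𝒜 V) :
    fieldTangent (T1 𝒜 H) Φ V = V + (1 : ℝ) • darbouxShiftDeriv H Φ V := by
  -- The formula for `T1` needs `H` to be antisymmetric at `X`, hence `X` in `U`; along the line
  -- `Φ + s • V` this is known only for small `s`, which depend on the point `σ`.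
  have hU' : ∀ σ, ∀ᶠ s : ℝ in nhds 0, (Φ + s • V).X σ ∈ U := fun σ => by
    have hc : Continuous fun s : ℝ => (Φ + s • V).X σ := by
      show Continuous fun s : ℝ => Φ.X σ + s • V.X σ
      fun_prop
    exact hc.continuousAt.eventually_mem (hU.mem_nhds (by simpa using X_mem h σ))
  have hA : ∀ σ i, ∀ᶠ s : ℝ in nhds 0, primA 𝒜 H (Φ + s • V).toSigmaField i σ
      = SA 𝒜 (Φ + s • V).toSigmaField i σ + ⟨0, 0, 0, ∑ j, ∑ k,
        (H ((Φ + s • V).X σ) i j k * fderiv ℝ (Φ + s • V).X σ (0, 1) j)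
          • (Φ + s • V).Ap0 σ k⟩ := fun σ i => by
    filter_upwards [hU' σ] with s hs
    have hs' := h.1.add_smul hV s
    exact primA_eq (hs'.hasGhosts σ) (hs'.X_differentiable σ)
      (hπ.H_anti_right _ hs) i
  apply BVField.ext
  case X =>
    funext σ i
    exact (hasDerivAt_line (Φ.X σ i) (V.X σ i)).deriv.trans
      (show V.X σ i = V.X σ i + (1 : ℝ) • (0 : ℝ) by simp)
  case XN =>
    funext σ i
    exact (hasDerivAt_line (Φ.XN σ i) (V.XN σ i)).deriv.trans
      (show V.XN σ i = V.XN σ i + (1 : ℝ) • (0 : ℝ) by simp)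
  case cp =>
    funext σ i
    exact (hasDerivAt_line (Φ.cp σ i) (V.cp σ i)).deriv.trans
      (show V.cp σ i = V.cp σ i + (1 : ℝ) • (0 : 𝒢) by simp)
  case Ap0 =>
    funext σ i
    have e : (fun s : ℝ => (T1 𝒜 H (Φ + s • V)).Ap0 σ i) = fun s => Φ.Ap0 σ i + s • V.Ap0 σ i :=
      funext fun s => neg_neg _
    exact (congrArg (fun f => deriv f 0) e).trans ((hasDerivAt_line _ _).deriv.trans
      (show V.Ap0 σ i = V.Ap0 σ i + (1 : ℝ) • (0 : 𝒢) by simp))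
  case Ap1 =>
    funext σ i
    have e : (fun s : ℝ => (T1 𝒜 H (Φ + s • V)).Ap1 σ i) = fun s => Φ.Ap1 σ i + s • V.Ap1 σ i :=
      funext fun s => neg_neg _
    exact (congrArg (fun f => deriv f 0) e).trans ((hasDerivAt_line _ _).deriv.trans
      (show V.Ap1 σ i = V.Ap1 σ i + (1 : ℝ) • (0 : 𝒢) by simp))
  case c =>
    funext σ i
    have e : (fun s : ℝ => (T1 𝒜 H (Φ + s • V)).c σ i)
        =ᶠ[nhds 0] fun s => Φ.c σ i + s • V.c σ i := by
      filter_upwards [hA σ i] with s hs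
      simp [T1, ofSuper, hs, SA]
    exact e.deriv_eq.trans ((hasDerivAt_line _ _).deriv.trans
      (show V.c σ i = V.c σ i + (1 : ℝ) • (0 : 𝒢) by simp))
  case A0 =>
    funext σ i
    have e : (fun s : ℝ => (T1 𝒜 H (Φ + s • V)).A0 σ i)
        =ᶠ[nhds 0] fun s => Φ.A0 σ i + s • V.A0 σ i := by
      filter_upwards [hA σ i] with s hs
      simp [T1, ofSuper, hs, SA]
    exact e.deriv_eq.trans ((hasDerivAt_line _ _).deriv.trans
      (show V.A0 σ i = V.A0 σ i + (1 : ℝ) • (0 : 𝒢) by simp))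
  case A1 =>
    funext σ i
    have e : (fun s : ℝ => (T1 𝒜 H (Φ + s • V)).A1 σ i)
        =ᶠ[nhds 0] fun s => Φ.A1 σ i + s • V.A1 σ i := by
      filter_upwards [hA σ i] with s hs
      simp [T1, ofSuper, hs, SA]
    exact e.deriv_eq.trans ((hasDerivAt_line _ _).deriv.trans
      (show V.A1 σ i = V.A1 σ i + (1 : ℝ) • (0 : 𝒢) by simp))
  case Xp =>
    funext σ i
    have hfd : ∀ s : ℝ, ∀ j, fderiv ℝ (Φ + s • V).X σ (0, 1) j
        = fderiv ℝ Φ.X σ (0, 1) j + s • fderiv ℝ V.X σ (0, 1) j := fun s j => by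
      have : fderiv ℝ (Φ + s • V).X σ = fderiv ℝ Φ.X σ + s • fderiv ℝ V.X σ :=
        ((h.1.X_differentiable σ).hasFDerivAt.add
          ((hV.X_differentiable σ).hasFDerivAt.const_smul s)).fderiv
      rw [this]
      rfl
    have e : (fun s : ℝ => (T1 𝒜 H (Φ + s • V)).Xp σ i)
        =ᶠ[nhds 0] fun s => (Φ.Xp σ i + s • V.Xp σ i) + ∑ j, ∑ k,
          (H (Φ.X σ + s • V.X σ) i j k
            * (fderiv ℝ Φ.X σ (0, 1) j + s • fderiv ℝ V.X σ (0, 1) j))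
            • (Φ.Ap0 σ k + s • V.Ap0 σ k) := by
      filter_upwards [hA σ i] with s hs
      simp only [T1, ofSuper, hs, SA, hfd]
      rfl
    have key := (hasDerivAt_line (Φ.Xp σ i) (V.Xp σ i)).fun_add
      (HasDerivAt.fun_sum (u := Finset.univ) fun j _ =>
        HasDerivAt.fun_sum (u := Finset.univ) fun k _ =>
        hasDerivAt_mul_smul_line (((hπ.H_smooth i j k).contDiffAt
          (hU.mem_nhds (X_mem h σ))).differentiableAt (by norm_num)) (V.X σ)
          (fderiv ℝ Φ.X σ (0, 1) j) (fderiv ℝ V.X σ (0, 1) j) (Φ.Ap0 σ k) (V.Ap0 σ k))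
    refine e.deriv_eq.trans (key.deriv.trans ?_)
    simp [darbouxShiftDeriv]

/-- The integrand of the part of the Grigoriev-Damgaard form that involves `H`. -/
theorem berezin_gdForm [GradedAlgebra 𝒜] {Φ V W : BVField m 𝒢} (h : IsTangent 𝒜 Φ)
    (hV : IsTangent 𝒜 V) (hW : IsTangent 𝒜 W) (σ : ℝ × ℝ) :
    berezin (∑ i, ∑ j, ∑ k, atX 𝒜 (fun x => H x i j k) Φ.toSigmaField σ
        * d1 (SX 𝒜 Φ.toSigmaField i) σ * dSX 𝒜 V.toSigmaField j σ * dSX 𝒜 W.toSigmaField k σ)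
      = -(∑ i, ∑ j, ∑ k, (H (Φ.X σ) i j k * V.X σ j * W.X σ k)
            • fderiv ℝ (fun s => Φ.Ap0 s i) σ (0, 1)
        + ∑ i, ∑ j, ∑ k, ∑ a, (pd a (fun x => H x i j k) (Φ.X σ) * fderiv ℝ Φ.X σ (0, 1) i
            * V.X σ j * W.X σ k) • Φ.Ap0 σ a
        + ∑ i, ∑ j, ∑ k, (H (Φ.X σ) i j k * fderiv ℝ Φ.X σ (0, 1) i * W.X σ k) • V.Ap0 σ j
        + ∑ i, ∑ j, ∑ k, (H (Φ.X σ) i j k * fderiv ℝ Φ.X σ (0, 1) i * V.X σ j) • W.Ap0 σ k) := by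
  have hp := (h.hasGhosts σ).parityRules
  have hpV := (hV.hasGhosts σ).parityRules
  have hpW := (hW.hasGhosts σ).parityRules
  simp only [berezin, SuperFun.sum_t10, ← Finset.sum_add_distrib, ← Finset.sum_neg_distrib]
  refine Finset.sum_congr rfl fun i _ => Finset.sum_congr rfl fun j _ =>
    Finset.sum_congr rfl fun k _ => ?_
  have e : ∀ a, (pd a (fun x => H x i j k) (Φ.X σ) * fderiv ℝ Φ.X σ (0, 1) i
      * V.X σ j * W.X σ k) • Φ.Ap0 σ a = (fderiv ℝ Φ.X σ (0, 1) i * V.X σ j * W.X σ k) •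
        (pd a (fun x => H x i j k) (Φ.X σ) • Φ.Ap0 σ a) := fun a => by
    rw [smul_smul]; congr 1; ring
  simp only [e, ← Finset.smul_sum]
  simp [d1_SX (h.X_differentiable σ), dSX, SX, parity_one, hp.Ap0,
    Algebra.algebraMap_eq_smul_one]
  module

theorem pairing_add_darbouxShiftDeriv (Φ V W : BVField m 𝒢) (σ : ℝ × ℝ) :
    pairing (V + (1 : ℝ) • darbouxShiftDeriv H Φ V).toSigmaField
        (W + (1 : ℝ) • darbouxShiftDeriv H Φ W).toSigmaField σ
      = pairing V.toSigmaField W.toSigmaField σ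
        + ∑ i, V.X σ i • (darbouxShiftDeriv H Φ W).Xp σ i := by
  simp only [pairing, ← Finset.sum_add_distrib]
  refine Finset.sum_congr rfl fun i _ => ?_
  simp [darbouxShiftDeriv]
  abel

variable (H) in
/-- The function `H_{ijk}(X) δX^i(V) δX^j(W) A₀^{+k}` on the world sheet, whose derivative along
`σ¹` is the difference of the two symplectic densities. -/
def gdPotential (Φ V W : SigmaField m 𝒢) (σ : ℝ × ℝ) : 𝒢 :=
  ∑ i, ∑ j, ∑ k, (H (Φ.X σ) i j k * V.X σ i * W.X σ j) • Φ.Ap0 σ k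

theorem contDiff_gdPotential (hπ : IsTwistedPoisson U π H) {Φ V W : BVField m 𝒢}
    (h : Φ ∈ bvFields 𝒜 U) (hV : IsTangent 𝒜 V) (hW : IsTangent 𝒜 W) :
    ContDiff ℝ ∞ (gdPotential H Φ.toSigmaField V.toSigmaField W.toSigmaField) :=
  ContDiff.sum fun i _ => ContDiff.sum fun j _ => ContDiff.sum fun k _ =>
    (((contDiff_comp_X h (hπ.H_smooth i j k)).mul (contDiff_pi.1 hV.X_smooth i)).mul
      (contDiff_pi.1 hW.X_smooth j)).smul (h.1.Ap0.contDiff_apply k)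

theorem fderiv_gdPotential (hU : IsOpen U) (hπ : IsTwistedPoisson U π H) {Φ V W : BVField m 𝒢}
    (h : Φ ∈ bvFields 𝒜 U) (hV : IsTangent 𝒜 V) (hW : IsTangent 𝒜 W) (σ u : ℝ × ℝ) :
    fderiv ℝ (gdPotential H Φ.toSigmaField V.toSigmaField W.toSigmaField) σ u
      = ∑ i, ∑ j, ∑ k, ((H (Φ.X σ) i j k * V.X σ i * W.X σ j) • fderiv ℝ (fun s => Φ.Ap0 s k) σ u
        + (dirPd (fun x => H x i j k) (Φ.X σ) (fderiv ℝ Φ.X σ u) * V.X σ i * W.X σ j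
          + H (Φ.X σ) i j k * fderiv ℝ V.X σ u i * W.X σ j
          + H (Φ.X σ) i j k * V.X σ i * fderiv ℝ W.X σ u j) • Φ.Ap0 σ k) := by
  have hX := (h.1.X_differentiable σ).hasFDerivAt
  have hc : ∀ {Z : BVField m 𝒢}, IsTangent 𝒜 Z → ∀ i, HasFDerivAt (fun s => Z.X s i)
      ((ContinuousLinearMap.proj i).comp (fderiv ℝ Z.X σ)) σ := fun hZ i =>
    hasFDerivAt_pi'.1 (hZ.X_differentiable σ).hasFDerivAt i
  have hA : ∀ k, HasFDerivAt (fun s => Φ.Ap0 s k) (fderiv ℝ (fun s => Φ.Ap0 s k) σ) σ := fun k =>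
    ((h.1.Ap0.contDiff_apply k).differentiable (by norm_num) σ).hasFDerivAt
  have hH : ∀ i j k, HasFDerivAt (fun s => H (Φ.X s) i j k)
      ((fderiv ℝ (fun x => H x i j k) (Φ.X σ)).comp (fderiv ℝ Φ.X σ)) σ := fun i j k =>
    HasFDerivAt.comp (g := fun x => H x i j k) σ (((hπ.H_smooth i j k).contDiffAt
      (hU.mem_nhds (X_mem h σ))).differentiableAt (by norm_num)).hasFDerivAt hX
  have key := HasFDerivAt.fun_sum (u := Finset.univ) fun i (_ : i ∈ Finset.univ) =>
    HasFDerivAt.fun_sum (u := Finset.univ) fun j (_ : j ∈ Finset.univ) =>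
    HasFDerivAt.fun_sum (u := Finset.univ) fun k (_ : k ∈ Finset.univ) =>
      (((hH i j k).fun_mul (hc hV i)).fun_mul (hc hW j)).fun_smul (hA k)
  have e : fderiv ℝ (gdPotential H Φ.toSigmaField V.toSigmaField W.toSigmaField) σ = _ :=
    key.fderiv
  rw [e]
  simp only [sum_apply]
  refine Finset.sum_congr rfl fun i _ => Finset.sum_congr rfl fun j _ =>
    Finset.sum_congr rfl fun k _ => ?_
  simp [fderiv_eq_dirPd]
  module

/-- Closedness of `H` contracted with four vectors, the last of them with values in a module. -/
theorem sum_closed {E : Type*} [AddCommGroup E] [Module ℝ E]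
    {dH : Fin m → Fin m → Fin m → Fin m → ℝ}
    (hclosed : ∀ i j k l, dH l i j k - dH i l j k + dH j l i k - dH k l i j = 0)
    (hl : ∀ a i j k, dH a i j k = -dH a j i k) (hr : ∀ a i j k, dH a i j k = -dH a i k j)
    (v w x : Fin m → ℝ) (p : Fin m → E) :
    ∑ i, ∑ j, ∑ k, ∑ l, (dH l i j k * w l * v i * x j) • p k
      - ∑ i, ∑ j, ∑ k, ∑ l, (dH l i j k * v l * w i * x j) • p k
      + ∑ i, ∑ j, ∑ k, ∑ a, (dH a i j k * x i * v j * w k) • p a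
      = ∑ i, ∑ j, ∑ k, ∑ a, (dH a i j k * x a * v i * w j) • p k := by
  have e2 : ∑ i, ∑ j, ∑ k, ∑ l, (dH l i j k * v l * w i * x j) • p k
      = ∑ i, ∑ j, ∑ k, ∑ l, (dH i l j k * v i * w l * x j) • p k := by
    rw [sum_move3, ← sum_move2]
  have e3 : ∑ i, ∑ j, ∑ k, ∑ a, (dH a i j k * x a * v i * w j) • p k
      = ∑ i, ∑ j, ∑ k, ∑ l, (dH j i l k * x j * v i * w l) • p k := by
    refine Finset.sum_congr rfl fun i _ => ?_
    rw [sum_move2, Finset.sum_comm]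
  have e4 : ∑ i, ∑ j, ∑ k, ∑ a, (dH a i j k * x i * v j * w k) • p a
      = ∑ i, ∑ j, ∑ k, ∑ l, (dH k j i l * x j * v i * w l) • p k := by
    rw [Finset.sum_comm]
    exact Finset.sum_congr rfl fun i _ => Finset.sum_congr rfl fun j _ => Finset.sum_comm
  rw [e2, e3, e4]
  simp only [← Finset.sum_sub_distrib, ← Finset.sum_add_distrib, ← sub_smul, ← add_smul]
  refine Finset.sum_congr rfl fun i _ => Finset.sum_congr rfl fun j _ =>
    Finset.sum_congr rfl fun k _ => Finset.sum_congr rfl fun l _ => ?_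
  congr 1
  have h1 := hclosed i j k l
  have h2 : dH j l i k = -dH j i l k := hl j l i k
  have h3 : dH k l i j = -dH k j i l := by rw [hr k l i j, hl k l j i, hr k j l i]; ring
  rw [h2, h3] at h1
  linear_combination (v i * w l * x j) * h1

/-- The difference of the symplectic densities is a total derivative, because `H` is closed. -/
theorem sum_darbouxShiftDeriv_sub [GradedAlgebra 𝒜] (hU : IsOpen U) (hπ : IsTwistedPoisson U π H)
    {Φ V W : BVField m 𝒢} (h : Φ ∈ bvFields 𝒜 U) (hV : IsTangent 𝒜 V) (hW : IsTangent 𝒜 W)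
    (σ : ℝ × ℝ) :
    ∑ i, V.X σ i • (darbouxShiftDeriv H Φ W).Xp σ i
        - ∑ i, W.X σ i • (darbouxShiftDeriv H Φ V).Xp σ i
      = berezin (∑ i, ∑ j, ∑ k, atX 𝒜 (fun x => H x i j k) Φ.toSigmaField σ
          * d1 (SX 𝒜 Φ.toSigmaField i) σ * dSX 𝒜 V.toSigmaField j σ * dSX 𝒜 W.toSigmaField k σ)
        + fderiv ℝ (gdPotential H Φ.toSigmaField V.toSigmaField W.toSigmaField) σ (0, 1) := by
  have hx := X_mem h σ
  rw [berezin_gdForm h.1 hV hW, fderiv_gdPotential hU hπ h hV hW]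
  set x1 : Fin m → ℝ := fderiv ℝ Φ.X σ (0, 1)
  set v1 : Fin m → ℝ := fderiv ℝ V.X σ (0, 1)
  set w1 : Fin m → ℝ := fderiv ℝ W.X σ (0, 1)
  set v := V.X σ
  set w := W.X σ
  have hl := hπ.H_anti_left _ hx
  have hr := hπ.H_anti_right _ hx
  have hcyc : ∀ i j k, H (Φ.X σ) i j k = H (Φ.X σ) j k i := fun i j k => by
    rw [hl i j k, hr j i k, neg_neg]
  have eD : ∑ i, ∑ j, ∑ k, (H (Φ.X σ) i j k * v j * w k) • fderiv ℝ (fun s => Φ.Ap0 s i) σ (0, 1)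
      = ∑ i, ∑ j, ∑ k, (H (Φ.X σ) i j k * v i * w j) • fderiv ℝ (fun s => Φ.Ap0 s k) σ (0, 1) := by
    rw [sum_move2]
    exact Finset.sum_congr rfl fun i _ => Finset.sum_congr rfl fun j _ =>
      Finset.sum_congr rfl fun k _ => by rw [hcyc k i j]
  have eV : ∑ i, ∑ j, ∑ k, (H (Φ.X σ) i j k * x1 i * w k) • V.Ap0 σ j
      = ∑ i, ∑ j, ∑ k, (w i * (H (Φ.X σ) i j k * x1 j)) • V.Ap0 σ k := by
    rw [← sum_move2]
    exact Finset.sum_congr rfl fun i _ => Finset.sum_congr rfl fun j _ =>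
      Finset.sum_congr rfl fun k _ => by rw [← hcyc i j k]; congr 1; ring
  have eW : ∑ i, ∑ j, ∑ k, (H (Φ.X σ) i j k * x1 i * v j) • W.Ap0 σ k
      = -∑ i, ∑ j, ∑ k, (v i * (H (Φ.X σ) i j k * x1 j)) • W.Ap0 σ k := by
    rw [Finset.sum_comm]
    simp only [← Finset.sum_neg_distrib]
    exact Finset.sum_congr rfl fun i _ => Finset.sum_congr rfl fun j _ =>
      Finset.sum_congr rfl fun k _ => by rw [hl j i k, ← neg_smul]; congr 1; ring
  have e1 : ∑ i, ∑ j, ∑ k, (w i * (H (Φ.X σ) i j k * v1 j)) • Φ.Ap0 σ k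
      = -∑ i, ∑ j, ∑ k, (H (Φ.X σ) i j k * v1 i * w j) • Φ.Ap0 σ k := by
    rw [Finset.sum_comm]
    simp only [← Finset.sum_neg_distrib]
    exact Finset.sum_congr rfl fun i _ => Finset.sum_congr rfl fun j _ =>
      Finset.sum_congr rfl fun k _ => by rw [hl j i k, ← neg_smul]; congr 1; ring
  have hcl := sum_closed (dH := fun a i j k => pd a (fun x => H x i j k) (Φ.X σ))
    (hπ.H_closed _ hx)
    (fun a i j k => pd_eq_neg_of_eqOn hU (fun y hy => hπ.H_anti_left y hy i j k) hx a)
    (fun a i j k => pd_eq_neg_of_eqOn hU (fun y hy => hπ.H_anti_right y hy i j k) hx a)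
    v w x1 (Φ.Ap0 σ)
  have eL : ∀ (Z : BVField m 𝒢) (u z z1 : Fin m → ℝ), Z.X σ = z → fderiv ℝ Z.X σ (0, 1) = z1 →
      ∑ i, u i • (darbouxShiftDeriv H Φ Z).Xp σ i
      = ∑ i, ∑ j, ∑ k, (u i * (H (Φ.X σ) i j k * x1 j)) • Z.Ap0 σ k
        + ∑ i, ∑ j, ∑ k, ∑ l, (pd l (fun x => H x i j k) (Φ.X σ) * z l * u i * x1 j) • Φ.Ap0 σ k
        + ∑ i, ∑ j, ∑ k, (u i * (H (Φ.X σ) i j k * z1 j)) • Φ.Ap0 σ k := by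
    rintro Z u _ _ rfl rfl
    simp only [darbouxShiftDeriv, Finset.smul_sum, ← Finset.sum_add_distrib]
    refine Finset.sum_congr rfl fun i _ => Finset.sum_congr rfl fun j _ =>
      Finset.sum_congr rfl fun k _ => ?_
    rw [← Finset.sum_smul, ← Finset.sum_mul, ← Finset.sum_mul]
    change _ = _ + (dirPd (fun x => H x i j k) (Φ.X σ) (Z.X σ) * u i * x1 j) • _ + _
    module
  have eG : ∑ i, ∑ j, ∑ k, (dirPd (fun x => H x i j k) (Φ.X σ) x1 * v i * w j) • Φ.Ap0 σ k
      = ∑ i, ∑ j, ∑ k, ∑ a, (pd a (fun x => H x i j k) (Φ.X σ) * x1 a * v i * w j)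
        • Φ.Ap0 σ k := by
    refine Finset.sum_congr rfl fun i _ => Finset.sum_congr rfl fun j _ =>
      Finset.sum_congr rfl fun k _ => ?_
    rw [← Finset.sum_smul]
    simp only [dirPd, Finset.sum_mul]
  have e2 : ∑ i, ∑ j, ∑ k, (v i * (H (Φ.X σ) i j k * w1 j)) • Φ.Ap0 σ k
      = ∑ i, ∑ j, ∑ k, (H (Φ.X σ) i j k * v i * w1 j) • Φ.Ap0 σ k := by
    exact Finset.sum_congr rfl fun i _ => Finset.sum_congr rfl fun j _ =>
      Finset.sum_congr rfl fun k _ => by congr 1; ring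
  rw [eL W v w w1 rfl rfl, eL V w v v1 rfl rfl, eD, eV, eW, e1]
  simp only [add_smul, Finset.sum_add_distrib]
  rw [eG, ← hcl, e2]
  abel

theorem continuous_canDensity [GradedAlgebra 𝒜] {V W : BVField m 𝒢} (hV : IsTangent 𝒜 V)
    (hW : IsTangent 𝒜 W) : Continuous (canDensity 𝒜 V.toSigmaField W.toSigmaField) := by
  have e : canDensity 𝒜 V.toSigmaField W.toSigmaField
      = fun σ => pairing V.toSigmaField W.toSigmaField σ
        - pairing W.toSigmaField V.toSigmaField σ :=
    funext fun σ => canDensity_eq (hV.Ap0.ghost σ) (hV.Ap1.ghost σ) (hW.Ap0.ghost σ)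
      (hW.Ap1.ghost σ)
  have hp : ∀ {V W : BVField m 𝒢}, IsTangent 𝒜 V → IsTangent 𝒜 W →
      Continuous (pairing V.toSigmaField W.toSigmaField) := fun {V W} hV hW => by
    have := hV.X_smooth.continuous
    have := hV.cp.smooth.continuous
    have := hV.Ap0.smooth.continuous
    have := hV.Ap1.smooth.continuous
    have := hW.Xp.smooth.continuous
    have := hW.c.smooth.continuous
    have := hW.A0.smooth.continuous
    have := hW.A1.smooth.continuous
    unfold pairing
    fun_prop
  rw [e]
  exact (hp hV hW).sub (hp hW hV)

theorem continuous_gdForm [GradedAlgebra 𝒜] (hU : IsOpen U) (hπ : IsTwistedPoisson U π H)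
    {Φ V W : BVField m 𝒢} (h : Φ ∈ bvFields 𝒜 U) (hV : IsTangent 𝒜 V) (hW : IsTangent 𝒜 W) :
    Continuous fun σ => berezin (∑ i, ∑ j, ∑ k, atX 𝒜 (fun x => H x i j k) Φ.toSigmaField σ
      * d1 (SX 𝒜 Φ.toSigmaField i) σ * dSX 𝒜 V.toSigmaField j σ * dSX 𝒜 W.toSigmaField k σ) := by
  simp only [berezin_gdForm h.1 hV hW]
  have hv := fun i => (contDiff_pi.1 hV.X_smooth i).continuous
  have hw := fun i => (contDiff_pi.1 hW.X_smooth i).continuous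
  have hp := fun i => (h.1.Ap0.contDiff_apply i).continuous
  have hvp := fun i => (hV.Ap0.contDiff_apply i).continuous
  have hwp := fun i => (hW.Ap0.contDiff_apply i).continuous
  have h1 := fun i => (contDiff_fderiv_X h.1 (0, 1) i).continuous
  have h2 : ∀ i, Continuous fun σ => fderiv ℝ (fun s => Φ.Ap0 s i) σ (0, 1) := fun i =>
    ((h.1.Ap0.contDiff_apply i).continuous_fderiv (by norm_num)).clm_apply continuous_const
  have h3 := fun i j k => (contDiff_comp_X h (hπ.H_smooth i j k)).continuous
  have h4 := fun a i j k => (contDiff_comp_X h (contDiffOn_pd hU (hπ.H_smooth i j k) a)).continuous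
  refine (((Continuous.add ?_ ?_).add ?_).add ?_).neg <;>
    refine continuous_finsetSum _ fun i _ => continuous_finsetSum _ fun j _ =>
      continuous_finsetSum _ fun k _ => ?_
  · exact (((h3 i j k).mul (hv j)).mul (hw k)).smul (h2 i)
  · exact continuous_finsetSum _ fun a _ =>
      ((((h4 a i j k).mul (h1 i)).mul (hv j)).mul (hw k)).smul (hp a)
  · exact (((h3 i j k).mul (h1 i)).mul (hw k)).smul (hvp j)
  · exact (((h3 i j k).mul (h1 i)).mul (hv j)).smul (hwp k)

/-- The Grigoriev-Damgaard form is the pullback of the Darboux form, the densities differing by the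
derivative of `gdPotential`, which integrates to zero. -/
theorem omegaCan_T1 [GradedAlgebra 𝒜] (hU : IsOpen U) (hπ : IsTwistedPoisson U π H)
    {Φ V W : BVField m 𝒢} (h : Φ ∈ bvFields 𝒜 U) (hV : IsTangent 𝒜 V) (hW : IsTangent 𝒜 W) :
    omegaCan 𝒜 (fieldTangent (T1 𝒜 H) Φ V) (fieldTangent (T1 𝒜 H) Φ W)
      = omegaGD 𝒜 H Φ V W := by
  rw [fieldTangent_T1 hU hπ h hV, fieldTangent_T1 hU hπ h hW, omegaGD, omegaCan, omegaCan]
  have e0 : ∀ Z : BVField m 𝒢, (Z + (1 : ℝ) • darbouxShiftDeriv H Φ Z).Ap0 = Z.Ap0 := fun Z => by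
    simp [darbouxShiftDeriv]
  have e1 : ∀ Z : BVField m 𝒢, (Z + (1 : ℝ) • darbouxShiftDeriv H Φ Z).Ap1 = Z.Ap1 := fun Z => by
    simp [darbouxShiftDeriv]
  have hG := contDiff_gdPotential hπ h hV hW
  have hGc : Continuous fun σ =>
      fderiv ℝ (gdPotential H Φ.toSigmaField V.toSigmaField W.toSigmaField) σ (0, 1) :=
    (hG.continuous_fderiv (by norm_num)).clm_apply continuous_const
  have hG0 : intSigma (fun σ =>
      fderiv ℝ (gdPotential H Φ.toSigmaField V.toSigmaField W.toSigmaField) σ (0, 1)) = 0 := by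
    have := intSigma_divergence (𝒢 := 𝒢) (f := fun _ => 0) contDiff_const hG (fun _ _ => rfl)
      (fun s t => by
        simp [gdPotential, h.1.X_periodic1, hV.X_periodic1, hW.X_periodic1, h.1.Ap0.periodic1])
    simpa using this
  have e : canDensity 𝒜 (V + (1 : ℝ) • darbouxShiftDeriv H Φ V).toSigmaField
        (W + (1 : ℝ) • darbouxShiftDeriv H Φ W).toSigmaField
      = fun σ => canDensity 𝒜 V.toSigmaField W.toSigmaField σ
        + (berezin (∑ i, ∑ j, ∑ k, atX 𝒜 (fun x => H x i j k) Φ.toSigmaField σ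
          * d1 (SX 𝒜 Φ.toSigmaField i) σ * dSX 𝒜 V.toSigmaField j σ * dSX 𝒜 W.toSigmaField k σ)
        + fderiv ℝ (gdPotential H Φ.toSigmaField V.toSigmaField W.toSigmaField) σ (0, 1)) := by
    funext σ
    rw [← sum_darbouxShiftDeriv_sub hU hπ h hV hW,
      canDensity_eq (by rw [e0]; exact hV.Ap0.ghost σ) (by rw [e1]; exact hV.Ap1.ghost σ)
      (by rw [e0]; exact hW.Ap0.ghost σ) (by rw [e1]; exact hW.Ap1.ghost σ),
      canDensity_eq (hV.Ap0.ghost σ) (hV.Ap1.ghost σ) (hW.Ap0.ghost σ) (hW.Ap1.ghost σ),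
      pairing_add_darbouxShiftDeriv, pairing_add_darbouxShiftDeriv]
    abel
  have hgd := continuous_gdForm hU hπ h hV hW
  rw [e, intSigma_add (continuous_canDensity hV hW) (hgd.fun_add hGc), intSigma_add hgd hGc, hG0,
    add_zero]

end DarbouxForm

/-! ### The covariant action in terms of component forms -/

section Forms

variable {m : ℕ} {𝒢 : Type*} [NormedRing 𝒢] [NormedAlgebra ℝ 𝒢] {𝒜 : ℤ → Submodule ℝ 𝒢}
  [GradedAlgebra 𝒜] {U : Set (Fin m → ℝ)} {π : (Fin m → ℝ) → Fin m → Fin m → ℝ}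
  {H : (Fin m → ℝ) → Fin m → Fin m → Fin m → ℝ}

theorem dd_formX {Φ : SigmaField m 𝒢} {σ : ℝ × ℝ} (hX : DifferentiableAt ℝ Φ.X σ) (i : Fin m) :
    dd (formX 𝒜 Φ i) σ = ⟨0, fderiv ℝ Φ.X σ (1, 0) i • 1, fderiv ℝ Φ.X σ (0, 1) i • 1, 0⟩ := by
  rw [dd, d0_comps, d1_comps]
  ext <;> simp [dirD, formX, fderiv_algebraMap_apply hX]

theorem dd_formC (Φ : SigmaField m 𝒢) (σ : ℝ × ℝ) (i : Fin m) :
    dd (formC 𝒜 Φ i) σ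
      = ⟨0, fderiv ℝ (fun s => Φ.c s i) σ (1, 0), fderiv ℝ (fun s => Φ.c s i) σ (0, 1), 0⟩ := by
  rw [dd, d0_comps, d1_comps]
  ext <;> simp [dirD, formC]

section Terms

variable {Φ : SigmaField m 𝒢} {σ : ℝ × ℝ}

theorem formA_mul_dd_formX (h : HasGhosts 𝒜 Φ σ) (hX : DifferentiableAt ℝ Φ.X σ) (i : Fin m) :
    (formA 𝒜 Φ i σ * dd (formX 𝒜 Φ i) σ).t10
      = fderiv ℝ Φ.X σ (1, 0) i • Φ.A1 σ i - fderiv ℝ Φ.X σ (0, 1) i • Φ.A0 σ i := by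
  have hp := h.parityRules
  simp [dd_formX hX, formA, hp.A0, hp.A1]

theorem formA_mul_formA (h𝒜 : GradedComm 𝒜) (h : HasGhosts 𝒜 Φ σ)
    (hanti : ∀ i j, π (Φ.X σ) i j = -π (Φ.X σ) j i) :
    ((1 / 2 : ℝ) • ∑ i, ∑ j, π (Φ.X σ) i j • (formA 𝒜 Φ i σ * formA 𝒜 Φ j σ)).t10
      = ∑ i, ∑ j, -(π (Φ.X σ) i j • (Φ.A0 σ i * Φ.A1 σ j)) := by
  have hp := h.parityRules
  have ho := h.orderRules h𝒜
  rw [← half_smul_sum_sum_eq (Z := fun i j => π (Φ.X σ) i j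
    • (Φ.A0 σ j * Φ.A1 σ i - Φ.A0 σ i * Φ.A1 σ j)) fun i j => by rw [hanti j i]; module]
  simp [formA, hp.A0, hp.A1, ho.A1_A0]

theorem formAp_mul (h : HasGhosts 𝒜 Φ σ) (s : SuperFun 𝒜) (i : Fin m) :
    (formAp 𝒜 Φ i σ * s).t10 = Φ.Ap0 σ i * s.t1 - Φ.Ap1 σ i * s.t0 := by
  have hp := h.parityRules
  simp [formAp, hp.Ap0, hp.Ap1]
  abel

theorem formAp_mul_formAp (h𝒜 : GradedComm 𝒜) (h : HasGhosts 𝒜 Φ σ) (i j k n : Fin m) :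
    (formAp 𝒜 Φ n σ * formAp 𝒜 Φ k σ * formC 𝒜 Φ i σ * formC 𝒜 Φ j σ).t10
      = Φ.Ap0 σ k * (Φ.Ap1 σ n * (Φ.c σ i * Φ.c σ j))
        + Φ.Ap0 σ n * (Φ.Ap1 σ k * (Φ.c σ i * Φ.c σ j)) := by
  have hp := h.parityRules
  have ho := h.orderRules h𝒜
  simp [formAp, formC, hp.Ap0, hp.Ap1, ho.Ap1_Ap0', mul_assoc]

end Terms

variable (𝒜 π H) in
/-- The integrand over `Σ` of the covariant action in terms of component forms. -/
def formsDensity (Φ : SigmaField m 𝒢) (σ : ℝ × ℝ) : 𝒢 :=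
  berezin (
      ∑ i, formA 𝒜 Φ i σ * dd (formX 𝒜 Φ i) σ
      + (1 / 2 : ℝ) • ∑ i, ∑ j, π (Φ.X σ) i j • (formA 𝒜 Φ i σ * formA 𝒜 Φ j σ)
      + ∑ i, formAp 𝒜 Φ i σ * (dd (formC 𝒜 Φ i) σ
          + ∑ j, ∑ k, pd i (fun x => π x j k) (Φ.X σ) • (formA 𝒜 Φ j σ * formC 𝒜 Φ k σ)
          + (1 / 2 : ℝ) • ∑ j, ∑ k, Theta π H k i j (Φ.X σ) •
              ((dd (formX 𝒜 Φ j) σ - ∑ a, π (Φ.X σ) j a • formA 𝒜 Φ a σ) * formC 𝒜 Φ k σ))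
      + ∑ i, ∑ j, π (Φ.X σ) j i • (formXp 𝒜 Φ i σ * formC 𝒜 Φ j σ)
      + (1 / 2 : ℝ) • ∑ i, ∑ j, ∑ k, (pd k (fun x => π x i j) (Φ.X σ) + piPiH π H i j k (Φ.X σ)) •
          (formCp 𝒜 Φ k σ * formC 𝒜 Φ i σ * formC 𝒜 Φ j σ)
      + (1 / 4 : ℝ) • ∑ i, ∑ j, ∑ k, ∑ n,
          (pd n (pd k (fun x => π x i j)) (Φ.X σ) + pd n (piPiH π H i j k) (Φ.X σ)) •
          (formAp 𝒜 Φ n σ * formAp 𝒜 Φ k σ * formC 𝒜 Φ i σ * formC 𝒜 Φ j σ)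
      + (1 / 8 : ℝ) • ∑ i, ∑ j, ∑ k, ∑ n,
          (∑ q, ∑ a, ∑ b, ∑ d, π (Φ.X σ) q i * π (Φ.X σ) j a * π (Φ.X σ) b d
            * H (Φ.X σ) n a b * H (Φ.X σ) k q d) •
          (formAp 𝒜 Φ n σ * formAp 𝒜 Φ k σ * formC 𝒜 Φ i σ * formC 𝒜 Φ j σ))

variable (𝒜 π H) in
theorem ScovForms_eq (Φ : BVField m 𝒢) :
    ScovForms 𝒜 π H Φ = intSigma (formsDensity 𝒜 π H Φ.toSigmaField) + wz 𝒢 H Φ.XN := rfl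

theorem sum_pi_Theta_eq_piPiH (hπ : IsTwistedPoisson U π H) {x : Fin m → ℝ} (hx : x ∈ U)
    (i j k : Fin m) : ∑ b, Theta π H k i b x * π x b j = -piPiH π H j k i x := by
  simp only [Theta, piPiH, Finset.sum_mul, ← Finset.sum_neg_distrib]
  exact Finset.sum_congr rfl fun b _ => Finset.sum_congr rfl fun n _ => by
    rw [hπ.pi_anti x hx b j]; ring

theorem sum_pi_pi_pi_H_H_eq (hπ : IsTwistedPoisson U π H) {x : Fin m → ℝ} (hx : x ∈ U)
    (i j k n : Fin m) :
    ∑ q, ∑ a, ∑ b, ∑ d, π x q i * π x j a * π x b d * H x n a b * H x k q d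
      = -piPiPiHH π H i j n k x := by
  simp only [piPiPiHH, ← Finset.sum_neg_distrib]
  exact Finset.sum_congr rfl fun q _ => Finset.sum_congr rfl fun a _ =>
    Finset.sum_congr rfl fun b _ => Finset.sum_congr rfl fun d _ => by
      rw [hπ.pi_anti x hx q i, hπ.H_anti_left x hx n a b, hπ.H_anti_right x hx a n b,
        hπ.H_anti_left x hx k q d, hπ.H_anti_right x hx q k d]
      ring

/-- The component form of the action contains `A^{+i} dc_i` where the superfield expression contains
`-c_i dA^{+i}`. -/
theorem formsDensity_eq (h𝒜 : GradedComm 𝒜) (hU : IsOpen U) (hπ : IsTwistedPoisson U π H)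
    {Φ : SigmaField m 𝒢} {σ : ℝ × ℝ} (h : HasGhosts 𝒜 Φ σ) (hX : DifferentiableAt ℝ Φ.X σ)
    (hx : Φ.X σ ∈ U) :
    formsDensity 𝒜 π H Φ σ = covDensity 𝒜 π H Φ σ + ∑ i, (Φ.c σ i * curlAp Φ σ i
      + (Φ.Ap0 σ i * fderiv ℝ (fun s => Φ.c s i) σ (0, 1)
        - Φ.Ap1 σ i * fderiv ℝ (fun s => Φ.c s i) σ (1, 0))) := by
  have hp := h.parityRules
  have ho := h.orderRules h𝒜
  have g4 : ∑ i, ∑ j, π (Φ.X σ) j i • (formXp 𝒜 Φ i σ * formC 𝒜 Φ j σ).t10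
      = ∑ i, ∑ j, -(π (Φ.X σ) i j • (Φ.Xp σ i * Φ.c σ j)) :=
    Finset.sum_congr rfl fun i _ => Finset.sum_congr rfl fun j _ => by
      rw [hπ.pi_anti _ hx j i]; simp [formXp, formC]
  have g5 : ∀ i j k, (formCp 𝒜 Φ k σ * formC 𝒜 Φ i σ * formC 𝒜 Φ j σ).t10
      = Φ.cp σ k * (Φ.c σ i * Φ.c σ j) := fun i j k => by simp [formCp, formC, mul_assoc]
  have g6 : ∀ (C : Fin m → Fin m → ℝ) (i j : Fin m), ∑ k, ∑ n, C k n
        • (formAp 𝒜 Φ n σ * formAp 𝒜 Φ k σ * formC 𝒜 Φ i σ * formC 𝒜 Φ j σ).t10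
      = ∑ k, ∑ n, (C k n + C n k) • (Φ.Ap0 σ k * (Φ.Ap1 σ n * (Φ.c σ i * Φ.c σ j))) := by
    intro C i j
    simp only [formAp_mul_formAp h𝒜 h, smul_add, add_smul, Finset.sum_add_distrib]
    congr 1
    exact Finset.sum_comm
  have g3 : ∑ i, (formAp 𝒜 Φ i σ * (dd (formC 𝒜 Φ i) σ
          + ∑ j, ∑ k, pd i (fun x => π x j k) (Φ.X σ) • (formA 𝒜 Φ j σ * formC 𝒜 Φ k σ)
          + (1 / 2 : ℝ) • ∑ j, ∑ k, Theta π H k i j (Φ.X σ) •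
              ((dd (formX 𝒜 Φ j) σ - ∑ a, π (Φ.X σ) j a • formA 𝒜 Φ a σ) * formC 𝒜 Φ k σ))).t10
      = ∑ i, (Φ.Ap0 σ i * fderiv ℝ (fun s => Φ.c s i) σ (0, 1)
          - Φ.Ap1 σ i * fderiv ℝ (fun s => Φ.c s i) σ (1, 0))
        + ∑ i, ∑ j, (-∑ k, (pd k (fun x => π x i j) (Φ.X σ) + (1 / 2 : ℝ) * piPiH π H i j k (Φ.X σ))
              • (Φ.A0 σ i * (Φ.Ap1 σ k * Φ.c σ j))
          + ∑ k, (pd k (fun x => π x i j) (Φ.X σ) + (1 / 2 : ℝ) * piPiH π H i j k (Φ.X σ))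
              • (Φ.A1 σ i * (Φ.Ap0 σ k * Φ.c σ j))
          + ∑ k, ((1 / 2 : ℝ) * Theta π H i j k (Φ.X σ) * fderiv ℝ Φ.X σ (1, 0) j)
              • (Φ.Ap1 σ k * Φ.c σ i)
          - ∑ k, ((1 / 2 : ℝ) * Theta π H i j k (Φ.X σ) * fderiv ℝ Φ.X σ (0, 1) j)
              • (Φ.Ap0 σ k * Φ.c σ i)) := by
    -- The term is the difference of one expression for `A₁`, `A₀⁺`, `∂₁` and the same one for
    -- `A₀`, `A₁⁺`, `∂₀`; the expression is evaluated once, for `A`, `Ap`, `x1`, `D`.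
    have hS : ∀ (A : Fin m → 𝒢) (x1 : Fin m → ℝ) (i : Fin m),
        (1 / 2 : ℝ) • ∑ j, ∑ k, Theta π H k i j (Φ.X σ)
            • ((x1 j • (1 : 𝒢) - ∑ a, π (Φ.X σ) j a • A a) * Φ.c σ k)
          = ∑ j, ∑ k, ((1 / 2 : ℝ) * piPiH π H j k i (Φ.X σ)) • (A j * Φ.c σ k)
            + ∑ j, ∑ k, ((1 / 2 : ℝ) * Theta π H k i j (Φ.X σ) * x1 j) • Φ.c σ k := by
      intro A x1 i
      have e : ∑ j, ∑ k, ((1 / 2 : ℝ) * piPiH π H j k i (Φ.X σ)) • (A j * Φ.c σ k)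
          = -∑ j, ∑ k, ∑ a, ((1 / 2 : ℝ) * (Theta π H k i j (Φ.X σ) * π (Φ.X σ) j a))
            • (A a * Φ.c σ k) := by
        rw [sum_move2, Finset.sum_comm, ← Finset.sum_neg_distrib]
        refine Finset.sum_congr rfl fun k _ => ?_
        rw [← Finset.sum_neg_distrib]
        refine Finset.sum_congr rfl fun j _ => ?_
        rw [← Finset.sum_smul, ← Finset.mul_sum, sum_pi_Theta_eq_piPiH hπ hx]
        module
      rw [e]
      simp only [Finset.smul_sum, ← Finset.sum_neg_distrib, ← Finset.sum_add_distrib]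
      refine Finset.sum_congr rfl fun j _ => Finset.sum_congr rfl fun k _ => ?_
      simp only [sub_mul, smul_mul_assoc, one_mul, Finset.sum_mul, smul_sub, Finset.smul_sum,
        smul_smul, Finset.sum_neg_distrib, mul_assoc]
      abel
    have hB : ∀ (A Ap : Fin m → 𝒢), (∀ i j z, Ap i * (A j * z) = A j * (Ap i * z)) →
        ∑ i, Ap i * ∑ j, ∑ k, (pd i (fun x => π x j k) (Φ.X σ)
          + (1 / 2 : ℝ) * piPiH π H j k i (Φ.X σ)) • (A j * Φ.c σ k)
        = ∑ i, ∑ j, ∑ k, (pd k (fun x => π x i j) (Φ.X σ)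
          + (1 / 2 : ℝ) * piPiH π H i j k (Φ.X σ)) • (A i * (Ap k * Φ.c σ j)) := by
      intro A Ap hcomm
      simp only [Finset.mul_sum, mul_smul_comm, hcomm]
      exact sum_move2 _
    have hE : ∀ (Ap : Fin m → 𝒢) (x1 : Fin m → ℝ),
        ∑ i, Ap i * ∑ j, ∑ k, ((1 / 2 : ℝ) * Theta π H k i j (Φ.X σ) * x1 j) • Φ.c σ k
        = -∑ i, ∑ j, ∑ k, ((1 / 2 : ℝ) * Theta π H i j k (Φ.X σ) * x1 j)
          • (Ap k * Φ.c σ i) := by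
      intro Ap x1
      simp only [Finset.mul_sum, mul_smul_comm]
      rw [sum_move2, Finset.sum_comm]
      simp only [← Finset.sum_neg_distrib]
      exact Finset.sum_congr rfl fun i _ => Finset.sum_congr rfl fun j _ =>
        Finset.sum_congr rfl fun k _ => by rw [hπ.Theta_anti hx i k j]; module
    have hs : ∀ (A Ap : Fin m → 𝒢) (x1 : Fin m → ℝ) (D : Fin m → 𝒢),
        (∀ i j z, Ap i * (A j * z) = A j * (Ap i * z)) →
        ∑ i, Ap i * (D i + ∑ j, ∑ k, pd i (fun x => π x j k) (Φ.X σ) • (A j * Φ.c σ k)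
          + (1 / 2 : ℝ) • ∑ j, ∑ k, Theta π H k i j (Φ.X σ)
            • ((x1 j • (1 : 𝒢) - ∑ a, π (Φ.X σ) j a • A a) * Φ.c σ k))
        = ∑ i, Ap i * D i + ∑ i, ∑ j, ∑ k, (pd k (fun x => π x i j) (Φ.X σ)
            + (1 / 2 : ℝ) * piPiH π H i j k (Φ.X σ)) • (A i * (Ap k * Φ.c σ j))
          - ∑ i, ∑ j, ∑ k, ((1 / 2 : ℝ) * Theta π H i j k (Φ.X σ) * x1 j)
            • (Ap k * Φ.c σ i) := by
      intro A Ap x1 D hcomm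
      rw [← hB A Ap hcomm, sub_eq_add_neg, ← hE, ← Finset.sum_add_distrib,
        ← Finset.sum_add_distrib]
      refine Finset.sum_congr rfl fun i _ => ?_
      rw [hS]
      simp only [add_smul, Finset.sum_add_distrib, mul_add]
      abel
    have h0 := hs (Φ.A0 σ) (Φ.Ap1 σ) (fderiv ℝ Φ.X σ (1, 0))
      (fun i => fderiv ℝ (fun s => Φ.c s i) σ (1, 0)) ho.Ap1_A0'
    have h1 := hs (Φ.A1 σ) (Φ.Ap0 σ) (fderiv ℝ Φ.X σ (0, 1))
      (fun i => fderiv ℝ (fun s => Φ.c s i) σ (0, 1)) ho.Ap0_A1'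
    have e : ∑ i, (formAp 𝒜 Φ i σ * (dd (formC 𝒜 Φ i) σ
          + ∑ j, ∑ k, pd i (fun x => π x j k) (Φ.X σ) • (formA 𝒜 Φ j σ * formC 𝒜 Φ k σ)
          + (1 / 2 : ℝ) • ∑ j, ∑ k, Theta π H k i j (Φ.X σ) •
              ((dd (formX 𝒜 Φ j) σ - ∑ a, π (Φ.X σ) j a • formA 𝒜 Φ a σ) * formC 𝒜 Φ k σ))).t10
        = ∑ i, Φ.Ap0 σ i * (fderiv ℝ (fun s => Φ.c s i) σ (0, 1)
          + ∑ j, ∑ k, pd i (fun x => π x j k) (Φ.X σ) • (Φ.A1 σ j * Φ.c σ k)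
          + (1 / 2 : ℝ) • ∑ j, ∑ k, Theta π H k i j (Φ.X σ)
            • ((fderiv ℝ Φ.X σ (0, 1) j • (1 : 𝒢) - ∑ a, π (Φ.X σ) j a • Φ.A1 σ a) * Φ.c σ k))
        - ∑ i, Φ.Ap1 σ i * (fderiv ℝ (fun s => Φ.c s i) σ (1, 0)
          + ∑ j, ∑ k, pd i (fun x => π x j k) (Φ.X σ) • (Φ.A0 σ j * Φ.c σ k)
          + (1 / 2 : ℝ) • ∑ j, ∑ k, Theta π H k i j (Φ.X σ)
            • ((fderiv ℝ Φ.X σ (1, 0) j • (1 : 𝒢) - ∑ a, π (Φ.X σ) j a • Φ.A0 σ a)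
              * Φ.c σ k)) := by
      rw [← Finset.sum_sub_distrib]
      refine Finset.sum_congr rfl fun i _ => ?_
      rw [formAp_mul h]
      simp only [SuperFun.add_t0, SuperFun.add_t1, SuperFun.smul_t0, SuperFun.smul_t1,
        SuperFun.sum_t0, SuperFun.sum_t1, SuperFun.mul_t0, SuperFun.mul_t1, SuperFun.sub_t0,
        SuperFun.sub_t1, SuperFun.sub_one, SuperFun.sum_one, SuperFun.smul_one, dd_formC,
        dd_formX hX, formA, formC, map_zero, mul_zero, zero_add,
        smul_zero, Finset.sum_const_zero, sub_zero]
    rw [e, h0, h1]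
    simp only [Finset.sum_add_distrib, Finset.sum_sub_distrib, Finset.sum_neg_distrib]
    abel
  rw [covDensity_eq h𝒜 hU hπ h hX hx]
  simp only [formsDensity, berezin, SuperFun.add_t10]
  rw [formA_mul_formA h𝒜 h (hπ.pi_anti _ hx)]
  simp only [SuperFun.sum_t10, SuperFun.smul_t10, formA_mul_dd_formX h hX]
  rw [g3, g4]
  simp only [g5, g6, sum_pi_pi_pi_H_H_eq hπ hx, kinetic, normalTerm]
  have q5 : (1 / 2 : ℝ) • ∑ i, ∑ j, ∑ k, (pd k (fun x => π x i j) (Φ.X σ)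
        + piPiH π H i j k (Φ.X σ)) • (Φ.cp σ k * (Φ.c σ i * Φ.c σ j))
      = ∑ i, ∑ j, ∑ k, ((1 / 2 : ℝ) * (pd k (fun x => π x i j) (Φ.X σ)
        + piPiH π H i j k (Φ.X σ))) • (Φ.cp σ k * (Φ.c σ i * Φ.c σ j)) := by
    simp only [Finset.smul_sum, smul_smul]
  have q6 : ∀ (r : ℝ) (C : Fin m → Fin m → Fin m → Fin m → ℝ), r • ∑ i, ∑ j, ∑ k, ∑ n,
        (C i j k n + C i j n k) • (Φ.Ap0 σ k * (Φ.Ap1 σ n * (Φ.c σ i * Φ.c σ j)))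
      = ∑ i, ∑ j, ∑ k, ∑ n, (r * (C i j k n + C i j n k))
        • (Φ.Ap0 σ k * (Φ.Ap1 σ n * (Φ.c σ i * Φ.c σ j))) := fun r C => by
    simp only [Finset.smul_sum, smul_smul]
  have q7 : ∑ i, ∑ j, ∑ k, ∑ n, (quarterHess (fun x => π x i j) (Φ.X σ) k n
          + (1 / 4 : ℝ) * (pd k (piPiH π H i j n) (Φ.X σ) + pd n (piPiH π H i j k) (Φ.X σ))
          - (1 / 8 : ℝ) * (piPiPiHH π H i j k n (Φ.X σ) + piPiPiHH π H i j n k (Φ.X σ)))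
          • (Φ.Ap0 σ k * (Φ.Ap1 σ n * (Φ.c σ i * Φ.c σ j)))
      = ∑ i, ∑ j, ∑ k, ∑ n, ((1 / 4 : ℝ) *
          (pd n (pd k (fun x => π x i j)) (Φ.X σ) + pd n (piPiH π H i j k) (Φ.X σ)
          + (pd k (pd n (fun x => π x i j)) (Φ.X σ) + pd k (piPiH π H i j n) (Φ.X σ))))
          • (Φ.Ap0 σ k * (Φ.Ap1 σ n * (Φ.c σ i * Φ.c σ j)))
        + ∑ i, ∑ j, ∑ k, ∑ n, ((1 / 8 : ℝ) *
          (-piPiPiHH π H i j n k (Φ.X σ) + -piPiPiHH π H i j k n (Φ.X σ)))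
          • (Φ.Ap0 σ k * (Φ.Ap1 σ n * (Φ.c σ i * Φ.c σ j))) := by
    simp only [← Finset.sum_add_distrib, ← add_smul]
    exact Finset.sum_congr rfl fun i _ => Finset.sum_congr rfl fun j _ =>
      Finset.sum_congr rfl fun k _ => Finset.sum_congr rfl fun n _ => by
        rw [quarterHess]; congr 1; ring
  have q6a := q6 (1 / 4) fun i j k n =>
    pd n (pd k (fun x => π x i j)) (Φ.X σ) + pd n (piPiH π H i j k) (Φ.X σ)
  have q6b := q6 (1 / 8) fun i j k n => -piPiPiHH π H i j n k (Φ.X σ)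
  rw [q5, q6a, q6b]
  simp only [Finset.sum_add_distrib, Finset.sum_sub_distrib, Finset.sum_neg_distrib]
  rw [q7]
  abel

end Forms

section Exponential

variable {m : ℕ} {𝒢 : Type*} [NormedRing 𝒢] [NormedAlgebra ℝ 𝒢] {𝒜 : ℤ → Submodule ℝ 𝒢}
  {U : Set (Fin m → ℝ)} {π : (Fin m → ℝ) → Fin m → Fin m → ℝ}
  {H : (Fin m → ℝ) → Fin m → Fin m → Fin m → ℝ}

theorem continuous_normalForm {Φ : BVField m 𝒢} (h : IsTangent 𝒜 Φ)
    {P : ℝ × ℝ → Fin m → Fin m → ℝ} {K B0 B1 E0 E1 : ℝ × ℝ → Fin m → Fin m → Fin m → ℝ}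
    {Q : ℝ × ℝ → Fin m → Fin m → Fin m → Fin m → ℝ} (hP : ∀ i j, Continuous fun σ => P σ i j)
    (hK : ∀ i j k, Continuous fun σ => K σ i j k) (hB0 : ∀ i j k, Continuous fun σ => B0 σ i j k)
    (hB1 : ∀ i j k, Continuous fun σ => B1 σ i j k) (hE0 : ∀ i j k, Continuous fun σ => E0 σ i j k)
    (hE1 : ∀ i j k, Continuous fun σ => E1 σ i j k)
    (hQ : ∀ i j k n, Continuous fun σ => Q σ i j k n) :
    Continuous fun σ => ∑ i, kinetic Φ.toSigmaField σ i + ∑ i, ∑ j, normalTerm (P σ i j) (K σ i j)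
      (B0 σ i j) (B1 σ i j) (E0 σ i j) (E1 σ i j) (Q σ i j) Φ.toSigmaField σ i j := by
  have hx0 := fun i => (contDiff_fderiv_X h (1, 0) i).continuous
  have hx1 := fun i => (contDiff_fderiv_X h (0, 1) i).continuous
  have hd : ∀ {k : ℤ} {f : ℝ × ℝ → Fin m → 𝒢}, IsComponent 𝒜 k f → ∀ i v,
      Continuous fun σ => fderiv ℝ (fun s => f s i) σ v := fun hf i v =>
    ((hf.contDiff_apply i).continuous_fderiv (by norm_num)).clm_apply continuous_const
  have hc := fun i => (h.c.contDiff_apply i).continuous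
  have hA0 := fun i => (h.A0.contDiff_apply i).continuous
  have hA1 := fun i => (h.A1.contDiff_apply i).continuous
  have hAp0 := fun i => (h.Ap0.contDiff_apply i).continuous
  have hAp1 := fun i => (h.Ap1.contDiff_apply i).continuous
  have hXp := fun i => (h.Xp.contDiff_apply i).continuous
  have hcp := fun i => (h.cp.contDiff_apply i).continuous
  refine (continuous_finsetSum _ fun i _ => ?_).add
    (continuous_finsetSum _ fun i _ => continuous_finsetSum _ fun j _ => ?_)
  · exact (((hx0 i).smul (hA1 i)).sub ((hx1 i).smul (hA0 i))).sub
      ((hc i).mul ((hd h.Ap1 i _).sub (hd h.Ap0 i _)))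
  · refine ((((((((hP i j).smul ((hA0 i).mul (hA1 j))).neg.sub
      ((hP i j).smul ((hXp i).mul (hc j)))).add ?_).sub ?_).add ?_).add ?_).sub ?_).add ?_ <;>
      refine continuous_finsetSum _ fun k _ => ?_
    · exact (continuous_const.mul (hK i j k)).smul ((hcp k).mul ((hc i).mul (hc j)))
    · exact (hB1 i j k).smul ((hA0 i).mul ((hAp1 k).mul (hc j)))
    · exact (hB0 i j k).smul ((hA1 i).mul ((hAp0 k).mul (hc j)))
    · exact ((hE1 i j k).mul (hx0 j)).smul ((hAp1 k).mul (hc i))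
    · exact ((hE0 i j k).mul (hx1 j)).smul ((hAp0 k).mul (hc i))
    · exact continuous_finsetSum _ fun n _ =>
        (hQ i j k n).smul ((hAp0 k).mul ((hAp1 n).mul ((hc i).mul (hc j))))

variable [GradedAlgebra 𝒜]

theorem continuous_darbouxDensity (h𝒜 : GradedComm 𝒜) (hU : IsOpen U)
    (hπ : IsTwistedPoisson U π H) {Φ : BVField m 𝒢} (h : Φ ∈ bvFields 𝒜 U) :
    Continuous (darbouxDensity 𝒜 π H Φ.toSigmaField) := by
  have e : darbouxDensity 𝒜 π H Φ.toSigmaField = _ := funext fun σ =>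
    darbouxDensity_eq h𝒜 hU hπ (h.1.hasGhosts σ) (h.1.X_differentiable σ) (X_mem h σ)
  rw [e]
  have hc : ∀ {f : (Fin m → ℝ) → ℝ}, ContDiffOn ℝ ∞ f U → Continuous fun σ => f (Φ.X σ) :=
    fun hf => (contDiff_comp_X h hf).continuous
  have hc1 : ∀ {f : (Fin m → ℝ) → ℝ}, ContDiffOn ℝ ∞ f U → ∀ a,
      Continuous fun σ => pd a f (Φ.X σ) := fun hf a => hc (contDiffOn_pd hU hf a)
  exact continuous_normalForm h.1 (fun i j => hc (hπ.pi_smooth i j))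
    (fun i j k => (hc1 (hπ.pi_smooth i j) k).add (hc (hπ.piPiH_smooth i j k)))
    (fun i j k => hc1 (hπ.pi_smooth i j) k)
    (fun i j k => (hc1 (hπ.pi_smooth i j) k).add (hc (hπ.piPiH_smooth i j k)))
    (fun i j k => (hc (hπ.Theta_smooth i k j)).neg) (fun _ _ _ => continuous_const)
    (fun i j k n => (continuous_const.mul (continuous_const.mul
      ((hc1 (contDiffOn_pd hU (hπ.pi_smooth i j) k) n).add
        (hc1 (contDiffOn_pd hU (hπ.pi_smooth i j) n) k)))).add
      (continuous_const.mul (hc1 (hπ.piPiH_smooth i j n) k)))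

theorem covDensity_eq_darbouxDensity (h𝒜 : GradedComm 𝒜) (hU : IsOpen U)
    (hπ : IsTwistedPoisson U π H) {Φ : BVField m 𝒢} (h : Φ ∈ bvFields 𝒜 U) (σ : ℝ × ℝ) :
    covDensity 𝒜 π H Φ.toSigmaField σ
      = darbouxDensity 𝒜 π H (Φ + (1 : ℝ) • hamLam π H Φ).toSigmaField σ := by
  rw [darbouxDensity_eq_covDensity h𝒜 hU hπ
    (add_smul_mem_bvFields h (isTangent_hamLam hU hπ.Theta_smooth h) rfl 1), hamLam_add,
    add_smul_add_smul, add_neg_cancel, add_zero_smul]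

/-- The two densities differ by the divergence of `-A₁^{+i} c_i`, `A₀^{+i} c_i`, which integrates to
zero over the torus. -/
theorem Scov_eq_ScovForms (h𝒜 : GradedComm 𝒜) (hU : IsOpen U)
    (hπ : IsTwistedPoisson U π H) {Φ : BVField m 𝒢} (h : Φ ∈ bvFields 𝒜 U) :
    Scov 𝒜 π H Φ = ScovForms 𝒜 π H Φ := by
  set f : ℝ × ℝ → 𝒢 := fun σ => ∑ i, -(Φ.Ap1 σ i * Φ.c σ i) with hf
  set g : ℝ × ℝ → 𝒢 := fun σ => ∑ i, Φ.Ap0 σ i * Φ.c σ i with hg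
  have hfs : ContDiff ℝ ∞ f := ContDiff.sum fun i _ =>
    ((h.1.Ap1.contDiff_apply i).mul (h.1.c.contDiff_apply i)).neg
  have hgs : ContDiff ℝ ∞ g := ContDiff.sum fun i _ =>
    (h.1.Ap0.contDiff_apply i).mul (h.1.c.contDiff_apply i)
  have hcomm : ∀ {F : ℝ × ℝ → Fin m → 𝒢}, IsComponent 𝒜 (-1) F → ∀ σ i v,
      fderiv ℝ (fun s => F s i) σ v * Φ.c σ i = -(Φ.c σ i * fderiv ℝ (fun s => F s i) σ v) := by
    intro F hF σ i v
    have hd := ((hF.contDiff_apply i).differentiable (by norm_num) σ).hasFDerivAt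
    have e : (fun s => F s i * Φ.c σ i) = fun s => -(Φ.c σ i * F s i) := funext fun s =>
      h𝒜.anticomm_of_odd (by decide) (hF.ghost s i) (h.1.c.ghost σ i)
    have h1 := hd.mul_const' (Φ.c σ i)
    have h2 := (hd.const_mul (Φ.c σ i)).fun_neg
    rw [e] at h1
    have := congrArg (fun L : ℝ × ℝ →L[ℝ] 𝒢 => L v) (h1.unique h2)
    simpa using this
  have hdc := fun σ i => ((h.1.c.contDiff_apply i).differentiable (by norm_num) σ).hasFDerivAt
  have hd0 := fun σ i => ((h.1.Ap0.contDiff_apply i).differentiable (by norm_num) σ).hasFDerivAt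
  have hd1 := fun σ i => ((h.1.Ap1.contDiff_apply i).differentiable (by norm_num) σ).hasFDerivAt
  have hdiv : ∀ σ, ∑ i, (Φ.c σ i * curlAp Φ.toSigmaField σ i
      + (Φ.Ap0 σ i * fderiv ℝ (fun s => Φ.c s i) σ (0, 1)
        - Φ.Ap1 σ i * fderiv ℝ (fun s => Φ.c s i) σ (1, 0)))
      = fderiv ℝ f σ (1, 0) + fderiv ℝ g σ (0, 1) := by
    intro σ
    have ef : fderiv ℝ f σ = _ := (HasFDerivAt.fun_sum (u := Finset.univ) fun i _ =>
      ((hd1 σ i).mul' (hdc σ i)).neg).fderiv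
    have eg : fderiv ℝ g σ = _ := (HasFDerivAt.fun_sum (u := Finset.univ) fun i _ =>
      (hd0 σ i).mul' (hdc σ i)).fderiv
    rw [ef, eg]
    simp only [sum_apply, ← Finset.sum_add_distrib]
    refine Finset.sum_congr rfl fun i _ => ?_
    simp [curlAp, hcomm h.1.Ap1, hcomm h.1.Ap0, mul_sub]
    abel
  have hcov : Continuous (covDensity 𝒜 π H Φ.toSigmaField) := by
    have e : covDensity 𝒜 π H Φ.toSigmaField = _ :=
      funext (covDensity_eq_darbouxDensity h𝒜 hU hπ h)
    rw [e]
    exact continuous_darbouxDensity h𝒜 hU hπ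
      (add_smul_mem_bvFields h (isTangent_hamLam hU hπ.Theta_smooth h) rfl 1)
  have hdivc : Continuous fun σ => fderiv ℝ f σ (1, 0) + fderiv ℝ g σ (0, 1) :=
    ((hfs.continuous_fderiv (by norm_num)).clm_apply continuous_const).add
      ((hgs.continuous_fderiv (by norm_num)).clm_apply continuous_const)
  have e : formsDensity 𝒜 π H Φ.toSigmaField = fun σ => covDensity 𝒜 π H Φ.toSigmaField σ
      + (fderiv ℝ f σ (1, 0) + fderiv ℝ g σ (0, 1)) := funext fun σ => by
    rw [formsDensity_eq h𝒜 hU hπ (h.1.hasGhosts σ) (h.1.X_differentiable σ) (X_mem h σ), hdiv]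
  rw [ScovForms_eq, Scov, e, intSigma_add hcov hdivc,
    intSigma_divergence hfs hgs
      (fun s t => by simp [f, h.1.Ap1.periodic0, h.1.c.periodic0])
      (fun s t => by simp [g, h.1.Ap0.periodic1, h.1.c.periodic1]), add_zero]

/-! ### The exponential of the Hamiltonian vector field -/

/-- Dependence on a real parameter that is polynomial of degree at most two. -/
def IsQuadratic (f : ℝ → 𝒢) : Prop := ∃ a b c, ∀ s, f s = a + s • b + s ^ 2 • c

section Quadratic

theorem IsQuadratic.add {f g : ℝ → 𝒢} (hf : IsQuadratic f) (hg : IsQuadratic g) :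
    IsQuadratic fun s => f s + g s := by
  obtain ⟨a, b, c, hf⟩ := hf
  obtain ⟨a', b', c', hg⟩ := hg
  exact ⟨a + a', b + b', c + c', fun s => by simp only [hf, hg]; module⟩

theorem IsQuadratic.smul {f : ℝ → 𝒢} (hf : IsQuadratic f) (r : ℝ) :
    IsQuadratic fun s => r • f s := by
  obtain ⟨a, b, c, hf⟩ := hf
  exact ⟨r • a, r • b, r • c, fun s => by simp only [hf]; module⟩

theorem IsQuadratic.neg {f : ℝ → 𝒢} (hf : IsQuadratic f) : IsQuadratic fun s => -f s := by
  simpa using hf.smul (-1)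

theorem IsQuadratic.sub {f g : ℝ → 𝒢} (hf : IsQuadratic f) (hg : IsQuadratic g) :
    IsQuadratic fun s => f s - g s := by
  simpa [sub_eq_add_neg] using hf.add hg.neg

theorem IsQuadratic.sum {f : Fin m → ℝ → 𝒢} (hf : ∀ i, IsQuadratic (f i)) :
    IsQuadratic fun s => ∑ i, f i s := by
  choose a b c hf using hf
  exact ⟨∑ i, a i, ∑ i, b i, ∑ i, c i, fun s => by
    simp only [hf, Finset.sum_add_distrib, Finset.smul_sum]⟩

theorem isQuadratic_const (a : 𝒢) : IsQuadratic fun _ => a := ⟨a, 0, 0, fun s => by simp⟩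

theorem isQuadratic_line_mul_line (a a' b b' : 𝒢) :
    IsQuadratic fun s => (a + s • a') * (b + s • b') :=
  ⟨a * b, a' * b + a * b', a' * b', fun s => by
    simp only [mul_add, add_mul, smul_mul_assoc, mul_smul_comm]
    module⟩

theorem isQuadratic_line_mul (a a' b : 𝒢) : IsQuadratic fun s => (a + s • a') * b := by
  simpa using isQuadratic_line_mul_line a a' b 0

theorem isQuadratic_line (a a' : 𝒢) : IsQuadratic fun s => a + s • a' :=
  ⟨a, a', 0, fun s => by simp⟩

theorem IsQuadratic.interpolation {f : ℝ → 𝒢} (hf : IsQuadratic f) (s : ℝ) :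
    f s = f 0 + s • ((1 / 2 : ℝ) • (f 1 - f (-1)))
      + s ^ 2 • ((1 / 2 : ℝ) • (f 1 + f (-1)) - f 0) := by
  obtain ⟨a, b, c, hf⟩ := hf
  simp only [hf]
  module

end Quadratic

/-- Along the flow of `Λ` the densities are quadratic, since the flow shifts only momenta. -/
theorem isQuadratic_darbouxDensity (h𝒜 : GradedComm 𝒜) (hU : IsOpen U)
    (hπ : IsTwistedPoisson U π H) {Φ : BVField m 𝒢} (h : Φ ∈ bvFields 𝒜 U) (σ : ℝ × ℝ) :
    IsQuadratic fun s =>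
      darbouxDensity 𝒜 π H (Φ + s • hamLam π H Φ).toSigmaField σ := by
  have hΨ := fun s : ℝ => add_smul_mem_bvFields h (isTangent_hamLam hU hπ.Theta_smooth h) rfl s
  set V := hamLam π H Φ with hV
  have hX : ∀ s : ℝ, (Φ + s • V).X = Φ.X := fun s => by simp [V, hamLam]
  have hc : ∀ s : ℝ, (Φ + s • V).c = Φ.c := fun s => by simp [V, hamLam]
  have hAp0 : ∀ s : ℝ, (Φ + s • V).Ap0 = Φ.Ap0 := fun s => by simp [V, hamLam]
  have hAp1 : ∀ s : ℝ, (Φ + s • V).Ap1 = Φ.Ap1 := fun s => by simp [V, hamLam]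
  have hA0 : ∀ (s : ℝ) i, (Φ + s • V).A0 σ i = Φ.A0 σ i + s • V.A0 σ i := fun _ _ => rfl
  have hA1 : ∀ (s : ℝ) i, (Φ + s • V).A1 σ i = Φ.A1 σ i + s • V.A1 σ i := fun _ _ => rfl
  have hXp : ∀ (s : ℝ) i, (Φ + s • V).Xp σ i = Φ.Xp σ i + s • V.Xp σ i := fun _ _ => rfl
  have hcp : ∀ (s : ℝ) i, (Φ + s • V).cp σ i = Φ.cp σ i + s • V.cp σ i := fun _ _ => rfl
  have e := fun s : ℝ => darbouxDensity_eq h𝒜 hU hπ ((hΨ s).1.hasGhosts σ)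
    ((hΨ s).1.X_differentiable σ) (X_mem (hΨ s) σ)
  simp only [e, hX, kinetic, normalTerm, curlAp, hc, hAp0, hAp1, hA0, hA1, hXp, hcp]
  refine (IsQuadratic.sum fun i => ?_).add (IsQuadratic.sum fun i => IsQuadratic.sum fun j => ?_)
  · exact (((isQuadratic_line _ _).smul _).sub ((isQuadratic_line _ _).smul _)).sub
      (isQuadratic_const _)
  · refine ((((((((isQuadratic_line_mul_line _ _ _ _).smul _).neg.sub
      ((isQuadratic_line_mul _ _ _).smul _)).add
      (IsQuadratic.sum fun k => (isQuadratic_line_mul _ _ _).smul _)).sub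
      (IsQuadratic.sum fun k => (isQuadratic_line_mul _ _ _).smul _)).add
      (IsQuadratic.sum fun k => (isQuadratic_line_mul _ _ _).smul _)).add
      (isQuadratic_const _)).sub (isQuadratic_const _)).add (isQuadratic_const _)

/-- The coefficients of the quadratic polynomial are integrals of continuous densities, by
interpolation at the parameters `-1`, `0`, `1`. -/
theorem isQuadratic_SDarboux (h𝒜 : GradedComm 𝒜) (hU : IsOpen U)
    (hπ : IsTwistedPoisson U π H) {Φ : BVField m 𝒢} (h : Φ ∈ bvFields 𝒜 U) :
    IsQuadratic fun s => SDarboux 𝒜 π H (Φ + s • hamLam π H Φ) := by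
  let D : ℝ → ℝ × ℝ → 𝒢 := fun s => darbouxDensity 𝒜 π H (Φ + s • hamLam π H Φ).toSigmaField
  have hΨ : ∀ s, Continuous (D s) := fun s => continuous_darbouxDensity h𝒜 hU hπ
    (add_smul_mem_bvFields h (isTangent_hamLam hU hπ.Theta_smooth h) rfl s)
  have hXN : ∀ s : ℝ, (Φ + s • hamLam π H Φ).XN = Φ.XN := fun s => by simp [hamLam]
  have e : ∀ s, D s = fun σ => (D 0 σ + s • ((1 / 2 : ℝ) • (D 1 σ - D (-1) σ)))
      + s ^ 2 • ((1 / 2 : ℝ) • (D 1 σ + D (-1) σ) - D 0 σ) := fun s => funext fun σ =>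
    (isQuadratic_darbouxDensity h𝒜 hU hπ h σ).interpolation s
  have hb : Continuous fun σ => (1 / 2 : ℝ) • (D 1 σ - D (-1) σ) :=
    ((hΨ 1).sub (hΨ (-1))).const_smul _
  have hc : Continuous fun σ => (1 / 2 : ℝ) • (D 1 σ + D (-1) σ) - D 0 σ :=
    (((hΨ 1).add (hΨ (-1))).const_smul _).sub (hΨ 0)
  refine ⟨intSigma (D 0) + wz 𝒢 H Φ.XN, intSigma fun σ => (1 / 2 : ℝ) • (D 1 σ - D (-1) σ),
    intSigma fun σ => (1 / 2 : ℝ) • (D 1 σ + D (-1) σ) - D 0 σ, fun s => ?_⟩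
  have e' : SDarboux 𝒜 π H (Φ + s • hamLam π H Φ) = intSigma (D s) + wz 𝒢 H Φ.XN := by
    rw [SDarboux_eq, hXN]
  beta_reduce
  rw [e', e s, intSigma_add ((hΨ 0).fun_add (hb.fun_const_smul s)) (hc.fun_const_smul (s ^ 2)),
    intSigma_add (hΨ 0) (hb.fun_const_smul s), intSigma_smul s, intSigma_smul (s ^ 2)]
  abel

/-- Along a flow line of a vector field that is constant along its flow lines, the derivative
along the vector field is the derivative with respect to the parameter. -/
theorem lieD_flow {V : BVField m 𝒢 → BVField m 𝒢} {Φ : BVField m 𝒢}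
    (hV : ∀ t : ℝ, V (Φ + t • V Φ) = V Φ) {F : BVField m 𝒢 → 𝒢} {g g' : ℝ → 𝒢}
    (hF : ∀ t : ℝ, F (Φ + t • V Φ) = g t) (hg : ∀ t, HasDerivAt g (g' t) t) (t : ℝ) :
    lieD V F (Φ + t • V Φ) = g' t := by
  simp only [lieD, hV, add_smul_add_smul, hF]
  have := (hg (t + 0)).comp_const_add t 0
  simpa using this.deriv

theorem SDarboux_eq_Scov (h𝒜 : GradedComm 𝒜) (hU : IsOpen U) (hπ : IsTwistedPoisson U π H)
    {Φ : BVField m 𝒢} (h : Φ ∈ bvFields 𝒜 U) :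
    SDarboux 𝒜 π H Φ = Scov 𝒜 π H (T2 𝒜 π H Φ) := by
  rw [SDarboux_eq, Scov, T2_eq h𝒜 h.1]
  congr 2
  · exact funext (darbouxDensity_eq_covDensity h𝒜 hU hπ h)
  · simp [hamLam]

theorem Scov_eq_SDarboux (h𝒜 : GradedComm 𝒜) (hU : IsOpen U) (hπ : IsTwistedPoisson U π H)
    {Φ : BVField m 𝒢} (h : Φ ∈ bvFields 𝒜 U) :
    Scov 𝒜 π H Φ = SDarboux 𝒜 π H (Φ + (1 : ℝ) • hamLam π H Φ) := by
  rw [SDarboux_eq, Scov]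
  congr 2
  · exact funext (covDensity_eq_darbouxDensity h𝒜 hU hπ h)
  · simp [hamLam]

/-- The exponential series is the Taylor expansion at `0` of the action along the flow line; this is
a quadratic polynomial, so that the series stops after the second term and gives the value of the
action at the parameter `1`. -/
theorem isExp_hamLam (h𝒜 : GradedComm 𝒜) (hU : IsOpen U) (hπ : IsTwistedPoisson U π H) :
    IsExp 𝒜 U (hamLam π H) (SDarboux 𝒜 π H) (Scov 𝒜 π H) := by
  intro Φ h
  obtain ⟨a, b, c, hq⟩ := isQuadratic_SDarboux h𝒜 hU hπ h
  beta_reduce at hq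
  have hV : ∀ t : ℝ, hamLam π H (Φ + t • hamLam π H Φ) = hamLam π H Φ := hamLam_add Φ
  set L := lieD (hamLam π H (𝒢 := 𝒢)) with hL
  have h1 : ∀ t : ℝ, L^[1] (SDarboux 𝒜 π H) (Φ + t • hamLam π H Φ) = b + (2 * t) • c :=
    lieD_flow hV hq fun t => by
      have := ((hasDerivAt_const t a).fun_add ((hasDerivAt_id t).smul_const b)).fun_add
        ((hasDerivAt_pow 2 t).smul_const c)
      simpa using this
  have h2 : ∀ t : ℝ, L^[2] (SDarboux 𝒜 π H) (Φ + t • hamLam π H Φ) = (2 : ℝ) • c := fun t => by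
    rw [Function.iterate_succ_apply']
    exact lieD_flow hV h1 (g' := fun _ => (2 : ℝ) • c) (fun t => by
      have := (hasDerivAt_const t b).fun_add
        (((hasDerivAt_id t).const_mul (2 : ℝ)).smul_const c)
      simpa using this) t
  have h3 : ∀ (n : ℕ) (t : ℝ), L^[n + 3] (SDarboux 𝒜 π H) (Φ + t • hamLam π H Φ) = 0 := by
    intro n
    induction n with
    | zero =>
      intro t
      rw [Function.iterate_succ_apply']
      exact lieD_flow hV h2 (fun t => hasDerivAt_const t _) t
    | succ n ih =>
      intro t
      rw [Function.iterate_succ_apply']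
      exact lieD_flow hV ih (fun t => hasDerivAt_const t _) t
  have h0 : ∀ n, L^[n] (SDarboux 𝒜 π H) Φ
      = L^[n] (SDarboux 𝒜 π H) (Φ + (0 : ℝ) • hamLam π H Φ) := fun n => by rw [add_zero_smul]
  have key := hasSum_sum_of_ne_finset_zero (s := Finset.range 3) (L := .unconditional ℕ)
    (f := fun n : ℕ => ((n.factorial : ℝ)⁻¹) • (L^[n] (SDarboux 𝒜 π H)) Φ) fun n hn => by
      obtain ⟨k, rfl⟩ : ∃ k, n = k + 3 := ⟨n - 3, by simp at hn; omega⟩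
      rw [h0, h3, smul_zero]
  have e : ∑ n ∈ Finset.range 3, ((n.factorial : ℝ)⁻¹) • (L^[n] (SDarboux 𝒜 π H)) Φ
      = Scov 𝒜 π H Φ := by
    rw [Scov_eq_SDarboux h𝒜 hU hπ h, hq 1, Finset.sum_range_succ, Finset.sum_range_succ,
      Finset.sum_range_one, h0 0, h0 1, h0 2, h1, h2, Function.iterate_zero, id, hq 0]
    simp [Nat.factorial]
  rw [e] at key
  exact key

end Exponential

end HPSM

end

theorem mainTheorem2 {m : ℕ} {𝒢 : Type*} [NormedRing 𝒢] [NormedAlgebra ℝ 𝒢]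
    [FiniteDimensional ℝ 𝒢] (𝒜 : ℤ → Submodule ℝ 𝒢) [GradedAlgebra 𝒜] (h𝒜 : GradedComm 𝒜)
    (U : Set (Fin m → ℝ)) (hU : IsOpen U) (π : (Fin m → ℝ) → Fin m → Fin m → ℝ)
    (H : (Fin m → ℝ) → Fin m → Fin m → Fin m → ℝ) (hπH : IsTwistedPoisson U π H) :
    -- The transformations are invertible on the space of fields and have the stated form,
    -- in terms of superfields and in terms of components.
    (Set.BijOn (T1 𝒜 H) (bvFields 𝒜 U) (bvFields 𝒜 U)
      ∧ Set.BijOn (T2 𝒜 π H) (bvFields 𝒜 U) (bvFields 𝒜 U)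
      ∧ ∀ Φ ∈ bvFields 𝒜 U,
        (SX 𝒜 (T1 𝒜 H Φ).toSigmaField = SX 𝒜 Φ.toSigmaField
          ∧ SA 𝒜 (T1 𝒜 H Φ).toSigmaField = primA 𝒜 H Φ.toSigmaField
          ∧ SX 𝒜 (T2 𝒜 π H Φ).toSigmaField = secX 𝒜 π H Φ.toSigmaField
          ∧ SA 𝒜 (T2 𝒜 π H Φ).toSigmaField = secA 𝒜 π H Φ.toSigmaField)
        ∧ T1 𝒜 H Φ =
          { Φ with
            Xp := fun σ i => Φ.Xp σ i
              + ∑ j, ∑ k, (H (Φ.X σ) i j k * fderiv ℝ Φ.X σ (0, 1) j) • Φ.Ap0 σ k }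
        ∧ T2 𝒜 π H Φ =
          { Φ with
            cp := fun σ i => Φ.cp σ i + ∑ j, ∑ k,
              ((1 / 2 : ℝ) * Theta π H i j k (Φ.X σ)) • (Φ.Ap0 σ j * Φ.Ap1 σ k)
            A0 := fun σ i => Φ.A0 σ i - ∑ j, ∑ k,
              ((1 / 2 : ℝ) * Theta π H j k i (Φ.X σ)) • (Φ.Ap0 σ k * Φ.c σ j)
            A1 := fun σ i => Φ.A1 σ i + ∑ j, ∑ k,
              ((1 / 2 : ℝ) * Theta π H j k i (Φ.X σ)) • (Φ.Ap1 σ k * Φ.c σ j)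
            Xp := fun σ i => Φ.Xp σ i + ∑ j, ∑ k, ∑ l,
              ((1 / 2 : ℝ) * pd i (Theta π H j k l) (Φ.X σ))
                • (Φ.Ap0 σ k * Φ.Ap1 σ l * Φ.c σ j) })
    -- The first transformation brings the symplectic form into Darboux form.
    ∧ (∀ Φ ∈ bvFields 𝒜 U, ∀ V W : BVField m 𝒢, IsTangent 𝒜 V → IsTangent 𝒜 W →
        omegaCan 𝒜 (fieldTangent (T1 𝒜 H) Φ V) (fieldTangent (T1 𝒜 H) Φ W) = omegaGD 𝒜 H Φ V W)
    -- It transforms the action as stated and keeps the classical part.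
    ∧ (∀ Φ ∈ bvFields 𝒜 U, SGD 𝒜 π H Φ = SDarboux 𝒜 π H (T1 𝒜 H Φ))
    ∧ (∀ Φ ∈ bvFields 𝒜 U, AntifieldFree Φ.toSigmaField →
        SGD 𝒜 π H Φ = Sclass π H Φ ∧ SDarboux 𝒜 π H Φ = Sclass π H Φ
          ∧ Scov 𝒜 π H Φ = Sclass π H Φ)
    -- The second transformation preserves the Darboux form.
    ∧ (∀ Φ ∈ bvFields 𝒜 U, ∀ V W : BVField m 𝒢, IsTangent 𝒜 V → IsTangent 𝒜 W →
        omegaCan 𝒜 (fieldTangent (T2 𝒜 π H) Φ V) (fieldTangent (T2 𝒜 π H) Φ W) = omegaCan 𝒜 V W)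
    -- It is generated by the Hamiltonian vector field of `Λ`, whose flow terminates after the
    -- linear term and whose exponential maps the action to the covariant one.
    ∧ (∃ V : BVField m 𝒢 → BVField m 𝒢,
        IsHamiltonianVF 𝒜 U V (Lam π H)
        ∧ (∀ Φ ∈ bvFields 𝒜 U, ∀ s : ℝ, V (Φ + s • V Φ) = V Φ)
        ∧ (∀ Φ ∈ bvFields 𝒜 U, T2 𝒜 π H Φ = Φ + (-1 : ℝ) • V Φ)
        ∧ IsExp 𝒜 U V (SDarboux 𝒜 π H) (Scov 𝒜 π H))
    -- The resulting identities between the actions.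
    ∧ (∀ Φ ∈ bvFields 𝒜 U, SDarboux 𝒜 π H Φ = Scov 𝒜 π H (T2 𝒜 π H Φ))
    ∧ (∀ Φ ∈ bvFields 𝒜 U, SGD 𝒜 π H Φ = Scov 𝒜 π H (T2 𝒜 π H (T1 𝒜 H Φ)))
    -- The covariant action, in terms of component forms.
    ∧ (∀ Φ ∈ bvFields 𝒜 U, Scov 𝒜 π H Φ = ScovForms 𝒜 π H Φ)
    -- Covariance: the integrands transform as a 2-form on `Σ` and as a 3-form on `N`.
    ∧ (∀ φ : ℝ × ℝ → ℝ × ℝ, ContDiff ℝ ∞ φ → ∀ Φ ∈ bvFields 𝒜 U, ∀ τ,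
        covDensity 𝒜 π H (pull φ Φ.toSigmaField) τ
          = jac φ τ • covDensity 𝒜 π H Φ.toSigmaField (φ τ))
    ∧ (∀ φ : ℝ × ℝ → ℝ × ℝ, ContDiff ℝ ∞ φ → ∀ V W : BVField m 𝒢, IsTangent 𝒜 V → IsTangent 𝒜 W → ∀ τ,
        canDensity 𝒜 (pull φ V.toSigmaField) (pull φ W.toSigmaField) τ
          = jac φ τ • canDensity 𝒜 V.toSigmaField W.toSigmaField (φ τ))
    ∧ (∀ ψ : ℂ × ℝ → ℂ × ℝ, ContDiff ℝ ∞ ψ → ∀ Φ ∈ bvFields 𝒜 U, ∀ p,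
        ψ p ∈ Metric.ball (0 : ℂ) 1 ×ˢ (Set.univ : Set ℝ) →
        wzDensity H (fun q => Φ.XN (ψ q)) p
          = LinearMap.det (fderiv ℝ ψ p : ℂ × ℝ →ₗ[ℝ] ℂ × ℝ) * wzDensity H Φ.XN (ψ p)) := by
  refine ⟨⟨bijOn_T1 hπH, bijOn_T2 h𝒜 hU hπH, fun Φ h => ⟨⟨?_, ?_, ?_, ?_⟩, ?_, ?_⟩⟩,
    fun Φ h V W hV hW => omegaCan_T1 hU hπH h hV hW,
    fun Φ h => SGD_eq_SDarboux h𝒜 hU hπH h,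
    fun Φ h h0 => actions_of_antifieldFree h𝒜 hU hπH h h0,
    fun Φ h V W hV hW => omegaCan_T2 h𝒜 hU hπH h hV hW,
    ⟨hamLam π H, isHamiltonianVF_hamLam h𝒜 hU hπH, fun Φ _ => hamLam_add Φ,
      fun Φ h => T2_eq h𝒜 h.1, isExp_hamLam h𝒜 hU hπH⟩,
    fun Φ h => SDarboux_eq_Scov h𝒜 hU hπH h,
    fun Φ h => ?_,
    fun Φ h => Scov_eq_ScovForms h𝒜 hU hπH h,
    fun φ hφ Φ h τ => covDensity_pull π H hφ (h.1.X_differentiable _)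
      (h.1.Ap0.smooth.differentiable (by norm_num) _)
      (h.1.Ap1.smooth.differentiable (by norm_num) _),
    fun φ _ V W _ _ τ => canDensity_pull _ _ τ,
    fun ψ hψ Φ h p hp => ?_⟩
  · funext i σ
    rw [T1_eq hπH.H_anti_right h]
    simp [SX, darbouxShift]
  · funext i σ
    rw [T1_eq hπH.H_anti_right h, primA_eq (h.1.hasGhosts σ) (h.1.X_differentiable σ)
      (hπH.H_anti_right _ (X_mem h σ))]
    ext <;> simp [SA, darbouxShift]
  · funext i σ
    rw [T2_eq h𝒜 h.1, secX_eq (h.1.hasGhosts σ)]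
  · funext i σ
    rw [T2_eq h𝒜 h.1, secA_eq h𝒜 (h.1.hasGhosts σ)]
  · rw [T1_eq hπH.H_anti_right h]
    apply BVField.ext <;> funext σ i <;> simp [darbouxShift]
  · rw [T2_eq h𝒜 h.1]
    apply BVField.ext <;> funext σ i <;> simp [hamLam, sub_eq_add_neg]
  · rw [SGD_eq_SDarboux h𝒜 hU hπH h]
    exact SDarboux_eq_Scov h𝒜 hU hπH ((bijOn_T1 hπH).mapsTo h)
  · have hnhds : solidTorus ∈ nhds (ψ p) :=
      Filter.mem_of_superset ((Metric.isOpen_ball.prod isOpen_univ).mem_nhds hp)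
        (Set.prod_mono Metric.ball_subset_closedBall subset_rfl)
    have hU' : Φ.XN (ψ p) ∈ U := h.2 _ (mem_of_mem_nhds hnhds)
    exact wzDensity_comp H (hψ.differentiable (by norm_num) p)
      ((h.1.XN_smooth.contDiffAt hnhds).differentiableAt (by norm_num))
      (hπH.H_anti_left _ hU') (hπH.H_anti_right _ hU')
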